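/- For $1\le q<\infty$ and an open set $\Omega\subseteq\mathbb R^2$, let $W^{1,q}(\Omega)$ be the space of real functions in $L^q(\Omega)$ whose distributional gradient belongs to $L^q(\Omega;\mathbb R^2)$. For $1\le p<2$, let $\mathcal A_p(\mathbb R^2)$ be the class of bounded open sets $\Omega\subseteq\mathbb R^2$ with the following property: if $\{K_i\}_{i\in I}$ denotes the family of connected components of $\Omega^c=\mathbb R^2\setminus\Omega$, then one can choose a point $x_i\in K_i$ for every $i\in I$ in such a way that $\mathcal H^{2-p}(\{x_i : i\in I\})=0$, where $\mathcal H^{\alpha}$ is the $\alpha$-dimensional Hausdorff measure. Theorem. Let $1\le p<2$ and let $\Omega\in\mathcal A_p(\mathbb R^2)$. Then for every $u\in W^{1,p}(\Omega)$ there exists a sequence $(u_n)_{n\in\mathbb N}$ in $W^{1,2}(\Omega)$ such that $$\nabla u_n\to\nabla u\qquad\text{strongly in }L^p(\Omega;\mathbb R^2).$$ -/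

import Mathlib

open MeasureTheory Filter Topology
open scoped ContDiff

/-- Euclidean space `ℝ^N`, with the Euclidean norm and Lebesgue measure. -/
abbrev Euc (N : ℕ) : Type := EuclideanSpace ℝ (Fin N)

/-- `g` is the gradient of `u` on the open set `Ω` in the sense of distributions:
`u` and `g` are locally integrable on `Ω`, and for every test function `η ∈ C_c^∞(Ω)` and every
coordinate `i` one has `∫_Ω u ∂_i η = - ∫_Ω g_i η`. -/
structure HasWeakGradient {N : ℕ} (Ω : Set (Euc N)) (u : Euc N → ℝ) (g : Euc N → Euc N) :
    Prop where
  locallyIntegrable : LocallyIntegrableOn u Ω volume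
  locallyIntegrable_grad : LocallyIntegrableOn g Ω volume
  integral_eq : ∀ η : Euc N → ℝ, ContDiff ℝ ∞ η → HasCompactSupport η → tsupport η ⊆ Ω →
    ∀ i : Fin N,
      ∫ x in Ω, u x * fderiv ℝ η x (EuclideanSpace.single i 1) = - ∫ x in Ω, g x i * η x

/-- `u ∈ W^{1,q}(Ω)`: `u` lies in `L^q(Ω)` and its distributional gradient lies in
`L^q(Ω; ℝ^N)`. Functions are defined on all of `ℝ^N`, but only their values on `Ω` matter. -/
def MemSobolev {N : ℕ} (q : ENNReal) (Ω : Set (Euc N)) (u : Euc N → ℝ) : Prop :=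
  MemLp u q (volume.restrict Ω) ∧
    ∃ g : Euc N → Euc N, HasWeakGradient Ω u g ∧ MemLp g q (volume.restrict Ω)

/-- The class `𝒜_p(ℝ²)` of admissible domains: bounded open sets `Ω ⊆ ℝ²` for which one can
select a point `s K` in each connected component `K` of `Ωᶜ` so that the set of all selected
points has zero `(2 - p)`-dimensional Hausdorff measure. -/
structure AdmissibleDomain (p : ℝ) (Ω : Set (Euc 2)) : Prop where
  isOpen : IsOpen Ω
  isBounded : Bornology.IsBounded Ω
  exists_selection : ∃ s : ConnectedComponents (Ωᶜ : Set (Euc 2)) → (Ωᶜ : Set (Euc 2)),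
    (∀ K, ConnectedComponents.mk (s K) = K) ∧
      μH[2 - p] (Set.range fun K => (s K : Euc 2)) = 0

/-!
# Density of gradients of `W^{1,2}` among gradients of `W^{1,p}` on rough plane domains

The proof is by duality. By the Hahn–Banach theorem it suffices that every field `Φ ∈ L^q(Ω)`, with
`q` conjugate to `p`, which annihilates the gradients of `W^{1,2}(Ω)` also annihilates the weak
gradients belonging to `L^p(Ω)` (`exists_eLpNorm_sub_lt_of_orthogonal`,
`OrthogonalToGradients.integral_inner_eq_zero`). Here a functional on `L^p` is represented through
its restriction to the Hilbert space `L²`.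

Such a `Φ`, extended by zero, is divergence-free in the plane, so it has a stream function `ψ`, the
limit of the stream functions of the mollifications of `Φ`. As `q > 2`, Morrey's estimate applies:
`ψ` is continuous, and summing the estimate over disjoint dyadic squares shows that `ψ` maps
`H^{2-p}`-null sets to Lebesgue null sets (`volume_image_eq_zero_of_tendsto`). Moreover `ψ` is
constant on each connected component `K` of the complement of `Ω`
(`eq_of_isPreconnected_compl`): by a Helmholtz decomposition, `Φ` is also an `L²` limit of
divergence-free fields compactly supported in `Ω`, whose stream functions are constant on `K` and,
along a fast converging sequence, converge on almost every line parallel to an axis, up to additive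
constants independent of the line; these lines meet a nontrivial `K` in a dense set. As the
selected points of the components form an `H^{2-p}`-null set, `ψ` maps the whole complement of `Ω`
to a null set `L` (`AdmissibleDomain.volume_image_compl_eq_zero`).

If `χ` is a smooth function vanishing near (a compact part of) `L`, then `χ(ψ) Φ` is approximated
by the fields `χ(ψₙ) Φₙ` built from the mollifications, which are divergence-free since `∇ψₙ` is
orthogonal to `Φₙ`, and have compact support in `Ω`. Hence a weak gradient `g ∈ L^p` is orthogonal
to `χ(ψ) Φ`, and to `Φ` restricted to `{ψ ∉ L}` in the limit
(`StreamApprox.integral_indicator_eq_zero`). Finally `Φ = 0` almost everywhere on `{ψ ∈ L}`,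
because `|∇ψ| = |Φ|` and `L` is null (`StreamApprox.ae_eq_zero_of_mem`).

The Helmholtz decomposition needs that an `L²` field orthogonal to the divergence-free test fields
is a gradient. To obtain this without the regularity theory of distributions, the potential is
constructed from the pairings of the field with explicit fields whose divergence is a difference of
mollifiers (`exists_primitive_of_orthogonal`).
-/

/-! ### A radial mollifier in the plane -/

/-- A smooth bump on `ℝ`, supported in `(1/4, 3/4)`; it is evaluated at `‖z‖ ^ 2`. -/
noncomputable def radialProfile : ContDiffBump (1 / 2 : ℝ) :=
  ⟨1 / 8, 1 / 4, by norm_num, by norm_num⟩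

/-- The primitive of `radialProfile` vanishing at `0`. -/
noncomputable def radialPrimitive (s : ℝ) : ℝ := ∫ t in (0 : ℝ)..s, radialProfile t

/-- `radialPrimitive s / s`; it vanishes near `0` and is smooth. -/
noncomputable def radialQuotient (s : ℝ) : ℝ := radialPrimitive s / s

/-- The primitive of `radialQuotient` vanishing at `1`: a smooth function which for `s ≥ 1` is a
multiple of `log s`. -/
noncomputable def radialLog (s : ℝ) : ℝ := ∫ t in (1 : ℝ)..s, radialQuotient t

lemma radialProfile_eq_zero_of_le {s : ℝ} (hs : s ≤ 1 / 4) : radialProfile s = 0 := by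
  apply radialProfile.zero_of_le_dist
  rw [Real.dist_eq, abs_of_nonpos (by linarith)]
  show (1 / 4 : ℝ) ≤ _
  linarith

lemma radialProfile_eq_zero_of_ge {s : ℝ} (hs : 3 / 4 ≤ s) : radialProfile s = 0 := by
  apply radialProfile.zero_of_le_dist
  rw [Real.dist_eq, abs_of_nonneg (by linarith)]
  show (1 / 4 : ℝ) ≤ _
  linarith

lemma contDiff_radialProfile : ContDiff ℝ ∞ radialProfile := radialProfile.contDiff

lemma hasDerivAt_radialPrimitive (s : ℝ) :
    HasDerivAt radialPrimitive (radialProfile s) s :=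
  intervalIntegral.integral_hasDerivAt_right
    (contDiff_radialProfile.continuous.intervalIntegrable _ _)
    (contDiff_radialProfile.continuous.stronglyMeasurableAtFilter _ _)
    contDiff_radialProfile.continuous.continuousAt

lemma contDiff_radialPrimitive : ContDiff ℝ ∞ radialPrimitive := by
  rw [contDiff_infty_iff_deriv]
  refine ⟨fun s => (hasDerivAt_radialPrimitive s).differentiableAt, ?_⟩
  rw [show deriv radialPrimitive = radialProfile from
    funext fun s => (hasDerivAt_radialPrimitive s).deriv]
  exact contDiff_radialProfile

lemma radialPrimitive_eq_zero {s : ℝ} (hs : s ≤ 1 / 4) : radialPrimitive s = 0 := by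
  unfold radialPrimitive
  rw [intervalIntegral.integral_zero_ae]
  refine Eventually.of_forall fun t ht => radialProfile_eq_zero_of_le ?_
  have := ht.2
  exact this.trans (max_le (by norm_num) hs)

lemma radialPrimitive_eq_of_one_le {s : ℝ} (hs : 1 ≤ s) :
    radialPrimitive s = radialPrimitive 1 := by
  unfold radialPrimitive
  rw [← intervalIntegral.integral_add_adjacent_intervals (b := 1)
    (contDiff_radialProfile.continuous.intervalIntegrable _ _)
    (contDiff_radialProfile.continuous.intervalIntegrable _ _)]
  rw [intervalIntegral.integral_zero_ae (a := 1), add_zero]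
  refine Eventually.of_forall fun t ht => radialProfile_eq_zero_of_ge ?_
  have := ht.1
  rw [min_eq_left hs] at this
  linarith

lemma mul_radialQuotient (s : ℝ) : s * radialQuotient s = radialPrimitive s := by
  unfold radialQuotient
  rcases eq_or_ne s 0 with rfl | hs
  · simp [radialPrimitive_eq_zero (show (0 : ℝ) ≤ 1 / 4 by norm_num)]
  · field_simp

lemma contDiff_radialQuotient : ContDiff ℝ ∞ radialQuotient := by
  rw [contDiff_iff_contDiffAt]
  intro s
  rcases eq_or_ne s 0 with rfl | hs
  · have : radialQuotient =ᶠ[𝓝 0] fun _ => 0 := by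
      filter_upwards [Iio_mem_nhds (show (0 : ℝ) < 1 / 4 by norm_num)] with t ht
      simp [radialQuotient, radialPrimitive_eq_zero (le_of_lt ht)]
    exact contDiffAt_const.congr_of_eventuallyEq this
  · exact contDiff_radialPrimitive.contDiffAt.div contDiffAt_id hs

lemma hasDerivAt_radialLog (s : ℝ) : HasDerivAt radialLog (radialQuotient s) s :=
  intervalIntegral.integral_hasDerivAt_right
    (contDiff_radialQuotient.continuous.intervalIntegrable _ _)
    (contDiff_radialQuotient.continuous.stronglyMeasurableAtFilter _ _)
    contDiff_radialQuotient.continuous.continuousAt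

lemma contDiff_radialLog : ContDiff ℝ ∞ radialLog := by
  rw [contDiff_infty_iff_deriv]
  refine ⟨fun s => (hasDerivAt_radialLog s).differentiableAt, ?_⟩
  rw [show deriv radialLog = radialQuotient from
    funext fun s => (hasDerivAt_radialLog s).deriv]
  exact contDiff_radialQuotient

lemma radialLog_eq {s : ℝ} (hs : 1 ≤ s) : radialLog s = radialPrimitive 1 * Real.log s := by
  unfold radialLog
  rw [intervalIntegral.integral_congr (g := fun t => radialPrimitive 1 * t⁻¹)]
  · rw [intervalIntegral.integral_const_mul, integral_inv_of_pos one_pos (by linarith), div_one]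
  · intro t ht
    rw [Set.uIcc_of_le hs] at ht
    simp only [radialQuotient, radialPrimitive_eq_of_one_le ht.1, div_eq_mul_inv]

/-- The integral of `radialProfile (‖z‖ ^ 2)` over the plane, which normalizes the mollifier. -/
noncomputable def mollMass : ℝ := ∫ z : Euc 2, radialProfile (‖z‖ ^ 2)

/-- The mollifier at scale `ε`: a nonnegative smooth radial function of integral one, supported in
the closed ball of radius `ε`. -/
noncomputable def moll (ε : ℝ) (z : Euc 2) : ℝ :=
  mollMass⁻¹ * ((ε ^ 2)⁻¹ * radialProfile (‖ε⁻¹ • z‖ ^ 2))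

lemma contDiff_moll (ε : ℝ) : ContDiff ℝ ∞ (moll ε) := by
  unfold moll
  have : ContDiff ℝ ∞ fun z : Euc 2 => ‖ε⁻¹ • z‖ ^ 2 :=
    (contDiff_const_smul _).norm_sq ℝ
  exact contDiff_const.mul (contDiff_const.mul (contDiff_radialProfile.comp this))

lemma moll_eq_zero {ε : ℝ} (hε : 0 < ε) {z : Euc 2} (hz : ε ≤ ‖z‖) : moll ε z = 0 := by
  unfold moll
  rw [radialProfile_eq_zero_of_ge, mul_zero, mul_zero]
  rw [norm_smul, norm_inv, Real.norm_of_nonneg hε.le]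
  have : 1 ≤ ε⁻¹ * ‖z‖ := by
    rw [inv_mul_eq_div, le_div_iff₀ hε]; linarith
  nlinarith

lemma support_moll_subset {ε : ℝ} (hε : 0 < ε) :
    Function.support (moll ε) ⊆ Metric.closedBall 0 ε := by
  intro z hz
  rw [mem_closedBall_zero_iff]
  by_contra h
  exact hz (moll_eq_zero hε (not_le.1 h).le)

lemma hasCompactSupport_moll {ε : ℝ} (hε : 0 < ε) : HasCompactSupport (moll ε) :=
  HasCompactSupport.of_support_subset_isCompact (isCompact_closedBall _ _) (support_moll_subset hε)

lemma integrable_moll {ε : ℝ} (hε : 0 < ε) : Integrable (moll ε) :=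
  (contDiff_moll ε).continuous.integrable_of_hasCompactSupport (hasCompactSupport_moll hε)

lemma mollMass_pos : 0 < mollMass := by
  unfold mollMass
  have hc : Continuous fun z : Euc 2 => radialProfile (‖z‖ ^ 2) := by
    have := contDiff_radialProfile.continuous
    fun_prop
  have hs : HasCompactSupport fun z : Euc 2 => radialProfile (‖z‖ ^ 2) := by
    refine HasCompactSupport.intro (isCompact_closedBall (0 : Euc 2) 1) fun z hz => ?_
    rw [mem_closedBall_zero_iff, not_le] at hz
    exact radialProfile_eq_zero_of_ge (by nlinarith)
  refine hc.integral_pos_of_hasCompactSupport_nonneg_nonzero hs (fun z => radialProfile.nonneg)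
    (x := EuclideanSpace.single 0 (Real.sqrt (1 / 2))) ?_
  rw [PiLp.norm_single, Real.norm_of_nonneg (Real.sqrt_nonneg _),
    Real.sq_sqrt (by norm_num)]
  rw [radialProfile.one_of_mem_closedBall (Metric.mem_closedBall_self radialProfile.rIn_pos.le)]
  norm_num

lemma moll_nonneg (ε : ℝ) (z : Euc 2) : 0 ≤ moll ε z :=
  mul_nonneg (inv_nonneg.2 mollMass_pos.le)
    (mul_nonneg (inv_nonneg.2 (sq_nonneg _)) radialProfile.nonneg)

lemma moll_neg (ε : ℝ) (z : Euc 2) : moll ε (-z) = moll ε z := by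
  simp [moll]

lemma integral_moll {ε : ℝ} (hε : 0 < ε) : ∫ z, moll ε z = 1 := by
  unfold moll
  rw [integral_const_mul, integral_const_mul,
    Measure.integral_comp_inv_smul volume (fun z : Euc 2 => radialProfile (‖z‖ ^ 2)) ε]
  rw [show (∫ z : Euc 2, radialProfile (‖z‖ ^ 2)) = mollMass from rfl]
  simp only [finrank_euclideanSpace, Fintype.card_fin, smul_eq_mul, abs_of_pos (pow_pos hε 2)]
  have := mollMass_pos.ne'
  field_simp

/-! ### Divergence of plane fields -/

/-- The pointwise divergence of a differentiable plane field. -/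
noncomputable def dvg (F : Euc 2 → Euc 2) (x : Euc 2) : ℝ :=
  fderiv ℝ F x (EuclideanSpace.single 0 1) 0 + fderiv ℝ F x (EuclideanSpace.single 1 1) 1

lemma dvg_add {F G : Euc 2 → Euc 2} {x : Euc 2} (hF : DifferentiableAt ℝ F x)
    (hG : DifferentiableAt ℝ G x) : dvg (F + G) x = dvg F x + dvg G x := by
  simp [dvg, fderiv_add hF hG]; ring

lemma dvg_neg {F : Euc 2 → Euc 2} {x : Euc 2} : dvg (-F) x = - dvg F x := by
  simp [dvg, fderiv_neg]; ring

lemma dvg_sub {F G : Euc 2 → Euc 2} {x : Euc 2} (hF : DifferentiableAt ℝ F x)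
    (hG : DifferentiableAt ℝ G x) : dvg (F - G) x = dvg F x - dvg G x := by
  simp [dvg, fderiv_sub hF hG]; ring

lemma dvg_smul {f : Euc 2 → ℝ} {F : Euc 2 → Euc 2} {x : Euc 2} (hf : DifferentiableAt ℝ f x)
    (hF : DifferentiableAt ℝ F x) :
    dvg (fun y => f y • F y) x = f x * dvg F x + fderiv ℝ f x (F x) := by
  have hFx : F x = F x 0 • EuclideanSpace.single 0 1 + F x 1 • EuclideanSpace.single 1 1 := by
    ext i; fin_cases i <;> simp
  have h2 : fderiv ℝ f x (F x) = F x 0 * fderiv ℝ f x (EuclideanSpace.single 0 1)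
      + F x 1 * fderiv ℝ f x (EuclideanSpace.single 1 1) := by
    conv_lhs => rw [hFx]
    simp
  rw [h2]
  simp [dvg, fderiv_fun_smul hf hF]
  ring

/-- The difference of two mollifiers is the Laplacian of a compactly supported function `σ`; `F` is
the gradient of `σ`. -/
lemma exists_potential_moll_sub {s t : ℝ} (hs : 0 < s) (ht : 0 < t) :
    ∃ (σ : Euc 2 → ℝ) (F : Euc 2 → Euc 2), ContDiff ℝ ∞ σ ∧ ContDiff ℝ ∞ F ∧
      (∀ z, max s t ≤ ‖z‖ → σ z = 0) ∧ (∀ z v, fderiv ℝ σ z v = inner ℝ (F z) v) ∧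
      ∀ z, dvg F z = moll s z - moll t z := by
  -- Radial functions: `Δ (ℓ (‖z‖²)) = 4 (s ℓ'(s))'` at `s = ‖z‖²`, and `s ℓ' = radialPrimitive`
  -- for `ℓ = radialLog`. Outside the ball of radius `r` the function `γ r` is a multiple of
  -- `log ‖z‖` independent of `r`.
  let γ : ℝ → Euc 2 → ℝ := fun r z =>
    (4 * mollMass)⁻¹ * (radialLog (‖z‖ ^ 2 * (r ^ 2)⁻¹) + radialPrimitive 1 * Real.log (r ^ 2))
  let T : ℝ → Euc 2 → Euc 2 := fun r z =>
    ((2 * mollMass)⁻¹ * (r ^ 2)⁻¹ * radialQuotient (‖z‖ ^ 2 * (r ^ 2)⁻¹)) • z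
  have hsq : ∀ r : ℝ, ContDiff ℝ ∞ fun z : Euc 2 => ‖z‖ ^ 2 * (r ^ 2)⁻¹ := fun r =>
    (contDiff_id.norm_sq ℝ).mul contDiff_const
  have hsq' : ∀ (r : ℝ) (z : Euc 2), HasFDerivAt (fun z : Euc 2 => ‖z‖ ^ 2 * (r ^ 2)⁻¹)
      ((r ^ 2)⁻¹ • (2 • innerSL ℝ z)) z := fun r z =>
    (hasStrictFDerivAt_norm_sq z).hasFDerivAt.mul_const _
  have hγ : ∀ r, ContDiff ℝ ∞ (γ r) := fun r =>
    contDiff_const.mul ((contDiff_radialLog.comp (hsq r)).add contDiff_const)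
  have hq : ∀ r, ContDiff ℝ ∞ fun z : Euc 2 => (2 * mollMass)⁻¹ * (r ^ 2)⁻¹ *
      radialQuotient (‖z‖ ^ 2 * (r ^ 2)⁻¹) := fun r =>
    contDiff_const.mul (contDiff_radialQuotient.comp (hsq r))
  have hT : ∀ r, ContDiff ℝ ∞ (T r) := fun r => (hq r).smul contDiff_id
  have hm := mollMass_pos.ne'
  have hγ' : ∀ r z v, fderiv ℝ (γ r) z v = inner ℝ (T r z) v := by
    intro r z v
    have h1 := (((hasDerivAt_radialLog (‖z‖ ^ 2 * (r ^ 2)⁻¹)).comp_hasFDerivAt z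
      (hsq' r z)).add_const (radialPrimitive 1 * Real.log (r ^ 2))).const_mul (4 * mollMass)⁻¹
    have h2 : HasFDerivAt (γ r) _ z := h1
    rw [h2.fderiv]
    simp only [T, smul_apply, innerSL_apply_apply, smul_eq_mul,
      real_inner_smul_left, nsmul_eq_mul]
    push_cast
    field_simp
    ring
  have hdT : ∀ r, 0 < r → ∀ z, dvg (T r) z = moll r z := by
    intro r hr z
    have h0 : DifferentiableAt ℝ radialQuotient (‖z‖ ^ 2 * (r ^ 2)⁻¹) :=
      (contDiff_radialQuotient.differentiable (by simp)).differentiableAt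
    have h1 : HasFDerivAt (fun z : Euc 2 => (2 * mollMass)⁻¹ * (r ^ 2)⁻¹ *
        radialQuotient (‖z‖ ^ 2 * (r ^ 2)⁻¹)) _ z :=
      ((h0.hasDerivAt.comp_hasFDerivAt z (hsq' r z)).const_mul ((2 * mollMass)⁻¹ * (r ^ 2)⁻¹))
    have h2 : radialQuotient (‖z‖ ^ 2 * (r ^ 2)⁻¹) + ‖z‖ ^ 2 * (r ^ 2)⁻¹ *
        deriv radialQuotient (‖z‖ ^ 2 * (r ^ 2)⁻¹) = radialProfile (‖z‖ ^ 2 * (r ^ 2)⁻¹) := by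
      have h3 : HasDerivAt (fun s => s * radialQuotient s) _ (‖z‖ ^ 2 * (r ^ 2)⁻¹) :=
        (hasDerivAt_id _).mul h0.hasDerivAt
      rw [show (fun s => s * radialQuotient s) = radialPrimitive from
        funext mul_radialQuotient] at h3
      have := h3.unique (hasDerivAt_radialPrimitive _)
      simpa using this
    show dvg (fun z => ((2 * mollMass)⁻¹ * (r ^ 2)⁻¹ *
      radialQuotient (‖z‖ ^ 2 * (r ^ 2)⁻¹)) • z) z = _
    rw [dvg_smul h1.differentiableAt differentiableAt_fun_id, h1.fderiv]
    have h4 : dvg (fun z : Euc 2 => z) z = 2 := by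
      simp [dvg]; norm_num
    rw [h4]
    have h5 : moll r z = mollMass⁻¹ * ((r ^ 2)⁻¹ * radialProfile (‖z‖ ^ 2 * (r ^ 2)⁻¹)) := by
      simp only [moll, norm_smul, mul_pow, norm_inv, Real.norm_eq_abs, inv_pow, sq_abs]
      rw [mul_comm (r ^ 2)⁻¹ (‖z‖ ^ 2)]
    rw [h5, ← h2]
    simp only [smul_apply, innerSL_apply_apply, smul_eq_mul,
      nsmul_eq_mul, real_inner_self_eq_norm_sq]
    push_cast
    field_simp
  refine ⟨γ s - γ t, T s - T t, (hγ s).sub (hγ t), (hT s).sub (hT t), ?_, ?_, ?_⟩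
  · intro z hz
    have key : ∀ r, 0 < r → r ≤ ‖z‖ →
        γ r z = (4 * mollMass)⁻¹ * (radialPrimitive 1 * Real.log (‖z‖ ^ 2)) := by
      intro r hr hrz
      have hz2 : 0 < ‖z‖ := hr.trans_le hrz
      have : (1 : ℝ) ≤ ‖z‖ ^ 2 * (r ^ 2)⁻¹ := by
        rw [← div_eq_mul_inv, le_div_iff₀ (by positivity)]
        nlinarith
      simp only [γ]
      rw [radialLog_eq this, Real.log_mul (by positivity) (by positivity), Real.log_inv]
      ring
    simp only [Pi.sub_apply]
    rw [key s hs ((le_max_left _ _).trans hz), key t ht ((le_max_right _ _).trans hz), sub_self]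
  · intro z v
    rw [fderiv_sub ((hγ s).differentiable (by simp)).differentiableAt
      ((hγ t).differentiable (by simp)).differentiableAt]
    simp only [sub_apply, hγ', Pi.sub_apply, inner_sub_left]
  · intro z
    rw [dvg_sub ((hT s).differentiable (by simp)).differentiableAt
      ((hT t).differentiable (by simp)).differentiableAt, hdT s hs, hdT t ht]

/-! ### Mollification -/

section Mollify

variable {F : Type*} [NormedAddCommGroup F] [NormedSpace ℝ F]

/-- The mollification at scale `ε` of a function on the plane. -/
noncomputable def mollify (ε : ℝ) (f : Euc 2 → F) : Euc 2 → F :=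
  convolution (moll ε) f (ContinuousLinearMap.lsmul ℝ ℝ) volume

lemma mollify_apply' (ε : ℝ) (f : Euc 2 → F) (x : Euc 2) :
    mollify ε f x = ∫ y, moll ε y • f (x - y) := rfl

lemma mollify_apply (ε : ℝ) (f : Euc 2 → F) (x : Euc 2) :
    mollify ε f x = ∫ y, moll ε (x - y) • f y := by
  unfold mollify
  rw [convolution_eq_swap]
  rfl

lemma contDiff_mollify {ε : ℝ} (hε : 0 < ε) {f : Euc 2 → F} (hf : LocallyIntegrable f) :
    ContDiff ℝ ∞ (mollify ε f) :=
  (hasCompactSupport_moll hε).contDiff_convolution_left _ (contDiff_moll ε) hf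

lemma integrable_moll_smul {ε : ℝ} (hε : 0 < ε) {f : Euc 2 → F} (hf : LocallyIntegrable f)
    (x : Euc 2) : Integrable fun y => moll ε (x - y) • f y := by
  have hc : HasCompactSupport fun y => moll ε (x - y) :=
    (hasCompactSupport_moll hε).comp_homeomorph (Homeomorph.subLeft x)
  have hcont : Continuous fun y => moll ε (x - y) :=
    (contDiff_moll ε).continuous.comp (continuous_const.sub continuous_id)
  exact hf.integrable_smul_left_of_hasCompactSupport hcont hc

lemma fderiv_mollify {ε : ℝ} (hε : 0 < ε) {f : Euc 2 → F} (hf : LocallyIntegrable f)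
    (x v : Euc 2) :
    fderiv ℝ (mollify ε f) x v = ∫ y, (fderiv ℝ (moll ε) (x - y) v) • f y := by
  have h := (hasCompactSupport_moll hε).hasFDerivAt_convolution_left
    (ContinuousLinearMap.lsmul ℝ ℝ : ℝ →L[ℝ] F →L[ℝ] F) ((contDiff_moll ε).of_le (by simp)) hf x
  have h' : HasFDerivAt (mollify ε f) _ x := h
  rw [h'.fderiv, convolution_eq_swap, ContinuousLinearMap.integral_apply]
  · rfl
  · have hc : HasCompactSupport fun y => fderiv ℝ (moll ε) (x - y) :=
      ((hasCompactSupport_moll hε).fderiv ℝ).comp_homeomorph (Homeomorph.subLeft x)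
    have hcont : Continuous fun y => fderiv ℝ (moll ε) (x - y) :=
      ((contDiff_moll ε).continuous_fderiv (by simp)).comp (continuous_const.sub continuous_id)
    have := ((hasCompactSupport_moll hε).fderiv ℝ).convolutionExists_left
      ((ContinuousLinearMap.lsmul ℝ ℝ : ℝ →L[ℝ] F →L[ℝ] F).precompL (Euc 2))
      ((contDiff_moll ε).continuous_fderiv (by simp)) hf x
    exact this.integrable_swap

/-- A mollification at scale `ε` vanishes where the function vanishes in the ball of radius
`ε`. -/
lemma mollify_eq_zero {ε : ℝ} (hε : 0 < ε) {f : Euc 2 → F} {x : Euc 2}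
    (h : ∀ y, dist x y < ε → f y = 0) : mollify ε f x = 0 := by
  rw [mollify_apply]
  refine integral_eq_zero_of_ae (Eventually.of_forall fun y => ?_)
  rcases lt_or_ge (dist x y) ε with h1 | h1
  · simp [h y h1]
  · rw [dist_eq_norm] at h1
    simp [moll_eq_zero hε h1]

lemma mollify_sub {ε : ℝ} (hε : 0 < ε) {f g : Euc 2 → F} (hf : LocallyIntegrable f)
    (hg : LocallyIntegrable g) : mollify ε (f - g) = mollify ε f - mollify ε g := by
  funext x
  simp only [Pi.sub_apply, mollify_apply, smul_sub]
  exact integral_sub (integrable_moll_smul hε hf x) (integrable_moll_smul hε hg x)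

/-- The probability measure with density `moll ε`. -/
noncomputable def mollMeasure (ε : ℝ) : Measure (Euc 2) :=
  volume.withDensity fun y => ENNReal.ofReal (moll ε y)

lemma isProbabilityMeasure_mollMeasure {ε : ℝ} (hε : 0 < ε) :
    IsProbabilityMeasure (mollMeasure ε) := by
  refine ⟨?_⟩
  rw [mollMeasure, withDensity_apply _ MeasurableSet.univ, Measure.restrict_univ,
    ← ofReal_integral_eq_lintegral_ofReal (integrable_moll hε)
      (Eventually.of_forall (moll_nonneg ε)), integral_moll hε, ENNReal.ofReal_one]

lemma measurable_ofReal_moll (ε : ℝ) : Measurable fun y => ENNReal.ofReal (moll ε y) :=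
  (contDiff_moll ε).continuous.measurable.ennreal_ofReal

/-- Writing the mollification as an average for a probability measure gives access to Jensen's
inequality. -/
lemma enorm_mollify_le {ε : ℝ} (f : Euc 2 → F) (x : Euc 2) :
    ‖mollify ε f x‖ₑ ≤ ∫⁻ y, ‖f (x - y)‖ₑ ∂(mollMeasure ε) := by
  rw [mollify_apply', mollMeasure, lintegral_withDensity_eq_lintegral_mul_non_measurable _
    (measurable_ofReal_moll ε) (Eventually.of_forall fun _ => ENNReal.ofReal_lt_top)]
  refine (enorm_integral_le_lintegral_enorm _).trans (lintegral_mono fun y => ?_)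
  rw [enorm_smul, Real.enorm_of_nonneg (moll_nonneg ε y)]
  rfl

/-- Mollification does not increase the norm of `L^q`. -/
lemma eLpNorm_mollify_le {ε : ℝ} (hε : 0 < ε) {f : Euc 2 → F} {q : ENNReal} (hq : 1 ≤ q)
    (hf : AEStronglyMeasurable f) : eLpNorm (mollify ε f) q volume ≤ eLpNorm f q volume := by
  have hP := isProbabilityMeasure_mollMeasure hε
  rcases eq_or_ne q ⊤ with rfl | hqt
  · rw [eLpNorm_exponent_top, eLpNorm_exponent_top]
    refine eLpNormEssSup_le_of_ae_enorm_bound (Eventually.of_forall fun x => ?_)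
    refine (enorm_mollify_le f x).trans ?_
    have h1 : ∀ᵐ y, ‖f (x - y)‖ₑ ≤ eLpNormEssSup f volume :=
      (Measure.measurePreserving_sub_left volume x).quasiMeasurePreserving.ae
        (ae_le_eLpNormEssSup (f := f) (μ := volume))
    have h2 : ∀ᵐ y ∂(mollMeasure ε), ‖f (x - y)‖ₑ ≤ eLpNormEssSup f volume :=
      (withDensity_absolutelyContinuous _ _).ae_le h1
    calc ∫⁻ y, ‖f (x - y)‖ₑ ∂(mollMeasure ε)
        ≤ ∫⁻ _, eLpNormEssSup f volume ∂(mollMeasure ε) := lintegral_mono_ae h2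
      _ = _ := by simp
  · have hq0 : q ≠ 0 := (one_pos.trans_le hq).ne'
    have hqr : 1 ≤ q.toReal := by
      rw [← ENNReal.toReal_one]; exact ENNReal.toReal_mono hqt hq
    rw [eLpNorm_eq_lintegral_rpow_enorm_toReal hq0 hqt,
      eLpNorm_eq_lintegral_rpow_enorm_toReal hq0 hqt]
    refine ENNReal.rpow_le_rpow ?_ (by positivity)
    have hmeas : AEMeasurable (fun z : Euc 2 × Euc 2 => ‖f (z.1 - z.2)‖ₑ ^ q.toReal)
        (volume.prod (mollMeasure ε)) := by
      have h1 : AEStronglyMeasurable (fun z : Euc 2 × Euc 2 => f (z.1 - z.2))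
          (volume.prod volume) :=
        hf.comp_quasiMeasurePreserving (quasiMeasurePreserving_sub volume volume)
      have h2 : AEStronglyMeasurable (fun z : Euc 2 × Euc 2 => f (z.1 - z.2))
          (volume.prod (mollMeasure ε)) :=
        h1.mono_ac (Measure.AbsolutelyContinuous.rfl.prod (withDensity_absolutelyContinuous _ _))
      exact h2.enorm.pow_const _
    calc ∫⁻ x, ‖mollify ε f x‖ₑ ^ q.toReal
        ≤ ∫⁻ x, ∫⁻ y, ‖f (x - y)‖ₑ ^ q.toReal ∂(mollMeasure ε) := by
          refine lintegral_mono fun x => ?_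
          refine (ENNReal.rpow_le_rpow (enorm_mollify_le f x) (by positivity)).trans ?_
          have h3 : AEStronglyMeasurable (fun y => f (x - y)) (mollMeasure ε) :=
            (hf.comp_quasiMeasurePreserving
              (Measure.measurePreserving_sub_left volume x).quasiMeasurePreserving).mono_ac
              (withDensity_absolutelyContinuous _ _)
          have h4 := eLpNorm_le_eLpNorm_of_exponent_le hq h3
          rw [eLpNorm_one_eq_lintegral_enorm, eLpNorm_eq_lintegral_rpow_enorm_toReal hq0 hqt] at h4
          refine (ENNReal.rpow_le_rpow h4 (by positivity : 0 ≤ q.toReal)).trans ?_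
          rw [← ENNReal.rpow_mul, one_div, inv_mul_cancel₀ (by positivity), ENNReal.rpow_one]
      _ = ∫⁻ y, (∫⁻ x, ‖f (x - y)‖ₑ ^ q.toReal) ∂(mollMeasure ε) := by
          rw [lintegral_lintegral_swap hmeas]
      _ = ∫⁻ y, (∫⁻ x, ‖f x‖ₑ ^ q.toReal) ∂(mollMeasure ε) := by
          refine lintegral_congr fun y => ?_
          exact lintegral_sub_right_eq_self (fun x => ‖f x‖ₑ ^ q.toReal) y
      _ = ∫⁻ x, ‖f x‖ₑ ^ q.toReal := by simp

variable [CompleteSpace F]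

/-- A mollification of a continuous function which varies little on balls of radius `ε`. -/
lemma norm_mollify_sub_le {ε : ℝ} (hε : 0 < ε) {f : Euc 2 → F} (hf : Continuous f) {x : Euc 2}
    {δ : ℝ} (h : ∀ y, dist y x < ε → ‖f y - f x‖ ≤ δ) : ‖mollify ε f x - f x‖ ≤ δ := by
  have h1 : f x = ∫ y, moll ε (x - y) • f x := by
    rw [integral_smul_const, integral_sub_left_eq_self (fun y => moll ε y), integral_moll hε,
      one_smul]
  have hi := integrable_moll_smul hε hf.locallyIntegrable x
  have hi' := integrable_moll_smul hε (f := fun _ => f x) (continuous_const.locallyIntegrable) x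
  have hi2 : Integrable fun y => moll ε (x - y) := (integrable_moll hε).comp_sub_left x
  conv_lhs => rw [h1, mollify_apply, ← integral_sub hi hi']
  calc ‖∫ y, (moll ε (x - y) • f y - moll ε (x - y) • f x)‖
      ≤ ∫ y, moll ε (x - y) * δ := by
        refine norm_integral_le_of_norm_le (hi2.mul_const δ) (Eventually.of_forall fun y => ?_)
        rw [← smul_sub, norm_smul, Real.norm_of_nonneg (moll_nonneg _ _)]
        rcases lt_or_ge (dist y x) ε with h2 | h2
        · exact mul_le_mul_of_nonneg_left (h y h2) (moll_nonneg _ _)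
        · rw [dist_comm, dist_eq_norm] at h2
          simp [moll_eq_zero hε h2]
    _ = δ := by
        rw [integral_mul_const, integral_sub_left_eq_self (fun y => moll ε y), integral_moll hε,
          one_mul]

/-- Mollifications converge in `L^q` for `1 ≤ q < ∞`. -/
lemma tendsto_eLpNorm_mollify_sub {f : Euc 2 → F} {q : ENNReal} (hq : 1 ≤ q) (hqt : q ≠ ⊤)
    (hf : MemLp f q) :
    Tendsto (fun ε => eLpNorm (mollify ε f - f) q volume) (𝓝[>] 0) (𝓝 0) := by
  rw [ENNReal.tendsto_nhds_zero]
  intro η hη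
  obtain ⟨δ, hδ, hδη⟩ : ∃ δ : ENNReal, 0 < δ ∧ δ + δ + δ ≤ η := by
    refine ⟨η / 3, ENNReal.div_pos hη.ne' (by simp), ?_⟩
    rw [ENNReal.add_thirds]
  obtain ⟨g, hgc, hfg, hg, hgL⟩ := hf.exists_hasCompactSupport_eLpNorm_sub_le hqt hδ.ne'
  set B := Metric.cthickening 1 (tsupport g) with hB
  have hBc : IsCompact B := hgc.isCompact.cthickening
  have hBv : volume B ≠ ⊤ := hBc.measure_lt_top.ne
  -- a uniform bound `τ` on the error of `g` with `τ |B|^{1/q} ≤ δ`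
  obtain ⟨τ, hτ, hτB⟩ : ∃ τ : NNReal, 0 < τ ∧ (τ : ENNReal) * volume B ^ (1 / q.toReal) ≤ δ := by
    have hne : volume B ^ (1 / q.toReal) ≠ ⊤ := ENNReal.rpow_ne_top_of_nonneg (by positivity) hBv
    have ht : Tendsto (fun τ : NNReal => (τ : ENNReal) * volume B ^ (1 / q.toReal)) (𝓝[>] 0)
        (𝓝 0) := by
      have h0 : Tendsto (fun τ : NNReal => (τ : ENNReal)) (𝓝[>] 0) (𝓝 0) := by
        have := (ENNReal.continuous_coe.tendsto (0 : NNReal)).mono_left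
          (nhdsWithin_le_nhds (s := Set.Ioi 0))
        simpa using this
      have := ENNReal.Tendsto.mul_const h0 (Or.inr hne)
      simpa using this
    obtain ⟨τ, h1, h2⟩ := ((ENNReal.tendsto_nhds_zero.1 ht δ hδ).and
      self_mem_nhdsWithin).exists
    exact ⟨τ, h2, h1⟩
  have hgu : UniformContinuous g := hg.uniformContinuous_of_tendsto_cocompact
    (hgc.is_zero_at_infty)
  obtain ⟨r, hr, hgr⟩ := Metric.uniformContinuous_iff.1 hgu τ hτ
  filter_upwards [Ioo_mem_nhdsGT (show (0 : ℝ) < min r 1 by positivity)] with ε hε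
  have hε0 := hε.1
  have hpt : ∀ x, ‖mollify ε g x - g x‖ ≤ τ := fun x =>
    norm_mollify_sub_le hε0 hg fun y hy => by
      rw [← dist_eq_norm]
      exact (hgr (hy.trans (hε.2.trans_le (min_le_left _ _)))).le
  have hsupp : ∀ x, x ∉ B → mollify ε g x - g x = 0 := by
    intro x hx
    have hfar : ∀ y, dist x y < 1 → g y = 0 := by
      intro y hy
      by_contra hne
      apply hx
      exact Metric.mem_cthickening_of_dist_le x y 1 _ (subset_tsupport g hne) hy.le
    rw [mollify_eq_zero hε0 fun y hy => hfar y (hy.trans (hε.2.trans_le (min_le_right _ _))),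
      hfar x (by simp), sub_zero]
  have hmid : eLpNorm (mollify ε g - g) q volume ≤ δ := by
    have h1 : eLpNorm (mollify ε g - g) q volume ≤
        eLpNorm (B.indicator fun _ => (τ : ℝ)) q volume := by
      refine eLpNorm_mono fun x => ?_
      by_cases hx : x ∈ B
      · simpa [hx] using hpt x
      · simp [hx, hsupp x hx]
    refine h1.trans ?_
    rw [eLpNorm_indicator_const hBc.measurableSet (one_pos.trans_le hq).ne' hqt]
    simpa using hτB
  have hfl : LocallyIntegrable f := hf.locallyIntegrable hq
  have hgl : LocallyIntegrable g := hg.locallyIntegrable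
  have h0 : mollify ε f - f = mollify ε (f - g) + (mollify ε g - g) + (g - f) := by
    rw [mollify_sub hε0 hfl hgl]; abel
  have hm1 : AEStronglyMeasurable (mollify ε (f - g)) volume :=
    (contDiff_mollify hε0 (hfl.sub hgl)).continuous.aestronglyMeasurable
  have hm2 : AEStronglyMeasurable (mollify ε g - g) volume :=
    ((contDiff_mollify hε0 hgl).continuous.sub hg).aestronglyMeasurable
  have hm3 : AEStronglyMeasurable (g - f) volume := hg.aestronglyMeasurable.sub hf.1
  rw [h0]
  refine (eLpNorm_add_le (hm1.add hm2) hm3 hq).trans ?_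
  refine le_trans (add_le_add ((eLpNorm_add_le hm1 hm2 hq).trans (add_le_add ?_ hmid)) ?_) hδη
  · exact (eLpNorm_mollify_le hε0 hq (hf.1.sub hg.aestronglyMeasurable)).trans hfg
  · rw [eLpNorm_sub_comm]; exact hfg

end Mollify

lemma dvg_mollify {ε : ℝ} (hε : 0 < ε) {Φ : Euc 2 → Euc 2} (hΦ : LocallyIntegrable Φ) (x : Euc 2) :
    dvg (mollify ε Φ) x = ∫ y, fderiv ℝ (moll ε) (x - y) (Φ y) := by
  have hint : ∀ v : Euc 2, Integrable fun y => (fderiv ℝ (moll ε) (x - y) v) • Φ y := by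
    intro v
    have hc : HasCompactSupport fun y => fderiv ℝ (moll ε) (x - y) v :=
      ((hasCompactSupport_moll hε).fderiv_apply ℝ v).comp_homeomorph (Homeomorph.subLeft x)
    have hcont : Continuous fun y => fderiv ℝ (moll ε) (x - y) v :=
      (((contDiff_moll ε).continuous_fderiv (by simp)).comp
        (continuous_const.sub continuous_id)).clm_apply continuous_const
    exact hΦ.integrable_smul_left_of_hasCompactSupport hcont hc
  have hcoord : ∀ i : Fin 2, ∀ v : Euc 2,
      (∫ y, (fderiv ℝ (moll ε) (x - y) v) • Φ y) i = ∫ y, fderiv ℝ (moll ε) (x - y) v * Φ y i := by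
    intro i v
    have := ((EuclideanSpace.proj i : Euc 2 →L[ℝ] ℝ).integral_comp_comm (hint v)).symm
    simpa using this
  have hinti : ∀ i : Fin 2, ∀ v : Euc 2,
      Integrable fun y => fderiv ℝ (moll ε) (x - y) v * Φ y i := by
    intro i v
    have := (EuclideanSpace.proj i : Euc 2 →L[ℝ] ℝ).integrable_comp (hint v)
    simpa using this
  unfold dvg
  rw [fderiv_mollify hε hΦ, fderiv_mollify hε hΦ, hcoord, hcoord,
    ← integral_add (hinti _ _) (hinti _ _)]
  refine integral_congr_ae (Eventually.of_forall fun y => ?_)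
  have hy : Φ y = Φ y 0 • EuclideanSpace.single 0 1 + Φ y 1 • EuclideanSpace.single 1 1 := by
    ext i; fin_cases i <;> simp
  have h2 : fderiv ℝ (moll ε) (x - y) (Φ y) =
      Φ y 0 * fderiv ℝ (moll ε) (x - y) (EuclideanSpace.single 0 1)
      + Φ y 1 * fderiv ℝ (moll ε) (x - y) (EuclideanSpace.single 1 1) := by
    conv_lhs => rw [hy]
    simp
  simp only [h2]
  ring

/-! ### Fields orthogonal to compactly supported gradients and divergence-free fields -/

/-- A smooth vector field with compact support in `Ω`. -/
structure TestField (Ω : Set (Euc 2)) (Ψ : Euc 2 → Euc 2) : Prop where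
  contDiff : ContDiff ℝ ∞ Ψ
  hasCompactSupport : HasCompactSupport Ψ
  tsupport_subset : tsupport Ψ ⊆ Ω

lemma TestField.add {Ω : Set (Euc 2)} {Ψ Ψ' : Euc 2 → Euc 2} (h : TestField Ω Ψ)
    (h' : TestField Ω Ψ') : TestField Ω (Ψ + Ψ') :=
  ⟨h.contDiff.add h'.contDiff, h.hasCompactSupport.add h'.hasCompactSupport,
    (tsupport_add Ψ Ψ').trans (Set.union_subset h.tsupport_subset h'.tsupport_subset)⟩

lemma TestField.neg {Ω : Set (Euc 2)} {Ψ : Euc 2 → Euc 2} (h : TestField Ω Ψ) :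
    TestField Ω (-Ψ) :=
  ⟨h.contDiff.neg, h.hasCompactSupport.neg, by rw [tsupport_neg]; exact h.tsupport_subset⟩

lemma TestField.const_smul {Ω : Set (Euc 2)} {Ψ : Euc 2 → Euc 2} (h : TestField Ω Ψ) (c : ℝ) :
    TestField Ω (c • Ψ) :=
  ⟨h.contDiff.const_smul c, h.hasCompactSupport.smul_left (f := fun _ => c),
    (tsupport_smul_subset_right (fun _ => c) Ψ).trans h.tsupport_subset⟩

lemma testField_zero {Ω : Set (Euc 2)} : TestField Ω 0 :=
  ⟨contDiff_const, HasCompactSupport.zero, by simp [tsupport]⟩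

lemma TestField.differentiableAt {Ω : Set (Euc 2)} {Ψ : Euc 2 → Euc 2} (h : TestField Ω Ψ)
    (x : Euc 2) : DifferentiableAt ℝ Ψ x :=
  (h.contDiff.differentiable (by simp)).differentiableAt

lemma integrable_inner_of_hasCompactSupport {h Ψ : Euc 2 → Euc 2} (hh : LocallyIntegrable h)
    (hΨ : Continuous Ψ) (hc : HasCompactSupport Ψ) :
    Integrable fun x => inner ℝ (h x) (Ψ x) := by
  have h1 : ∀ i : Fin 2, Integrable fun x => Ψ x i * h x i := by
    intro i
    have h2 : LocallyIntegrable fun x => h x i := fun x => by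
      obtain ⟨U, hU, hi⟩ := hh x
      refine ⟨U, hU, ?_⟩
      exact (EuclideanSpace.proj i : Euc 2 →L[ℝ] ℝ).integrable_comp hi
    have h3 : Continuous fun x => Ψ x i := by fun_prop
    have h4 : HasCompactSupport fun x => Ψ x i :=
      hc.comp_left (g := fun v : Euc 2 => v i) (by simp)
    exact h2.integrable_smul_left_of_hasCompactSupport h3 h4
  have h5 := (h1 0).add (h1 1)
  refine h5.congr (Eventually.of_forall fun x => ?_)
  simp [PiLp.inner_apply, Fin.sum_univ_two]

/-- `FluxRel Ω h f c` says that `f` is the divergence of a test field on `Ω` whose pairing with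
`h` is `c`. If `h` is orthogonal to the divergence-free test fields, `c` is determined by `f`; when
`h = ∇ V`, it is `-∫ V f`. -/
def FluxRel (Ω : Set (Euc 2)) (h : Euc 2 → Euc 2) (f : Euc 2 → ℝ) (c : ℝ) : Prop :=
  ∃ Ψ, TestField Ω Ψ ∧ (∀ x, dvg Ψ x = f x) ∧ ∫ x, inner ℝ (h x) (Ψ x) = c

lemma FluxRel.add {Ω : Set (Euc 2)} {h : Euc 2 → Euc 2} (hh : LocallyIntegrable h)
    {f f' : Euc 2 → ℝ} {c c' : ℝ} (H : FluxRel Ω h f c) (H' : FluxRel Ω h f' c') :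
    FluxRel Ω h (fun x => f x + f' x) (c + c') := by
  obtain ⟨Ψ, h1, h2, h3⟩ := H
  obtain ⟨Ψ', h1', h2', h3'⟩ := H'
  refine ⟨Ψ + Ψ', h1.add h1', fun x => ?_, ?_⟩
  · rw [dvg_add (h1.differentiableAt x) (h1'.differentiableAt x), h2, h2']
  · rw [← h3, ← h3', ← integral_add
      (integrable_inner_of_hasCompactSupport hh h1.contDiff.continuous h1.hasCompactSupport)
      (integrable_inner_of_hasCompactSupport hh h1'.contDiff.continuous h1'.hasCompactSupport)]
    simp [inner_add_right]

lemma FluxRel.neg {Ω : Set (Euc 2)} {h : Euc 2 → Euc 2} {f : Euc 2 → ℝ} {c : ℝ}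
    (H : FluxRel Ω h f c) : FluxRel Ω h (fun x => - f x) (-c) := by
  obtain ⟨Ψ, h1, h2, h3⟩ := H
  refine ⟨-Ψ, h1.neg, fun x => ?_, ?_⟩
  · rw [dvg_neg, h2]
  · rw [← h3, ← integral_neg]
    simp [inner_neg_right]

/-- Averages of a smooth function along the translates of a segment are smooth. -/
lemma contDiff_integral_segment {f : Euc 2 → ℝ} (hf : ContDiff ℝ ∞ f) (w : Euc 2) :
    ContDiff ℝ ∞ fun z => ∫ t in (0 : ℝ)..1, f (z - t • w) := by
  let cut : ContDiffBump (0 : ℝ) := ⟨1, 2, by norm_num, by norm_num⟩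
  have hg : ContDiff ℝ ∞ fun p : Euc 2 × ℝ => cut p.2 * f (p.1 + p.2 • w) :=
    (cut.contDiff.comp contDiff_snd).mul
      (hf.comp (contDiff_fst.add (contDiff_snd.smul contDiff_const)))
  have h1 : LocallyIntegrable ((Set.Ioc (0 : ℝ) 1).indicator fun _ => (1 : ℝ)) :=
    ((integrable_indicator_iff measurableSet_Ioc).2
      (integrableOn_const (by simp))).locallyIntegrable
  have := contDiffOn_convolution_right_with_param_comp (n := ⊤) (μ := (volume : Measure ℝ))
    (ContinuousLinearMap.mul ℝ ℝ) (s := (Set.univ : Set (Euc 2))) (v := fun _ => (0 : ℝ))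
    contDiffOn_const (f := (Set.Ioc (0 : ℝ) 1).indicator fun _ => (1 : ℝ))
    (g := fun (z : Euc 2) (τ : ℝ) => cut τ * f (z + τ • w)) (k := Metric.closedBall 0 2)
    isOpen_univ (isCompact_closedBall _ _)
    (fun z τ _ hτ => by
      rw [Metric.mem_closedBall, not_le] at hτ
      rw [cut.zero_of_le_dist hτ.le, zero_mul]) h1 hg.contDiffOn
  rw [contDiffOn_univ] at this
  convert this using 2 with z
  rw [convolution_def, intervalIntegral.integral_of_le zero_le_one,
    ← integral_indicator measurableSet_Ioc]
  refine integral_congr_ae (Eventually.of_forall fun t => ?_)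
  by_cases ht : t ∈ Set.Ioc (0 : ℝ) 1
  · have : cut (0 - t) = 1 := by
      apply cut.one_of_mem_closedBall
      rw [Metric.mem_closedBall, Real.dist_eq]
      show _ ≤ (1 : ℝ)
      rw [sub_zero, zero_sub, abs_neg, abs_of_pos ht.1]
      exact ht.2
    simp only [Set.indicator_of_mem ht, ContinuousLinearMap.mul_apply', this, one_mul]
    rw [zero_sub, neg_smul, sub_eq_add_neg]
  · simp [ht]

/-- The average along the segment from `x` to `y` of the mollifier at scale `s`, in the direction
of the segment, is a field with divergence `moll s (· - x) - moll s (· - y)`. -/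
lemma fluxRel_segment {Ω : Set (Euc 2)} {h : Euc 2 → Euc 2} (hh : LocallyIntegrable h)
    {x y : Euc 2} {s : ℝ} (hs : 0 < s) (hΩ : Metric.closedBall x (s + dist y x) ⊆ Ω) :
    FluxRel Ω h (fun z => moll s (z - x) - moll s (z - y))
      (∫ t in (0 : ℝ)..1, inner ℝ (mollify s h (x + t • (y - x))) (y - x)) := by
  set w := y - x with hw
  set k : Euc 2 → ℝ := fun z => ∫ t in (0 : ℝ)..1, moll s (z - x - t • w) with hk
  have hksm : ContDiff ℝ ∞ k := by
    have h1 := contDiff_integral_segment (f := fun z => moll s (z - x))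
      ((contDiff_moll s).comp (contDiff_id.sub contDiff_const)) w
    simpa only [sub_right_comm _ _ x] using h1
  have hmz : ∀ z : Euc 2, z ∉ Metric.closedBall x (s + dist y x) → ∀ t ∈ Set.Icc (0 : ℝ) 1,
      moll s (z - x - t • w) = 0 := by
    intro z hz t ht
    apply moll_eq_zero hs
    rw [Metric.mem_closedBall, not_le, dist_eq_norm, dist_eq_norm] at hz
    have h1 : ‖t • w‖ ≤ ‖y - x‖ := by
      rw [norm_smul, Real.norm_of_nonneg ht.1]
      exact mul_le_of_le_one_left (norm_nonneg _) ht.2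
    have h2 := norm_sub_norm_le (z - x) (t • w)
    linarith
  have hkz : ∀ z, z ∉ Metric.closedBall x (s + dist y x) → k z = 0 := by
    intro z hz
    simp only [hk]
    rw [intervalIntegral.integral_congr (g := fun _ => (0 : ℝ)), intervalIntegral.integral_zero]
    intro t ht
    rw [Set.uIcc_of_le zero_le_one] at ht
    exact hmz z hz t ht
  have hsupp : Function.support (fun z => k z • w) ⊆ Metric.closedBall x (s + dist y x) := by
    intro z hz
    by_contra hz'
    exact hz (by simp [hkz z hz'])
  have hcont : ∀ z, Continuous fun t : ℝ => moll s (z - x - t • w) := fun z =>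
    (contDiff_moll s).continuous.comp (by fun_prop)
  refine ⟨fun z => k z • w, ⟨hksm.smul contDiff_const,
    HasCompactSupport.of_support_subset_isCompact (isCompact_closedBall _ _) hsupp,
    (closure_minimal hsupp Metric.isClosed_closedBall).trans hΩ⟩, fun z => ?_, ?_⟩
  · rw [dvg_smul (hksm.differentiable (by simp)).differentiableAt (differentiableAt_const w)]
    have h0 : dvg (fun _ : Euc 2 => w) z = 0 := by simp [dvg]
    rw [h0, mul_zero, zero_add]
    -- the directional derivative of `k` along `w`, from the fundamental theorem of calculus
    have h1 : HasDerivAt (fun τ : ℝ => k (z + τ • w)) (fderiv ℝ k z w) 0 := by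
      have h2 : HasFDerivAt k (fderiv ℝ k z) (z + (0 : ℝ) • w) := by
        rw [zero_smul, add_zero]
        exact (hksm.differentiable (by simp)).differentiableAt.hasFDerivAt
      have h3 : HasDerivAt (fun τ : ℝ => z + τ • w) w 0 := by
        simpa using ((hasDerivAt_id (0 : ℝ)).smul_const w).const_add z
      exact h2.comp_hasDerivAt 0 h3
    have h4 : (fun τ : ℝ => k (z + τ • w)) = fun τ : ℝ =>
        (∫ t in (0 : ℝ)..(1 - τ), moll s (z - x - t • w)) -
          ∫ t in (0 : ℝ)..(-τ), moll s (z - x - t • w) := by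
      funext τ
      simp only [hk]
      have h5 : ∀ t : ℝ, moll s (z + τ • w - x - t • w) =
          (fun t : ℝ => moll s (z - x - t • w)) (t - τ) := by
        intro t; simp only [sub_smul]; congr 1; abel
      simp_rw [h5]
      rw [intervalIntegral.integral_comp_sub_right (fun t : ℝ => moll s (z - x - t • w)) τ,
        zero_sub, intervalIntegral.integral_interval_sub_left
          ((hcont z).intervalIntegrable _ _) ((hcont z).intervalIntegrable _ _)]
    rw [h4] at h1
    have h6 : ∀ b : ℝ, HasDerivAt (fun u => ∫ t in (0 : ℝ)..u, moll s (z - x - t • w))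
        (moll s (z - x - b • w)) b := fun b =>
      intervalIntegral.integral_hasDerivAt_right ((hcont z).intervalIntegrable _ _)
        ((hcont z).stronglyMeasurableAtFilter _ _) (hcont z).continuousAt
    have h7 : HasDerivAt (fun τ : ℝ => (1 : ℝ) - τ) (-1) 0 := by
      simpa using (hasDerivAt_id (0 : ℝ)).const_sub 1
    have h8 : HasDerivAt (fun τ : ℝ => -τ) (-1) 0 := by
      exact (hasDerivAt_id (0 : ℝ)).neg
    have h9 := (HasDerivAt.comp (0 : ℝ) (h6 ((1 : ℝ) - 0)) h7).sub
      (HasDerivAt.comp (0 : ℝ) (h6 (-0 : ℝ)) h8)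
    have h10 := h1.unique h9
    rw [h10]
    have h11 : z - x - w = z - y := by rw [hw]; abel
    simp only [sub_zero, one_smul, neg_zero, zero_smul, h11]
    ring
  · obtain ⟨M, hM⟩ : ∃ M, ∀ z, ‖moll s z‖ ≤ M :=
      (hasCompactSupport_moll hs).exists_bound_of_continuous (contDiff_moll s).continuous
    have hfub : Integrable (Function.uncurry fun (z : Euc 2) (t : ℝ) =>
        moll s (z - x - t • w) * inner ℝ (h z) w)
        (volume.prod (volume.restrict (Set.Ioc (0 : ℝ) 1))) := by
      have hdom : Integrable (fun p : Euc 2 × ℝ =>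
          ((Metric.closedBall x (s + dist y x)).indicator h p.1) )
          (volume.prod (volume.restrict (Set.Ioc (0 : ℝ) 1))) :=
        Integrable.comp_fst ((integrable_indicator_iff measurableSet_closedBall).2
          (hh.integrableOn_isCompact (isCompact_closedBall _ _))) _
      have hdom' := (hdom.norm.const_mul (M * ‖w‖))
      have hmeas : AEStronglyMeasurable (Function.uncurry fun (z : Euc 2) (t : ℝ) =>
          moll s (z - x - t • w) * inner ℝ (h z) w)
          (volume.prod (volume.restrict (Set.Ioc (0 : ℝ) 1))) := by
        have h1 : AEStronglyMeasurable (fun p : Euc 2 × ℝ => inner ℝ (h p.1) w)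
            (volume.prod (volume.restrict (Set.Ioc (0 : ℝ) 1))) :=
          (hh.aestronglyMeasurable.comp_fst).inner aestronglyMeasurable_const
        have h2 : Continuous fun p : Euc 2 × ℝ => moll s (p.1 - x - p.2 • w) :=
          (contDiff_moll s).continuous.comp (by fun_prop)
        exact h2.aestronglyMeasurable.mul h1
      refine hdom'.mono' hmeas ?_
      have hae : ∀ᵐ p : Euc 2 × ℝ ∂(volume.prod (volume.restrict (Set.Ioc (0 : ℝ) 1))),
          p.2 ∈ Set.Ioc (0 : ℝ) 1 :=
        Measure.quasiMeasurePreserving_snd.ae (ae_restrict_mem measurableSet_Ioc)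
      filter_upwards [hae] with p hp
      by_cases hz : p.1 ∈ Metric.closedBall x (s + dist y x)
      · simp only [Function.uncurry, Set.indicator_of_mem hz, norm_mul]
        calc ‖moll s (p.1 - x - p.2 • w)‖ * ‖inner ℝ (h p.1) w‖
            ≤ M * (‖h p.1‖ * ‖w‖) :=
              mul_le_mul (hM _) (norm_inner_le_norm _ _) (norm_nonneg _)
                ((norm_nonneg _).trans (hM 0))
          _ = M * ‖w‖ * ‖h p.1‖ := by ring
      · simp [Function.uncurry, Set.indicator_of_notMem hz, hmz p.1 hz p.2 ⟨hp.1.le, hp.2⟩]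
    have h1 : ∀ z, inner ℝ (h z) (k z • w) =
        ∫ t in Set.Ioc (0 : ℝ) 1, moll s (z - x - t • w) * inner ℝ (h z) w := by
      intro z
      rw [inner_smul_right, integral_mul_const, ← intervalIntegral.integral_of_le zero_le_one]
    simp_rw [h1]
    rw [integral_integral_swap hfub, intervalIntegral.integral_of_le zero_le_one]
    refine integral_congr_ae (Eventually.of_forall fun t => ?_)
    simp only
    rw [mollify_apply, real_inner_comm, ← integral_inner (integrable_moll_smul hs hh _)]
    refine integral_congr_ae (Eventually.of_forall fun z => ?_)
    simp only
    rw [inner_smul_right, real_inner_comm, ← moll_neg]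
    congr 2
    abel

/-- If `h` is orthogonal to the gradients of test functions, its mollifications do not depend on
the scale, at the level of `FluxRel`. -/
lemma fluxRel_moll_sub {Ω : Set (Euc 2)} {h : Euc 2 → Euc 2}
    (hgrad : ∀ η : Euc 2 → ℝ, ContDiff ℝ ∞ η → HasCompactSupport η → tsupport η ⊆ Ω →
      ∫ x, fderiv ℝ η x (h x) = 0)
    {x : Euc 2} {s t : ℝ} (hs : 0 < s) (ht : 0 < t) (hsΩ : Metric.closedBall x s ⊆ Ω)
    (htΩ : Metric.closedBall x t ⊆ Ω) :
    FluxRel Ω h (fun z => moll s (z - x) - moll t (z - x)) 0 := by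
  obtain ⟨σ, F, hσ, hF, hσ0, hσF, hdF⟩ := exists_potential_moll_sub hs ht
  have hΩ : Metric.closedBall x (max s t) ⊆ Ω := by
    rcases max_choice s t with h | h <;> rw [h] <;> assumption
  have hσs : Function.support (fun z => σ (z - x)) ⊆ Metric.closedBall x (max s t) := by
    intro z hz
    rw [Metric.mem_closedBall, dist_eq_norm]
    by_contra hlt
    exact hz (hσ0 _ (not_le.1 hlt).le)
  have hσd : ∀ z v, fderiv ℝ (fun z => σ (z - x)) z v = inner ℝ (F (z - x)) v := by
    intro z v
    rw [fderiv_comp_sub, hσF]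
  have hσt : tsupport (fun z => σ (z - x)) ⊆ Metric.closedBall x (max s t) :=
    closure_minimal hσs Metric.isClosed_closedBall
  have hFs : Function.support (fun z => F (z - x)) ⊆ Metric.closedBall x (max s t) := by
    intro z hz
    by_contra hz'
    apply hz
    have h1 : fderiv ℝ (fun z => σ (z - x)) z = 0 :=
      image_eq_zero_of_notMem_tsupport fun h => hz' (hσt (tsupport_fderiv_subset ℝ h))
    have h2 := hσd z (F (z - x))
    rw [h1] at h2
    simpa using h2.symm
  refine ⟨fun z => F (z - x), ⟨hF.comp (contDiff_id.sub contDiff_const),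
    HasCompactSupport.of_support_subset_isCompact (isCompact_closedBall _ _) hFs,
    (closure_minimal hFs Metric.isClosed_closedBall).trans hΩ⟩, fun z => ?_, ?_⟩
  · show _ = moll s (z - x) - moll t (z - x)
    rw [← hdF]
    simp only [dvg, fderiv_comp_sub]
  · rw [← hgrad (fun z => σ (z - x)) (hσ.comp (contDiff_id.sub contDiff_const))
      (HasCompactSupport.of_support_subset_isCompact (isCompact_closedBall _ _) hσs)
      (hσt.trans hΩ)]
    simp_rw [hσd, real_inner_comm]

/-- A locally integrable field orthogonal to all gradients of test functions on `Ω` and to all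
divergence-free test fields on `Ω` agrees almost everywhere on `Ω` with the gradient of a `C¹`
function. Near any point the gradient is the mollification of `h` at any small enough scale. -/
theorem exists_primitive_of_orthogonal {Ω : Set (Euc 2)} (hΩ : IsOpen Ω) {h : Euc 2 → Euc 2}
    (hh : Integrable h)
    (hgrad : ∀ η : Euc 2 → ℝ, ContDiff ℝ ∞ η → HasCompactSupport η → tsupport η ⊆ Ω →
      ∫ x, fderiv ℝ η x (h x) = 0)
    (hsol : ∀ Ψ, TestField Ω Ψ → (∀ x, dvg Ψ x = 0) → ∫ x, inner ℝ (h x) (Ψ x) = 0) :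
    ∃ (V : Euc 2 → ℝ) (H : Euc 2 → Euc 2), ContinuousOn H Ω ∧
      (∀ x ∈ Ω, HasFDerivAt V (innerSL ℝ (H x)) x) ∧ ∀ᵐ x, x ∈ Ω → H x = h x := by
  have hl : LocallyIntegrable h := hh.locallyIntegrable
  have huniq : ∀ {c}, FluxRel Ω h (fun _ => 0) c → c = 0 := by
    rintro c ⟨Ψ, h1, h2, rfl⟩
    exact hsol Ψ h1 h2
  -- `J x y c`: the potential at `y` minus the potential at `x` is `c`.
  let J : Euc 2 → Euc 2 → ℝ → Prop := fun x y c => ∃ s t : ℝ, 0 < s ∧ 0 < t ∧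
    Metric.closedBall x s ⊆ Ω ∧ Metric.closedBall y t ⊆ Ω ∧
    FluxRel Ω h (fun z => moll s (z - x) - moll t (z - y)) c
  have hJtrans : ∀ {x y z c d}, J x y c → J y z d → J x z (c + d) := by
    rintro x y z c d ⟨s, t, hs, ht, hsx, hty, h1⟩ ⟨s', t', hs', ht', hsy, htz, h2⟩
    refine ⟨s, t', hs, ht', hsx, htz, ?_⟩
    have h3 := (h1.add hl (fluxRel_moll_sub hgrad ht hs' hty hsy)).add hl h2
    convert h3 using 1
    · funext w; ring
    · ring
  have hJsymm : ∀ {x y c}, J x y c → J y x (-c) := by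
    rintro x y c ⟨s, t, hs, ht, hsx, hty, h1⟩
    refine ⟨t, s, ht, hs, hty, hsx, ?_⟩
    convert h1.neg using 1
    funext w; ring
  have hball : ∀ x ∈ Ω, ∃ s, 0 < s ∧ Metric.closedBall x s ⊆ Ω := fun x hx =>
    Metric.nhds_basis_closedBall.mem_iff.1 (hΩ.mem_nhds hx)
  have hJself : ∀ {x c}, J x x c → c = 0 := by
    rintro x c ⟨s, t, hs, ht, hsx, htx, h1⟩
    have h2 := h1.add hl (fluxRel_moll_sub hgrad ht hs htx hsx)
    have h3 : FluxRel Ω h (fun _ => 0) (c + 0) := by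
      convert h2 using 1
      funext w; ring
    simpa using huniq h3
  let S : Setoid Ω := ⟨fun x y => ∃ c, J x y c, fun x => by
      obtain ⟨s, hs, hsΩ⟩ := hball x x.2
      exact ⟨0, s, s, hs, hs, hsΩ, hsΩ, fluxRel_moll_sub hgrad hs hs hsΩ hsΩ⟩,
    fun ⟨c, h⟩ => ⟨-c, hJsymm h⟩, fun ⟨c, h⟩ ⟨d, h'⟩ => ⟨c + d, hJtrans h h'⟩⟩
  let rep : Ω → Ω := fun x => (Quotient.mk S x).out
  have hrep : ∀ x : Ω, ∃ c, J x (rep x) c := fun x =>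
    S.symm (Quotient.mk_out (s := S) x)
  choose c hc using hrep
  -- the potential is normalized to vanish at the representatives
  let V : Euc 2 → ℝ := fun x => by
    classical exact if hx : x ∈ Ω then - c ⟨x, hx⟩ else 0
  have hV : ∀ x : Ω, J x (rep x) (- V x) := by
    intro x
    have : V x = - c x := by simp [V]
    rw [this, neg_neg]
    exact hc x
  have hVJ : ∀ x y : Ω, ∀ d, J x y d → V y - V x = d := by
    intro x y d hd
    have h1 : rep x = rep y := by
      simp only [rep]
      rw [Quotient.sound (s := S) (⟨d, hd⟩ : ∃ c, J x y c)]
    have h2 := hV x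
    rw [h1] at h2
    have h3 := hJself (hJtrans (hJtrans hd (hV y)) (hJsymm h2))
    linarith
  have hder : ∀ x s, 0 < s → Metric.closedBall x (2 * s) ⊆ Ω →
      HasFDerivAt V (innerSL ℝ (mollify s h x)) x := by
    intro x s hs hsΩ
    have hcont : Continuous (mollify s h) := (contDiff_mollify hs hl).continuous
    have hxΩ : x ∈ Ω := hsΩ (Metric.mem_closedBall_self (by positivity))
    rw [hasFDerivAt_iff_isLittleO, Asymptotics.isLittleO_iff]
    intro η hη
    obtain ⟨δ, hδ, hδη⟩ := Metric.continuousAt_iff.1 (hcont.continuousAt (x := x)) η hη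
    filter_upwards [Metric.ball_mem_nhds x (show 0 < min δ s by positivity)] with y hy
    have hys : dist y x < s := hy.trans_le (min_le_right _ _)
    have hyδ : dist y x < δ := hy.trans_le (min_le_left _ _)
    have hyΩ : y ∈ Ω := hsΩ (Metric.mem_closedBall.2 (by linarith))
    have h1 := fluxRel_segment (Ω := Ω) hl (x := x) (y := y) hs
      ((Metric.closedBall_subset_closedBall (by linarith)).trans hsΩ)
    have h2 : J x y _ := ⟨s, s, hs, hs,
      (Metric.closedBall_subset_closedBall (by linarith)).trans hsΩ,
      (Metric.closedBall_subset_closedBall' (by linarith)).trans hsΩ, h1⟩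
    rw [hVJ ⟨x, hxΩ⟩ ⟨y, hyΩ⟩ _ h2, innerSL_apply_apply]
    have hc1 : Continuous fun t : ℝ => inner ℝ (mollify s h (x + t • (y - x))) (y - x) :=
      (hcont.comp (by fun_prop)).inner continuous_const
    have h3 : inner ℝ (mollify s h x) (y - x) =
        ∫ _ in (0 : ℝ)..1, inner ℝ (mollify s h x) (y - x) := by simp
    rw [h3, ← intervalIntegral.integral_sub (hc1.intervalIntegrable _ _)
      (continuous_const.intervalIntegrable _ _)]
    have h4 := intervalIntegral.norm_integral_le_of_norm_le_const (a := (0 : ℝ)) (b := 1)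
      (f := fun t : ℝ => inner ℝ (mollify s h (x + t • (y - x))) (y - x) -
        inner ℝ (mollify s h x) (y - x)) (C := η * ‖y - x‖) ?_
    · simpa using h4
    · intro t ht
      rw [Set.uIoc_of_le zero_le_one] at ht
      rw [← inner_sub_left]
      refine (norm_inner_le_norm _ _).trans (mul_le_mul_of_nonneg_right ?_ (norm_nonneg _))
      rw [← dist_eq_norm]
      refine (hδη ?_).le
      rw [dist_eq_norm, add_sub_cancel_left, norm_smul, Real.norm_of_nonneg ht.1.le]
      rw [dist_eq_norm] at hyδ
      exact (mul_le_of_le_one_left (norm_nonneg _) ht.2).trans_lt hyδ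
  let H : Euc 2 → Euc 2 := fun x => (InnerProductSpace.toDual ℝ (Euc 2)).symm (fderiv ℝ V x)
  have hH : ∀ x s, 0 < s → Metric.closedBall x (2 * s) ⊆ Ω → H x = mollify s h x := by
    intro x s hs hsΩ
    simp only [H]
    rw [(hder x s hs hsΩ).fderiv]
    exact (InnerProductSpace.toDual ℝ (Euc 2)).symm_apply_apply _
  have hball2 : ∀ x ∈ Ω, ∃ s, 0 < s ∧ Metric.closedBall x (3 * s) ⊆ Ω := by
    intro x hx
    obtain ⟨s, hs, h1⟩ := hball x hx
    exact ⟨s / 3, by positivity, by rwa [mul_div_cancel₀ _ (by norm_num)]⟩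
  refine ⟨V, H, ?_, ?_, ?_⟩
  · intro x hx
    obtain ⟨s, hs, hsΩ⟩ := hball2 x hx
    have h1 : H =ᶠ[𝓝 x] mollify s h := by
      filter_upwards [Metric.ball_mem_nhds x hs] with y hy
      refine hH y s hs ((Metric.closedBall_subset_closedBall' ?_).trans hsΩ)
      have := Metric.mem_ball.1 hy
      linarith
    exact ((contDiff_mollify hs hl).continuous.continuousAt.congr h1.symm).continuousWithinAt
  · intro x hx
    obtain ⟨s, hs, hsΩ⟩ := hball2 x hx
    have h2 : Metric.closedBall x (2 * s) ⊆ Ω :=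
      (Metric.closedBall_subset_closedBall (by linarith)).trans hsΩ
    rw [hH x s hs h2]
    exact hder x s hs h2
  · have h1 := tendsto_eLpNorm_mollify_sub le_rfl ENNReal.one_ne_top (memLp_one_iff_integrable.2 hh)
    have h2 : Tendsto (fun n : ℕ => 1 / ((n : ℝ) + 1)) atTop (𝓝[>] 0) := by
      rw [tendsto_nhdsWithin_iff]
      exact ⟨tendsto_one_div_add_atTop_nhds_zero_nat, Eventually.of_forall fun n => by
        simp only [Set.mem_Ioi]; positivity⟩
    have h3 : TendstoInMeasure volume (fun n : ℕ => mollify (1 / ((n : ℝ) + 1)) h) atTop h := by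
      refine tendstoInMeasure_of_tendsto_eLpNorm one_ne_zero (fun n => ?_)
        hh.aestronglyMeasurable (h1.comp h2)
      exact (contDiff_mollify (by positivity) hl).continuous.aestronglyMeasurable
    obtain ⟨ns, hns, h4⟩ := h3.exists_seq_tendsto_ae
    filter_upwards [h4] with x hx hxΩ
    obtain ⟨s, hs, hsΩ⟩ := hball x hxΩ
    refine tendsto_nhds_unique (tendsto_const_nhds.congr' ?_) hx
    have h5 := (tendsto_nhdsWithin_iff.1 (h2.comp hns.tendsto_atTop)).1
    filter_upwards [h5.eventually (gt_mem_nhds (show (0 : ℝ) < s / 2 by positivity))] with k hk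
    refine hH x _ (by positivity) ((Metric.closedBall_subset_closedBall ?_).trans hsΩ)
    simp only [Function.comp] at hk
    linarith

/-! ### Approximation by compactly supported divergence-free fields -/

/-- A `C¹` function has its classical gradient as weak gradient. -/
lemma hasWeakGradient_of_hasFDerivAt {Ω : Set (Euc 2)} (hΩ : IsOpen Ω) {v : Euc 2 → ℝ}
    {G : Euc 2 → Euc 2} (hv : ∀ x ∈ Ω, HasFDerivAt v (innerSL ℝ (G x)) x)
    (hG : ContinuousOn G Ω) : HasWeakGradient Ω v G := by
  have hvc : ContinuousOn v Ω := fun x hx => (hv x hx).continuousAt.continuousWithinAt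
  refine ⟨hvc.locallyIntegrableOn hΩ.measurableSet, hG.locallyIntegrableOn hΩ.measurableSet, ?_⟩
  intro η hη hηc hηΩ i
  have hcs : ∀ f ζ : Euc 2 → ℝ, ContinuousOn f Ω → Continuous ζ → tsupport ζ ⊆ tsupport η →
      Integrable fun x => f x * ζ x := by
    intro f ζ hf hζ hs
    refine Continuous.integrable_of_hasCompactSupport ?_ ?_
    · refine continuous_of_tsupport fun x hx => ?_
      have hx' : x ∈ Ω := hηΩ (hs (tsupport_mul_subset_right hx))
      exact (hf.continuousAt (hΩ.mem_nhds hx')).mul hζ.continuousAt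
    · exact HasCompactSupport.mul_left (hηc.mono' ((subset_tsupport ζ).trans hs))
  have hη' : Continuous fun x => fderiv ℝ η x (EuclideanSpace.single i 1) :=
    (hη.continuous_fderiv (by simp)).clm_apply continuous_const
  have hη's : tsupport (fun x => fderiv ℝ η x (EuclideanSpace.single i 1)) ⊆ tsupport η :=
    (tsupport_fderiv_apply_subset ℝ _)
  have hGi : ContinuousOn (fun x => G x i) Ω := by fun_prop
  have hfd : ∀ x ∈ Ω, fderiv ℝ v x (EuclideanSpace.single i 1) = G x i := by
    intro x hx
    rw [(hv x hx).fderiv, innerSL_apply_apply]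
    simp [EuclideanSpace.inner_single_right]
  have hfη : ∀ x, fderiv ℝ v x (EuclideanSpace.single i 1) * η x = G x i * η x := by
    intro x
    by_cases hx : x ∈ tsupport η
    · rw [hfd x (hηΩ hx)]
    · simp [image_eq_zero_of_notMem_tsupport hx]
  have key := integral_mul_fderiv_eq_neg_fderiv_mul_of_integrable (μ := volume) (f := v) (g := η)
    (v := EuclideanSpace.single i 1)
    (by simp_rw [hfη]; exact hcs _ _ hGi hη.continuous le_rfl)
    (hcs _ _ hvc hη' hη's) (hcs _ _ hvc hη.continuous le_rfl)
    (fun x hx => (hv x (hηΩ hx)).differentiableAt)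
    (fun x _ => (hη.differentiable (by simp)).differentiableAt)
  simp_rw [hfη] at key
  rw [setIntegral_eq_integral_of_forall_compl_eq_zero, key,
    setIntegral_eq_integral_of_forall_compl_eq_zero]
  · intro x hx
    rw [image_eq_zero_of_notMem_tsupport fun h => hx (hηΩ h), mul_zero]
  · intro x hx
    rw [image_eq_zero_of_notMem_tsupport fun h => hx (hηΩ (hη's h)), mul_zero]

lemma hasFDerivAt_innerSL_gradient {η : Euc 2 → ℝ} {x : Euc 2} (h : DifferentiableAt ℝ η x) :
    HasFDerivAt η (innerSL ℝ (gradient η x)) x :=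
  h.hasFDerivAt.congr_fderiv <| ContinuousLinearMap.ext fun w => by
    rw [innerSL_apply_apply, inner_gradient_left]

lemma contDiff_gradient {η : Euc 2 → ℝ} (hη : ContDiff ℝ ∞ η) : ContDiff ℝ ∞ (gradient η) :=
  (InnerProductSpace.toDual ℝ (Euc 2)).symm.contDiff.comp (hη.fderiv_right (by simp))

lemma tsupport_gradient_subset (η : Euc 2 → ℝ) : tsupport (gradient η) ⊆ tsupport η := by
  refine closure_minimal (fun x hx => ?_) (isClosed_tsupport η)
  by_contra h
  apply hx
  have : fderiv ℝ η x = 0 :=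
    image_eq_zero_of_notMem_tsupport fun h' => h (tsupport_fderiv_subset ℝ h')
  simp [gradient, this]

lemma testField_gradient {Ω : Set (Euc 2)} {η : Euc 2 → ℝ} (hη : ContDiff ℝ ∞ η)
    (hc : HasCompactSupport η) (hs : tsupport η ⊆ Ω) : TestField Ω (gradient η) :=
  ⟨contDiff_gradient hη, hc.mono' ((subset_tsupport _).trans (tsupport_gradient_subset η)),
    (tsupport_gradient_subset η).trans hs⟩

lemma TestField.memLp {Ω : Set (Euc 2)} {Ψ : Euc 2 → Euc 2} (h : TestField Ω Ψ) (q : ENNReal) :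
    MemLp Ψ q :=
  h.contDiff.continuous.memLp_of_hasCompactSupport h.hasCompactSupport

lemma TestField.eq_zero {Ω : Set (Euc 2)} {Ψ : Euc 2 → Euc 2} (h : TestField Ω Ψ) {x : Euc 2}
    (hx : x ∉ Ω) : Ψ x = 0 :=
  image_eq_zero_of_notMem_tsupport fun h' => hx (h.tsupport_subset h')

/-- A divergence-free test field is orthogonal to weak gradients. -/
lemma TestField.integral_inner_weakGradient {Ω : Set (Euc 2)} {Ψ : Euc 2 → Euc 2}
    (h : TestField Ω Ψ) (hd : ∀ x, dvg Ψ x = 0) {u : Euc 2 → ℝ} {g : Euc 2 → Euc 2}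
    (hu : HasWeakGradient Ω u g) : ∫ x in Ω, inner ℝ (g x) (Ψ x) = 0 := by
  have hci : ∀ i : Fin 2, ContDiff ℝ ∞ fun x => Ψ x i := fun i =>
    (EuclideanSpace.proj i : Euc 2 →L[ℝ] ℝ).contDiff.comp h.contDiff
  have hsi : ∀ i : Fin 2, HasCompactSupport fun x => Ψ x i := fun i =>
    h.hasCompactSupport.comp_left (g := fun v : Euc 2 => v i) (by simp)
  have htii : ∀ i : Fin 2, tsupport (fun x => Ψ x i) ⊆ tsupport Ψ := fun i =>
    tsupport_comp_subset (g := fun v : Euc 2 => v i) (by simp) Ψ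
  have hti : ∀ i : Fin 2, tsupport (fun x => Ψ x i) ⊆ Ω := fun i =>
    (htii i).trans h.tsupport_subset
  have hfd : ∀ (i : Fin 2) x v, fderiv ℝ (fun x => Ψ x i) x v = fderiv ℝ Ψ x v i := by
    intro i x v
    have := ((EuclideanSpace.proj i : Euc 2 →L[ℝ] ℝ).hasFDerivAt.comp x
      (h.differentiableAt x).hasFDerivAt)
    have h2 : HasFDerivAt (fun x => Ψ x i) _ x := this
    rw [h2.fderiv]
    rfl
  have hloc : ∀ (f ζ : Euc 2 → ℝ), LocallyIntegrableOn f Ω → Continuous ζ →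
      tsupport ζ ⊆ tsupport Ψ → IntegrableOn (fun x => f x * ζ x) Ω := by
    intro f ζ hf hζ hs
    have hK : IsCompact (tsupport Ψ) := h.hasCompactSupport
    have h1 : IntegrableOn f (tsupport Ψ) := by
      exact (hf.mono_set h.tsupport_subset).integrableOn_isCompact hK
    have h2 : IntegrableOn (fun x => f x * ζ x) (tsupport Ψ) :=
      h1.mul_continuousOn hζ.continuousOn hK
    refine (integrableOn_iff_integrable_of_support_subset ?_).1 h2 |>.integrableOn
    intro x hx
    by_contra hx'
    exact hx (by simp [image_eq_zero_of_notMem_tsupport fun h' => hx' (hs h')])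
  have hgi : ∀ i : Fin 2, LocallyIntegrableOn (fun x => g x i) Ω := fun i x hx => by
    obtain ⟨U, hU, hi⟩ := hu.locallyIntegrable_grad x hx
    exact ⟨U, hU, (EuclideanSpace.proj i : Euc 2 →L[ℝ] ℝ).integrable_comp hi⟩
  have e := fun i => hu.integral_eq _ (hci i) (hsi i) (hti i) i
  have h1 : ∀ x, inner ℝ (g x) (Ψ x) = g x 0 * Ψ x 0 + g x 1 * Ψ x 1 := by
    intro x; simp [PiLp.inner_apply, Fin.sum_univ_two, mul_comm]
  have hder : ∀ i : Fin 2, IntegrableOn (fun x => u x *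
      fderiv ℝ (fun x => Ψ x i) x (EuclideanSpace.single i 1)) Ω := fun i =>
    hloc _ _ hu.locallyIntegrable (((hci i).continuous_fderiv (by simp)).clm_apply continuous_const)
      ((tsupport_fderiv_apply_subset ℝ _).trans (htii i))
  simp_rw [h1]
  rw [integral_add (hloc _ _ (hgi 0) (hci 0).continuous (htii 0))
    (hloc _ _ (hgi 1) (hci 1).continuous (htii 1)),
    ← neg_eq_iff_eq_neg.2 (e 0), ← neg_eq_iff_eq_neg.2 (e 1), ← neg_add,
    ← integral_add (hder 0) (hder 1), neg_eq_zero]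
  refine integral_eq_zero_of_ae (Eventually.of_forall fun x => ?_)
  simp only [hfd, Pi.zero_apply]
  rw [← mul_add]
  have := hd x
  unfold dvg at this
  rw [this, mul_zero]

/-- A square integrable gradient of a `C¹` function on a bounded open set is orthogonal to every
square integrable field that is orthogonal to the gradients of functions in `W^{1,2}`. -/
lemma integral_inner_eq_zero_of_primitive {Ω : Set (Euc 2)} (hΩ : IsOpen Ω)
    (hb : Bornology.IsBounded Ω) {Φ : Euc 2 → Euc 2} (hΦ : MemLp Φ 2 (volume.restrict Ω))
    (horth : ∀ v G, MemLp v 2 (volume.restrict Ω) → HasWeakGradient Ω v G →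
      MemLp G 2 (volume.restrict Ω) → ∫ x in Ω, inner ℝ (G x) (Φ x) = 0)
    {V : Euc 2 → ℝ} {H : Euc 2 → Euc 2} (hV : ∀ x ∈ Ω, HasFDerivAt V (innerSL ℝ (H x)) x)
    (hH : ContinuousOn H Ω) (hH2 : MemLp H 2 (volume.restrict Ω)) :
    ∫ x in Ω, inner ℝ (H x) (Φ x) = 0 := by
  have hfin : IsFiniteMeasure (volume.restrict Ω) :=
    ⟨by rw [Measure.restrict_apply_univ]; exact hb.measure_lt_top⟩
  -- `V` need not be square integrable: truncate it by `s ↦ k arctan (s / k)`, `k = n + 1`, whose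
  -- derivative `a n` increases to one
  let a : ℕ → ℝ → ℝ := fun n s => 1 / (1 + (s / (n + 1)) ^ 2)
  have ha0 : ∀ n s, 0 ≤ a n s := fun n s => by positivity
  have ha1 : ∀ n s, a n s ≤ 1 := fun n s => by
    simp only [a]
    rw [div_le_one (by positivity)]
    nlinarith [sq_nonneg (s / ((n : ℝ) + 1))]
  have hac : ∀ n, Continuous (a n) := fun n => by
    simp only [a]
    refine continuous_const.div (by fun_prop) fun s => ?_
    positivity
  have hVc : ContinuousOn V Ω := fun x hx => (hV x hx).continuousAt.continuousWithinAt
  have hzero : ∀ n : ℕ, ∫ x in Ω, inner ℝ (a n (V x) • H x) (Φ x) = 0 := by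
    intro n
    have hn : (0 : ℝ) < n + 1 := by positivity
    have hGc : ContinuousOn (fun x => a n (V x) • H x) Ω := ((hac n).comp_continuousOn hVc).smul hH
    have hvd : ∀ x ∈ Ω, HasFDerivAt (fun x => ((n : ℝ) + 1) * Real.arctan (V x / (n + 1)))
        (innerSL ℝ (a n (V x) • H x)) x := by
      intro x hx
      have h1 := (((hV x hx).mul_const ((n : ℝ) + 1)⁻¹).arctan).const_mul ((n : ℝ) + 1)
      simp only [← div_eq_mul_inv] at h1
      refine h1.congr_fderiv (ContinuousLinearMap.ext fun w => ?_)
      simp only [a, innerSL_apply_apply, smul_apply, smul_eq_mul,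
        real_inner_smul_left, div_eq_mul_inv]
      field_simp
    refine horth (fun x => ((n : ℝ) + 1) * Real.arctan (V x / (n + 1))) _ ?_
      (hasWeakGradient_of_hasFDerivAt hΩ hvd hGc) ?_
    · refine MemLp.of_bound (C := (n + 1) * (Real.pi / 2)) ?_ (Eventually.of_forall fun x => ?_)
      · refine ContinuousOn.aestronglyMeasurable ?_ hΩ.measurableSet
        exact fun x hx => (hvd x hx).continuousAt.continuousWithinAt
      · rw [norm_mul, Real.norm_of_nonneg hn.le]
        exact mul_le_mul_of_nonneg_left
          (abs_lt.2 ⟨Real.neg_pi_div_two_lt_arctan _, Real.arctan_lt_pi_div_two _⟩).le hn.le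
    · refine hH2.mono (hGc.aestronglyMeasurable hΩ.measurableSet)
        (Eventually.of_forall fun x => ?_)
      rw [norm_smul, Real.norm_of_nonneg (ha0 _ _)]
      exact mul_le_of_le_one_left (norm_nonneg _) (ha1 _ _)
  have hint : Integrable (fun x => ‖H x‖ * ‖Φ x‖) (volume.restrict Ω) :=
    hH2.norm.integrable_mul hΦ.norm
  have hlim := tendsto_integral_of_dominated_convergence (μ := volume.restrict Ω)
    (F := fun (n : ℕ) x => inner ℝ (a n (V x) • H x) (Φ x)) (f := fun x => inner ℝ (H x) (Φ x))
    (fun x => ‖H x‖ * ‖Φ x‖)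
    (fun n => ((((hac n).comp_continuousOn hVc).smul hH).aestronglyMeasurable
      hΩ.measurableSet).inner hΦ.1) hint
    (fun n => Eventually.of_forall fun x => by
      refine (norm_inner_le_norm _ _).trans (mul_le_mul_of_nonneg_right ?_ (norm_nonneg _))
      rw [norm_smul, Real.norm_of_nonneg (ha0 _ _)]
      exact mul_le_of_le_one_left (norm_nonneg _) (ha1 _ _))
    (Eventually.of_forall fun x => by
      have h1 : Tendsto (fun n : ℕ => V x / ((n : ℝ) + 1)) atTop (𝓝 0) := by
        have := tendsto_one_div_add_atTop_nhds_zero_nat (𝕜 := ℝ) |>.const_mul (V x)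
        simpa [div_eq_mul_inv] using this
      have h2 : Tendsto (fun n : ℕ => a n (V x)) atTop (𝓝 1) := by
        have h3 : Tendsto (fun n : ℕ => 1 + (V x / ((n : ℝ) + 1)) ^ 2) atTop (𝓝 (1 + 0 ^ 2)) :=
          (h1.pow 2).const_add 1
        have h4 := h3.inv₀ (by norm_num)
        simpa only [a, one_div, pow_two, mul_zero, add_zero, div_one, inv_one] using h4
      have h5 := (h2.smul_const (H x)).inner (𝕜 := ℝ) (tendsto_const_nhds (x := Φ x))
      simpa using h5)
  simp only [hzero] at hlim
  exact (tendsto_nhds_unique hlim tendsto_const_nhds)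

/-- A square integrable field vanishing off a bounded open set `Ω` and orthogonal to the gradients
of all functions in `W^{1,2}(Ω)` is an `L²` limit of divergence-free test fields on `Ω`. -/
theorem exists_testField_eLpNorm_sub_le {Ω : Set (Euc 2)} (hΩ : IsOpen Ω)
    (hb : Bornology.IsBounded Ω) {Φ : Euc 2 → Euc 2} (hΦ : MemLp Φ 2)
    (hΦ0 : ∀ x ∉ Ω, Φ x = 0)
    (horth : ∀ v G, MemLp v 2 (volume.restrict Ω) → HasWeakGradient Ω v G →
      MemLp G 2 (volume.restrict Ω) → ∫ x in Ω, inner ℝ (G x) (Φ x) = 0)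
    {ε : ℝ} (hε : 0 < ε) :
    ∃ Ψ, TestField Ω Ψ ∧ (∀ x, dvg Ψ x = 0) ∧
      eLpNorm (Ψ - Φ) 2 volume ≤ ENNReal.ofReal ε := by
  have hfin : IsFiniteMeasure (volume.restrict Ω) :=
    ⟨by rw [Measure.restrict_apply_univ]; exact hb.measure_lt_top⟩
  let X : Submodule ℝ (Lp (Euc 2) 2 (volume : Measure (Euc 2))) :=
    { carrier := {f | ∃ Ψ, TestField Ω Ψ ∧ (∀ x, dvg Ψ x = 0) ∧ f =ᵐ[volume] Ψ}
      add_mem' := by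
        rintro f f' ⟨Ψ, h1, h2, h3⟩ ⟨Ψ', h1', h2', h3'⟩
        refine ⟨Ψ + Ψ', h1.add h1', fun x => ?_, (Lp.coeFn_add f f').trans (h3.add h3')⟩
        rw [dvg_add (h1.differentiableAt x) (h1'.differentiableAt x), h2, h2', add_zero]
      zero_mem' := ⟨0, testField_zero, fun x => by simp [dvg], Lp.coeFn_zero _ _ _⟩
      smul_mem' := by
        rintro c f ⟨Ψ, h1, h2, h3⟩
        refine ⟨c • Ψ, h1.const_smul c, fun x => ?_, (Lp.coeFn_smul c f).trans (h3.const_smul c)⟩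
        have := dvg_smul (differentiableAt_const c) (h1.differentiableAt x)
        rw [h2 x] at this
        simpa using! this }
  let Z : Submodule ℝ (Lp (Euc 2) 2 (volume : Measure (Euc 2))) :=
    { carrier := {f | ∃ η : Euc 2 → ℝ, ContDiff ℝ ∞ η ∧ HasCompactSupport η ∧ tsupport η ⊆ Ω ∧
        f =ᵐ[volume] gradient η}
      add_mem' := by
        rintro f f' ⟨η, h1, h2, h3, h4⟩ ⟨η', h1', h2', h3', h4'⟩
        refine ⟨η + η', h1.add h1', h2.add h2',
          (tsupport_add η η').trans (Set.union_subset h3 h3'), ?_⟩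
        refine (Lp.coeFn_add f f').trans ((h4.add h4').trans (Eventually.of_forall fun x => ?_))
        simp only [gradient, Pi.add_apply]
        rw [fderiv_add (h1.differentiable (by simp)).differentiableAt
          (h1'.differentiable (by simp)).differentiableAt, map_add]
      zero_mem' := ⟨0, contDiff_const, HasCompactSupport.zero, by simp [tsupport],
        (Lp.coeFn_zero _ _ _).trans (Eventually.of_forall fun x => by simp [gradient])⟩
      smul_mem' := by
        rintro c f ⟨η, h1, h2, h3, h4⟩
        refine ⟨c • η, h1.const_smul c, h2.smul_left (f := fun _ => c),
          (tsupport_smul_subset_right (fun _ => c) η).trans h3, ?_⟩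
        refine (Lp.coeFn_smul c f).trans
          ((h4.const_smul c).trans (Eventually.of_forall fun x => ?_))
        simp only [gradient, Pi.smul_apply]
        rw [fderiv_const_smul (h1.differentiable (by simp)).differentiableAt, map_smul] }
  have hinner : ∀ (f g : Lp (Euc 2) 2 (volume : Measure (Euc 2))) (F G : Euc 2 → Euc 2),
      f =ᵐ[volume] F → g =ᵐ[volume] G → inner ℝ f g = ∫ x, inner ℝ (F x) (G x) := by
    intro f g F G hf hg
    rw [L2.inner_def]
    refine integral_congr_ae ?_
    filter_upwards [hf, hg] with x h1 h2
    rw [h1, h2]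
  let a := hΦ.toLp
  have ha : a =ᵐ[volume] Φ := hΦ.coeFn_toLp
  -- `X` is the space of divergence-free test fields and `Z` that of gradients of test functions. An
  -- element of `Xᗮ` splits into its projection `z` to the closure of `Z`, which `a` annihilates,
  -- and an element `h` of `Xᗮ ⊓ Zᗮ`, which is the gradient of a `C¹` function on `Ω`.
  have hZX : Z ≤ Xᗮ := by
    rintro z ⟨η, h1, h2, h3, h4⟩
    rw [Submodule.mem_orthogonal']
    rintro f ⟨Ψ, k1, k2, k3⟩
    rw [hinner z f _ _ h4 k3, ← k1.integral_inner_weakGradient k2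
      (hasWeakGradient_of_hasFDerivAt hΩ (v := η) (G := gradient η) (fun x _ =>
        hasFDerivAt_innerSL_gradient (h1.differentiable (by simp)).differentiableAt)
        (contDiff_gradient h1).continuous.continuousOn),
      setIntegral_eq_integral_of_forall_compl_eq_zero]
    intro x hx
    rw [k1.eq_zero hx, inner_zero_right]
  have haZ : a ∈ Zᗮ := by
    rw [Submodule.mem_orthogonal]
    rintro z ⟨η, h1, h2, h3, h4⟩
    have hT := testField_gradient h1 h2 h3
    have h5 := horth η (gradient η)
      ((h1.continuous.memLp_of_hasCompactSupport h2).restrict Ω)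
      (hasWeakGradient_of_hasFDerivAt hΩ (fun x _ =>
        hasFDerivAt_innerSL_gradient (h1.differentiable (by simp)).differentiableAt)
        hT.contDiff.continuous.continuousOn)
      ((hT.memLp 2).restrict Ω)
    rw [hinner z a _ _ h4 ha, ← h5, setIntegral_eq_integral_of_forall_compl_eq_zero]
    intro x hx
    rw [hT.eq_zero hx, inner_zero_left]
  have key : a ∈ X.topologicalClosure := by
    rw [← Submodule.orthogonal_orthogonal_eq_closure, Submodule.mem_orthogonal]
    intro w hw
    obtain ⟨z, hz, h, hh, rfl⟩ :=
      (Z.topologicalClosure).exists_add_mem_mem_orthogonal w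
    have hz0 : inner ℝ z a = 0 := by
      have h1 : Z.topologicalClosure ≤ (ℝ ∙ a)ᗮ := by
        refine Z.topologicalClosure_minimal (fun y hy => ?_) (Submodule.isClosed_orthogonal _)
        rw [Submodule.mem_orthogonal_singleton_iff_inner_left]
        exact haZ y hy
      exact Submodule.mem_orthogonal_singleton_iff_inner_left.1 (h1 hz)
    have hzX : z ∈ Xᗮ :=
      Z.topologicalClosure_minimal hZX (Submodule.isClosed_orthogonal _) hz
    have hhX : h ∈ Xᗮ := by
      have := Submodule.sub_mem _ hw hzX
      simpa using this
    have hhZ : h ∈ Zᗮ := Submodule.orthogonal_le Z.le_topologicalClosure hh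
    rw [inner_add_left, hz0, zero_add]
    -- `h` restricted to `Ω` is the gradient of a `C¹` function
    have hhΩ : MemLp (h : Euc 2 → Euc 2) 2 (volume.restrict Ω) := (Lp.memLp h).restrict Ω
    have hi : Integrable (Ω.indicator h) :=
      (integrable_indicator_iff hΩ.measurableSet).2 (hhΩ.integrable (by norm_num))
    obtain ⟨V, H, hHc, hVH, hHh⟩ := exists_primitive_of_orthogonal hΩ hi
      (fun η h1 h2 h3 => by
        have hT := testField_gradient h1 h2 h3
        have h4 := hhZ (hT.memLp 2).toLp ⟨η, h1, h2, h3, (hT.memLp 2).coeFn_toLp⟩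
        rw [hinner _ h _ _ (hT.memLp 2).coeFn_toLp (ae_eq_refl _)] at h4
        rw [← h4]
        refine integral_congr_ae (Eventually.of_forall fun x => ?_)
        by_cases hx : x ∈ Ω
        · simp [hx, inner_gradient_left]
        · simp [hx, hT.eq_zero hx])
      (fun Ψ hT hd => by
        have h4 := hhX (hT.memLp 2).toLp ⟨Ψ, hT, hd, (hT.memLp 2).coeFn_toLp⟩
        rw [hinner _ h _ _ (hT.memLp 2).coeFn_toLp (ae_eq_refl _)] at h4
        rw [← h4]
        refine integral_congr_ae (Eventually.of_forall fun x => ?_)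
        by_cases hx : x ∈ Ω
        · simp [hx, real_inner_comm]
        · simp [hx, hT.eq_zero hx])
    have hHae : H =ᵐ[volume.restrict Ω] h := by
      filter_upwards [ae_restrict_of_ae hHh, ae_restrict_mem hΩ.measurableSet] with x h1 h2
      rw [h1 h2, Set.indicator_of_mem h2]
    have h0 := integral_inner_eq_zero_of_primitive hΩ hb (hΦ.restrict Ω) horth hVH hHc
      ((memLp_congr_ae hHae).2 hhΩ)
    rw [hinner h a _ _ (ae_eq_refl _) ha, ← h0,
      ← setIntegral_eq_integral_of_forall_compl_eq_zero (s := Ω)]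
    · refine integral_congr_ae ?_
      filter_upwards [hHae] with x hx
      rw [hx]
    · intro x hx
      rw [hΦ0 x hx, inner_zero_right]
  obtain ⟨f, ⟨Ψ, h1, h2, h3⟩, h4⟩ := Metric.mem_closure_iff.1 key ε hε
  refine ⟨Ψ, h1, h2, ?_⟩
  rw [dist_comm, Lp.dist_def] at h4
  have h5 : eLpNorm (Ψ - Φ) 2 volume = eLpNorm (⇑f - ⇑a) 2 volume :=
    eLpNorm_congr_ae (h3.symm.sub ha.symm)
  rw [h5]
  exact (ENNReal.le_ofReal_iff_toReal_le ((Lp.memLp f).sub (Lp.memLp a)).eLpNorm_ne_top hε.le).2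
    h4.le

/-! ### Stream functions -/

/-- The linear map sending a vector `F` to the covector `v ↦ F 0 * v 1 - F 1 * v 0`. A function
with derivative `crossL (F x)` is a stream function of the plane field `F`. -/
noncomputable def crossL : Euc 2 →L[ℝ] (Euc 2 →L[ℝ] ℝ) :=
  (EuclideanSpace.proj 0 : Euc 2 →L[ℝ] ℝ).smulRight (EuclideanSpace.proj 1 : Euc 2 →L[ℝ] ℝ) -
    (EuclideanSpace.proj 1 : Euc 2 →L[ℝ] ℝ).smulRight (EuclideanSpace.proj 0 : Euc 2 →L[ℝ] ℝ)

lemma crossL_apply (F v : Euc 2) : crossL F v = F 0 * v 1 - F 1 * v 0 := by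
  simp [crossL]

lemma crossL_self (F : Euc 2) : crossL F F = 0 := by
  rw [crossL_apply]; ring

lemma abs_crossL_le (F v : Euc 2) : |crossL F v| ≤ ‖F‖ * ‖v‖ := by
  rw [crossL_apply, EuclideanSpace.norm_eq, EuclideanSpace.norm_eq,
    ← Real.sqrt_mul (by positivity)]
  refine Real.abs_le_sqrt ?_
  simp only [Fin.sum_univ_two, Real.norm_eq_abs, sq_abs]
  nlinarith [sq_nonneg (F 0 * v 0 + F 1 * v 1)]

/-- A smooth divergence-free field on the plane has a smooth stream function. -/
lemma exists_stream_function {F : Euc 2 → Euc 2} (hF : ContDiff ℝ ∞ F) (hd : ∀ x, dvg F x = 0) :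
    ∃ ψ : Euc 2 → ℝ, ContDiff ℝ ∞ ψ ∧ ∀ x, HasFDerivAt ψ (crossL (F x)) x := by
  have hω : ContDiff ℝ ∞ fun x => crossL (F x) := crossL.contDiff.comp hF
  have hFd : ∀ x, HasFDerivAt F (fderiv ℝ F x) x := fun x =>
    (hF.differentiable (by simp)).differentiableAt.hasFDerivAt
  have hωd : ∀ x v w, fderiv ℝ (fun x => crossL (F x)) x v w = crossL (fderiv ℝ F x v) w := by
    intro x v w
    have h1 : HasFDerivAt (fun x => crossL (F x)) _ x := crossL.hasFDerivAt.comp x (hFd x)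
    rw [h1.fderiv]
    rfl
  obtain ⟨ψ, hψ⟩ := convex_univ.exists_forall_hasFDerivAt_of_fderiv_symmetric isOpen_univ
    (hω.differentiable (by simp)).differentiableOn (fun x _ v w => by
      have hv : ∀ v : Euc 2, fderiv ℝ F x v = v 0 • fderiv ℝ F x (EuclideanSpace.single 0 1) +
          v 1 • fderiv ℝ F x (EuclideanSpace.single 1 1) := by
        intro v
        rw [← map_smul, ← map_smul, ← map_add]
        congr 1
        ext i; fin_cases i <;> simp
      have h0 := hd x
      unfold dvg at h0
      rw [hωd, hωd, hv v, hv w]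
      simp only [crossL_apply, PiLp.add_apply, PiLp.smul_apply, smul_eq_mul]
      linear_combination (v 0 * w 1 - w 0 * v 1) * h0)
  refine ⟨ψ, ?_, fun x => hψ x (Set.mem_univ x)⟩
  rw [contDiff_infty_iff_fderiv]
  refine ⟨fun x => (hψ x (Set.mem_univ x)).differentiableAt, ?_⟩
  rw [show fderiv ℝ ψ = fun x => crossL (F x) from funext fun x => (hψ x (Set.mem_univ x)).fderiv]
  exact hω

/-! ### Morrey's estimate on squares -/

/-- The half-open square of side `r` with lower left corner `(a, b)`. -/
def square (a b r : ℝ) : Set (Euc 2) :=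
  {z | z 0 ∈ Set.Ico a (a + r) ∧ z 1 ∈ Set.Ico b (b + r)}

lemma measurableSet_square (a b r : ℝ) : MeasurableSet (square a b r) := by
  have h0 : Measurable fun z : Euc 2 => z 0 := by fun_prop
  have h1 : Measurable fun z : Euc 2 => z 1 := by fun_prop
  exact (h0 measurableSet_Ico).inter (h1 measurableSet_Ico)

lemma convex_square (a b r : ℝ) : Convex ℝ (square a b r) := by
  have h0 : IsLinearMap ℝ fun z : Euc 2 => z 0 := ⟨by simp, by simp⟩
  have h1 : IsLinearMap ℝ fun z : Euc 2 => z 1 := ⟨by simp, by simp⟩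
  exact ((convex_Ico _ _).is_linear_preimage h0).inter ((convex_Ico _ _).is_linear_preimage h1)

lemma volume_square (a b : ℝ) {r : ℝ} (hr : 0 ≤ r) :
    volume (square a b r) = ENNReal.ofReal (r ^ 2) := by
  have h : square a b r = (WithLp.ofLp : Euc 2 → Fin 2 → ℝ) ⁻¹'
      (Set.univ.pi fun i => Set.Ico (![a, b] i) (![a, b] i + r)) := by
    ext z
    simp [square, Fin.forall_fin_two]
  rw [h, (PiLp.volume_preserving_ofLp (Fin 2)).measure_preimage
    (MeasurableSet.univ_pi fun i => measurableSet_Ico).nullMeasurableSet, Real.volume_pi_Ico]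
  simp [← ENNReal.ofReal_mul hr, sq]

lemma norm_sub_le_of_mem_square {a b r : ℝ} (hr : 0 ≤ r) {x y : Euc 2} (hx : x ∈ square a b r)
    (hy : y ∈ square a b r) : ‖x - y‖ ≤ 2 * r := by
  rw [EuclideanSpace.norm_eq]
  refine Real.sqrt_le_iff.2 ⟨by positivity, ?_⟩
  obtain ⟨⟨h1, h2⟩, h3, h4⟩ := hx
  obtain ⟨⟨h1', h2'⟩, h3', h4'⟩ := hy
  simp only [Fin.sum_univ_two, Real.norm_eq_abs, sq_abs, PiLp.sub_apply]
  have e1 : (x 0 - y 0) ^ 2 ≤ r ^ 2 := by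
    rw [sq_le_sq, abs_of_nonneg hr]; exact abs_le.2 ⟨by linarith, by linarith⟩
  have e2 : (x 1 - y 1) ^ 2 ≤ r ^ 2 := by
    rw [sq_le_sq, abs_of_nonneg hr]; exact abs_le.2 ⟨by linarith, by linarith⟩
  nlinarith

/-- The integral of `‖F‖` over the homothetic copy of ratio `t` of a square, centred at one of its
points, in terms of the `L^q` norm of `F` on the square. -/
lemma lintegral_homothety_le {F : Euc 2 → Euc 2} (hF : Continuous F) {p : ℝ} {q : ENNReal}
    (hq1 : 1 ≤ q) (hq : 1 - 1 / q.toReal = 1 / p) {a b r : ℝ} (hr : 0 < r)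
    {x : Euc 2} (hx : x ∈ square a b r) {t : ℝ} (ht : t ∈ Set.Ioo (0 : ℝ) 1) :
    ∫⁻ z in square a b r, ‖F (x + t • (z - x))‖ₑ ≤
      ENNReal.ofReal (t ^ (2 / p - 2)) * (ENNReal.ofReal (r ^ (2 / p)) *
        eLpNorm F q (volume.restrict (square a b r))) := by
  set Q := square a b r with hQ
  set f : Euc 2 → Euc 2 := fun z => x + t • (z - x) with hf
  have hfd : ∀ z ∈ Q, HasFDerivWithinAt f (t • ContinuousLinearMap.id ℝ (Euc 2)) Q z := fun z _ =>
    ((((hasFDerivAt_id z).sub_const x).const_smul t).const_add x).hasFDerivWithinAt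
  have hinj : Set.InjOn f Q := fun z _ w _ h => by
    simpa [hf, ht.1.ne'] using h
  have hdet : ENNReal.ofReal |(t • ContinuousLinearMap.id ℝ (Euc 2)).det| =
      ENNReal.ofReal (t ^ 2) := by
    congr 1
    have : (t • ContinuousLinearMap.id ℝ (Euc 2)).det = t ^ 2 := by
      simp [ContinuousLinearMap.det]
    rw [this, abs_of_nonneg (sq_nonneg t)]
  have hfQ : f '' Q ⊆ Q := by
    rintro _ ⟨z, hz, rfl⟩
    have := convex_square a b r hx hz (sub_nonneg.2 ht.2.le) ht.1.le (by ring)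
    convert this using 1
    simp only [hf]; module
  have hcv := lintegral_image_eq_lintegral_abs_det_fderiv_mul volume (measurableSet_square a b r)
    hfd hinj fun z => ‖F z‖ₑ
  rw [hdet, lintegral_const_mul' _ _ ENNReal.ofReal_ne_top] at hcv
  have hvol : volume (f '' Q) = ENNReal.ofReal (t ^ 2 * r ^ 2) := by
    have := lintegral_image_eq_lintegral_abs_det_fderiv_mul volume (measurableSet_square a b r)
      hfd hinj fun z => 1
    rw [hdet] at this
    simp only [lintegral_const, MeasurableSet.univ, Measure.restrict_apply, Set.univ_inter,
      one_mul, mul_one] at this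
    rw [this, volume_square a b hr.le, ← ENNReal.ofReal_mul (sq_nonneg t)]
  have hhol : ∫⁻ z in f '' Q, ‖F z‖ₑ ≤
      eLpNorm F q (volume.restrict Q) * ENNReal.ofReal ((t * r) ^ (2 / p)) := by
    have h1 := eLpNorm_le_eLpNorm_mul_rpow_measure_univ (μ := volume.restrict (f '' Q)) hq1
      hF.aestronglyMeasurable
    rw [eLpNorm_one_eq_lintegral_enorm, Measure.restrict_apply_univ, hvol, ENNReal.toReal_one,
      div_one, hq, ← mul_pow, ENNReal.ofReal_rpow_of_pos (by have := ht.1; positivity),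
      ← Real.rpow_natCast, ← Real.rpow_mul (by have := ht.1; positivity)] at h1
    refine h1.trans (mul_le_mul' (eLpNorm_mono_measure _ (Measure.restrict_mono hfQ le_rfl)) ?_)
    rw [Nat.cast_ofNat, mul_one_div]
  have ht2 : ENNReal.ofReal (t ^ 2) ≠ 0 := by
    have := ht.1
    simp only [ne_eq, ENNReal.ofReal_eq_zero, not_le]; positivity
  rw [← ENNReal.mul_le_mul_iff_right ht2 ENNReal.ofReal_ne_top, ← hcv]
  refine hhol.trans (le_of_eq ?_)
  rw [← mul_assoc, ← mul_assoc, ← ENNReal.ofReal_mul (sq_nonneg t),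
    ← ENNReal.ofReal_mul (by have := ht.1; positivity), mul_comm]
  congr 2
  rw [Real.mul_rpow ht.1.le hr.le]
  congr 1
  rw [← Real.rpow_natCast, ← Real.rpow_add ht.1]
  congr 1
  push_cast; ring

/-- **Morrey's estimate** on a square, for a function whose gradient has the length of `F`. -/
lemma enorm_sub_le_of_mem_square {F : Euc 2 → Euc 2} (hF : Continuous F) {ψ : Euc 2 → ℝ}
    (hψ : ∀ x, HasFDerivAt ψ (crossL (F x)) x) {p : ℝ} {q : ENNReal}
    (hq1 : 1 ≤ q) (hq : 1 - 1 / q.toReal = 1 / p) (hp : 1 ≤ p) (hp2 : p < 2) {a b r : ℝ}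
    (hr : 0 < r) {x y : Euc 2} (hx : x ∈ square a b r) (hy : y ∈ square a b r) :
    ‖ψ x - ψ y‖ₑ ≤ ENNReal.ofReal (4 / (2 / p - 1)) * (ENNReal.ofReal (r ^ (2 / p - 1)) *
      eLpNorm F q (volume.restrict (square a b r))) := by
  set Q := square a b r with hQ
  set A := eLpNorm F q (volume.restrict Q) with hA
  have hp0 : 0 < p := by linarith
  have hpp : 0 < 2 / p - 1 := by rw [sub_pos, lt_div_iff₀ hp0]; linarith
  have hψc : Continuous ψ := continuous_iff_continuousAt.2 fun x => (hψ x).continuousAt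
  have hseg : ∀ x z, ‖ψ x - ψ z‖ₑ ≤
      ∫⁻ t in Set.Ioo (0 : ℝ) 1, ‖F (x + t • (z - x))‖ₑ * ‖z - x‖ₑ := by
    intro x z
    have hd : ∀ t : ℝ, HasDerivAt (fun t : ℝ => ψ (x + t • (z - x)))
        (crossL (F (x + t • (z - x))) (z - x)) t := by
      intro t
      have h1 : HasDerivAt (fun t : ℝ => x + t • (z - x)) (z - x) t := by
        simpa using ((hasDerivAt_id t).smul_const (z - x)).const_add x
      exact (hψ _).comp_hasDerivAt t h1
    have hc : Continuous fun t : ℝ => crossL (F (x + t • (z - x))) (z - x) := by fun_prop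
    have h2 := intervalIntegral.integral_eq_sub_of_hasDerivAt (a := 0) (b := 1)
      (fun t _ => hd t) (hc.intervalIntegrable _ _)
    have h3 : ψ z - ψ x = ∫ t in (0 : ℝ)..1, crossL (F (x + t • (z - x))) (z - x) := by
      rw [h2]; simp
    rw [← enorm_neg, neg_sub, h3, intervalIntegral.integral_of_le zero_le_one,
      ← restrict_Ioo_eq_restrict_Ioc]
    refine (enorm_integral_le_lintegral_enorm _).trans (lintegral_mono fun t => ?_)
    rw [← ofReal_norm, ← ofReal_norm, ← ofReal_norm, ← ENNReal.ofReal_mul (norm_nonneg _)]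
    exact ENNReal.ofReal_le_ofReal (abs_crossL_le _ _)
  have hrpow : ∫⁻ t in Set.Ioo (0 : ℝ) 1, ENNReal.ofReal (t ^ (2 / p - 2)) =
      ENNReal.ofReal (1 / (2 / p - 1)) := by
    rw [restrict_Ioo_eq_restrict_Ioc, ← ofReal_integral_eq_lintegral_ofReal,
      ← intervalIntegral.integral_of_le zero_le_one, integral_rpow (Or.inl (by linarith))]
    · congr 1
      rw [Real.one_rpow, Real.zero_rpow (by linarith)]
      ring
    · rw [← IntegrableOn, ← intervalIntegrable_iff_integrableOn_Ioc_of_le zero_le_one]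
      exact intervalIntegral.intervalIntegrable_rpow' (by linarith)
    · filter_upwards [ae_restrict_mem measurableSet_Ioc] with t ht
      exact Real.rpow_nonneg ht.1.le _
  -- averaging over the endpoint `z` of the segments from `x`
  have hB : ∀ x ∈ Q, ∫⁻ z in Q, ‖ψ x - ψ z‖ₑ ≤
      ENNReal.ofReal (2 * r) * (ENNReal.ofReal (1 / (2 / p - 1)) *
        (ENNReal.ofReal (r ^ (2 / p)) * A)) := by
    intro x hx
    have hmeas : AEMeasurable (Function.uncurry fun (z : Euc 2) (t : ℝ) =>
        ‖F (x + t • (z - x))‖ₑ)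
          ((volume.restrict Q).prod (volume.restrict (Set.Ioo (0 : ℝ) 1))) := by
      have : Continuous fun w : Euc 2 × ℝ => F (x + w.2 • (w.1 - x)) := by fun_prop
      exact this.enorm.aemeasurable
    calc ∫⁻ z in Q, ‖ψ x - ψ z‖ₑ
        ≤ ∫⁻ z in Q, ENNReal.ofReal (2 * r) *
            ∫⁻ t in Set.Ioo (0 : ℝ) 1, ‖F (x + t • (z - x))‖ₑ := by
          refine setLIntegral_mono' (measurableSet_square a b r) fun z hz => ?_
          refine (hseg x z).trans ?_
          rw [lintegral_mul_const' _ _ (by simp), mul_comm]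
          refine mul_le_mul' ?_ le_rfl
          rw [← ofReal_norm]
          exact ENNReal.ofReal_le_ofReal (norm_sub_le_of_mem_square hr.le hz hx)
      _ = ENNReal.ofReal (2 * r) * ∫⁻ t in Set.Ioo (0 : ℝ) 1, ∫⁻ z in Q,
            ‖F (x + t • (z - x))‖ₑ := by
          rw [lintegral_const_mul' _ _ ENNReal.ofReal_ne_top, lintegral_lintegral_swap hmeas]
      _ ≤ ENNReal.ofReal (2 * r) * ∫⁻ t in Set.Ioo (0 : ℝ) 1, ENNReal.ofReal (t ^ (2 / p - 2)) *
            (ENNReal.ofReal (r ^ (2 / p)) * A) :=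
          mul_le_mul' le_rfl (setLIntegral_mono' measurableSet_Ioo fun t ht =>
            lintegral_homothety_le hF hq1 hq hr hx ht)
      _ = _ := by
          rw [lintegral_mul_const _ (by fun_prop), hrpow]
  have hr2 : ENNReal.ofReal (r ^ 2) ≠ 0 := by
    simp only [ne_eq, ENNReal.ofReal_eq_zero, not_le]; positivity
  rw [← ENNReal.mul_le_mul_iff_right hr2 ENNReal.ofReal_ne_top]
  calc ENNReal.ofReal (r ^ 2) * ‖ψ x - ψ y‖ₑ
      = ∫⁻ _ in Q, ‖ψ x - ψ y‖ₑ := by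
        rw [setLIntegral_const, hQ, volume_square a b hr.le, mul_comm]
    _ ≤ ∫⁻ z in Q, (‖ψ x - ψ z‖ₑ + ‖ψ y - ψ z‖ₑ) := by
        refine lintegral_mono fun z => ?_
        have h1 : ψ x - ψ y = (ψ x - ψ z) - (ψ y - ψ z) := by ring
        rw [h1]
        exact enorm_sub_le
    _ = (∫⁻ z in Q, ‖ψ x - ψ z‖ₑ) + ∫⁻ z in Q, ‖ψ y - ψ z‖ₑ :=
        lintegral_add_left (continuous_const.sub hψc).enorm.measurable _
    _ ≤ _ := add_le_add (hB x hx) (hB y hy)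
    _ = _ := by
        rw [← two_mul]
        simp only [← mul_assoc]
        congr 1
        rw [show (2 : ENNReal) = ENNReal.ofReal 2 by simp,
          ← ENNReal.ofReal_mul (by norm_num), ← ENNReal.ofReal_mul (by positivity),
          ← ENNReal.ofReal_mul (by positivity), ← ENNReal.ofReal_mul (by positivity),
          ← ENNReal.ofReal_mul (by positivity)]
        congr 1
        rw [Real.rpow_sub hr, Real.rpow_one]
        field_simp
        ring

/-- `p` and `q` are conjugate exponents, where `1 ≤ p < ∞` is real. -/
def ConjExponents (p : ℝ) (q : ENNReal) : Prop :=
  (p = 1 ∧ q = ⊤) ∨ ∃ q' : ℝ, p.HolderConjugate q' ∧ q = ENNReal.ofReal q'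

lemma ConjExponents.one_le {p : ℝ} {q : ENNReal} (h : ConjExponents p q) : 1 ≤ q := by
  rcases h with ⟨_, rfl⟩ | ⟨q', h, rfl⟩
  · exact le_top
  · rw [← ENNReal.ofReal_one]; exact ENNReal.ofReal_le_ofReal h.symm.lt.le

lemma ConjExponents.one_sub_one_div {p : ℝ} {q : ENNReal} (h : ConjExponents p q) :
    1 - 1 / q.toReal = 1 / p := by
  rcases h with ⟨rfl, rfl⟩ | ⟨q', h, rfl⟩
  · simp
  · rw [ENNReal.toReal_ofReal h.symm.pos.le, one_div, one_div]
    linarith [h.inv_add_inv_eq_one]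

lemma exists_conjExponents {p : ℝ} (hp : 1 ≤ p) : ∃ q, ConjExponents p q := by
  rcases hp.eq_or_lt with rfl | h
  · exact ⟨⊤, Or.inl ⟨rfl, rfl⟩⟩
  · exact ⟨_, Or.inr ⟨_, Real.HolderConjugate.conjExponent h, rfl⟩⟩

/-- Morrey's estimate summed over disjoint squares: by Hölder's inequality for sums, the `L^q` norms
on the squares combine to the `L^q` norm on the plane. -/
lemma sum_enorm_sub_le {F : Euc 2 → Euc 2} (hF : Continuous F) {ψ : Euc 2 → ℝ}
    (hψ : ∀ x, HasFDerivAt ψ (crossL (F x)) x) {p : ℝ} {q : ENNReal} (hpq : ConjExponents p q)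
    (hp : 1 ≤ p) (hp2 : p < 2) {ι : Type*} (s : Finset ι) {a b r : ι → ℝ}
    (hr : ∀ i ∈ s, 0 < r i)
    (hdisj : (s : Set ι).PairwiseDisjoint fun i => square (a i) (b i) (r i))
    {x y : ι → Euc 2} (hx : ∀ i ∈ s, x i ∈ square (a i) (b i) (r i))
    (hy : ∀ i ∈ s, y i ∈ square (a i) (b i) (r i)) :
    ∑ i ∈ s, ‖ψ (x i) - ψ (y i)‖ₑ ≤ ENNReal.ofReal (4 / (2 / p - 1)) *
      ((∑ i ∈ s, ENNReal.ofReal (r i ^ (2 - p))) ^ (1 / p) * eLpNorm F q volume) := by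
  refine (Finset.sum_le_sum fun i hi => enorm_sub_le_of_mem_square hF hψ hpq.one_le
    hpq.one_sub_one_div hp hp2 (hr i hi) (hx i hi) (hy i hi)).trans ?_
  rw [← Finset.mul_sum]
  refine mul_le_mul' le_rfl ?_
  rcases hpq with ⟨rfl, rfl⟩ | ⟨q', hpq, rfl⟩
  · simp only [div_one, ENNReal.rpow_one, Finset.sum_mul]
    exact Finset.sum_le_sum fun i hi => mul_le_mul' le_rfl (eLpNorm_restrict_le _ _ _ _)
  · have hq0 : ENNReal.ofReal q' ≠ 0 := by
      simpa using hpq.symm.pos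
    have hA : ∀ t : Set (Euc 2), eLpNorm F (ENNReal.ofReal q') (volume.restrict t) ^ q' =
        ∫⁻ z in t, ‖F z‖ₑ ^ q' := by
      intro t
      rw [eLpNorm_eq_lintegral_rpow_enorm_toReal hq0 ENNReal.ofReal_ne_top,
        ENNReal.toReal_ofReal hpq.symm.pos.le, ← ENNReal.rpow_mul,
        one_div_mul_cancel hpq.symm.pos.ne', ENNReal.rpow_one]
    refine (ENNReal.inner_le_Lp_mul_Lq s _ _ hpq).trans (mul_le_mul' ?_ ?_)
    · refine ENNReal.rpow_le_rpow (Finset.sum_le_sum fun i hi => le_of_eq ?_)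
        (by have := hpq.pos; positivity)
      have := hr i hi
      rw [ENNReal.ofReal_rpow_of_pos (by positivity), ← Real.rpow_mul this.le]
      congr 2
      have := hpq.pos.ne'
      field_simp
    · simp_rw [hA]
      rw [← lintegral_biUnion_finset hdisj fun i _ => measurableSet_square _ _ _]
      rw [eLpNorm_eq_lintegral_rpow_enorm_toReal hq0 ENNReal.ofReal_ne_top,
        ENNReal.toReal_ofReal hpq.symm.pos.le]
      exact ENNReal.rpow_le_rpow (setLIntegral_le_lintegral _ _)
        (by have := hpq.symm.pos; positivity)

/-! ### Images of null sets for the Hausdorff measure -/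

/-- The dyadic square of level `k` with index `(m, n)`, for `i = (k, m, n)`. -/
def dyadicSquare (i : ℕ × ℤ × ℤ) : Set (Euc 2) :=
  square (i.2.1 / 2 ^ i.1) (i.2.2 / 2 ^ i.1) (2 ^ i.1)⁻¹

lemma mem_dyadicSquare {i : ℕ × ℤ × ℤ} {z : Euc 2} :
    z ∈ dyadicSquare i ↔ ⌊z 0 * 2 ^ i.1⌋ = i.2.1 ∧ ⌊z 1 * 2 ^ i.1⌋ = i.2.2 := by
  have h2 : (0 : ℝ) < 2 ^ i.1 := by positivity
  have key : ∀ (t : ℝ) (m : ℤ), t ∈ Set.Ico ((m : ℝ) / 2 ^ i.1) (m / 2 ^ i.1 + (2 ^ i.1)⁻¹) ↔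
      ⌊t * 2 ^ i.1⌋ = m := by
    intro t m
    rw [Int.floor_eq_iff, Set.mem_Ico, div_le_iff₀ h2, inv_eq_one_div, ← add_div, lt_div_iff₀ h2]
  simp only [dyadicSquare, square, Set.mem_ofPred_eq, key]

/-- Dyadic squares are nested or disjoint. -/
lemma dyadicSquare_subset {i j : ℕ × ℤ × ℤ} (hij : i.1 ≤ j.1)
    (h : ¬ Disjoint (dyadicSquare i) (dyadicSquare j)) : dyadicSquare j ⊆ dyadicSquare i := by
  obtain ⟨w, hwi, hwj⟩ := Set.not_disjoint_iff.1 h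
  intro z hz
  rw [mem_dyadicSquare] at *
  have key : ∀ t : ℝ, ⌊t * 2 ^ i.1⌋ = ⌊t * 2 ^ j.1⌋ / ((2 ^ (j.1 - i.1) : ℕ) : ℤ) := by
    intro t
    rw [← Int.floor_div_natCast]
    congr 1
    rw [eq_div_iff (by positivity)]
    push_cast
    rw [mul_assoc, ← pow_add, Nat.add_sub_cancel' hij]
  exact ⟨by rw [key, hz.1, ← hwj.1, ← key, hwi.1], by rw [key, hz.2, ← hwj.2, ← key, hwi.2]⟩

/-- The members of a family of dyadic squares that meet no larger member. -/
def maximalDyadic (I : Set (ℕ × ℤ × ℤ)) : Set (ℕ × ℤ × ℤ) :=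
  {i ∈ I | ∀ j ∈ I, j.1 < i.1 → Disjoint (dyadicSquare j) (dyadicSquare i)}

lemma pairwiseDisjoint_maximalDyadic (I : Set (ℕ × ℤ × ℤ)) :
    (maximalDyadic I).PairwiseDisjoint dyadicSquare := by
  intro i hi j hj hij
  rcases lt_trichotomy i.1 j.1 with h | h | h
  · exact hj.2 i hi.1 h
  · rw [Function.onFun, Set.disjoint_left]
    intro z hzi hzj
    rw [mem_dyadicSquare] at hzi hzj
    rw [h] at hzi
    exact hij (Prod.ext h (Prod.ext (hzi.1.symm.trans hzj.1) (hzi.2.symm.trans hzj.2)))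
  · exact (hi.2 j hj.1 h).symm

lemma exists_mem_maximalDyadic {I : Set (ℕ × ℤ × ℤ)} {i : ℕ × ℤ × ℤ} (hi : i ∈ I) {z : Euc 2}
    (hz : z ∈ dyadicSquare i) : ∃ j ∈ maximalDyadic I, z ∈ dyadicSquare j := by
  classical
  have hex : ∃ k, ∃ j ∈ I, j.1 = k ∧ z ∈ dyadicSquare j := ⟨i.1, i, hi, rfl, hz⟩
  obtain ⟨j, hj, hjk, hzj⟩ := Nat.find_spec hex
  refine ⟨j, ⟨hj, fun l hl hlj => ?_⟩, hzj⟩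
  by_contra hdis
  exact Nat.find_min hex (hjk ▸ hlj) ⟨l, hl, rfl, dyadicSquare_subset hlj.le hdis hzj⟩

/-- A set of diameter at most `2⁻ᵏ` is covered by nine dyadic squares of level `k`. -/
lemma exists_dyadicSquare_cover {k : ℕ} {t : Set (Euc 2)} {x : Euc 2}
    (h : ∀ z ∈ t, dist z x ≤ (2 ^ k)⁻¹) {z : Euc 2} (hz : z ∈ t) :
    ∃ e : Fin 3 × Fin 3, z ∈ dyadicSquare
      (k, ⌊x 0 * 2 ^ k⌋ + (e.1 : ℤ) - 1, ⌊x 1 * 2 ^ k⌋ + (e.2 : ℤ) - 1) := by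
  have h2 : (0 : ℝ) < 2 ^ k := by positivity
  have key : ∀ i : Fin 2, ∃ e : Fin 3, ⌊z i * 2 ^ k⌋ = ⌊x i * 2 ^ k⌋ + (e : ℤ) - 1 := by
    intro i
    have h3 : |z i - x i| ≤ (2 ^ k)⁻¹ := by
      have := (PiLp.norm_apply_le (z - x) i).trans ((dist_eq_norm z x) ▸ h z hz)
      simpa using this
    have h4 : |z i * 2 ^ k - x i * 2 ^ k| ≤ 1 := by
      rw [← sub_mul, abs_mul, abs_of_pos h2]
      calc |z i - x i| * 2 ^ k ≤ (2 ^ k)⁻¹ * 2 ^ k := by gcongr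
        _ = 1 := inv_mul_cancel₀ h2.ne'
    obtain ⟨h5, h6⟩ := abs_le.1 h4
    have h7 : ⌊x i * 2 ^ k⌋ - 1 ≤ ⌊z i * 2 ^ k⌋ := by
      rw [← Int.floor_sub_one]; exact Int.floor_mono (by linarith)
    have h8 : ⌊z i * 2 ^ k⌋ ≤ ⌊x i * 2 ^ k⌋ + 1 := by
      rw [← Int.floor_add_one]; exact Int.floor_mono (by linarith)
    refine ⟨⟨(⌊z i * 2 ^ k⌋ - ⌊x i * 2 ^ k⌋ + 1).toNat, by omega⟩, ?_⟩
    simp only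
    omega
  obtain ⟨e0, he0⟩ := key 0
  obtain ⟨e1, he1⟩ := key 1
  exact ⟨(e0, e1), mem_dyadicSquare.2 ⟨he0, he1⟩⟩

/-- A null set for the `s`-dimensional Hausdorff measure, `0 < s ≤ 1`, is covered by disjoint
dyadic squares whose sides have arbitrarily small sum of `s`-th powers. -/
lemma exists_disjoint_dyadic_cover {S : Set (Euc 2)} {s : ℝ} (hs : 0 < s) (hs1 : s ≤ 1)
    (hS : μH[s] S = 0) {ε : ENNReal} (hε : ε ≠ 0) :
    ∃ I : Set (ℕ × ℤ × ℤ), I.PairwiseDisjoint dyadicSquare ∧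
      (∀ z ∈ S, ∃ i ∈ I, z ∈ dyadicSquare i) ∧
      ∑' i : I, ENNReal.ofReal (((2 : ℝ) ^ i.1.1)⁻¹ ^ s) ≤ ε := by
  obtain ⟨η, hη, hηε⟩ : ∃ η : ENNReal, 0 < η ∧ 9 * (2 * (η + η)) ≤ ε := by
    refine ⟨ε / 36, ENNReal.div_pos hε (by simp), le_of_eq ?_⟩
    rw [← two_mul, ← mul_assoc, ← mul_assoc]
    norm_num
    rw [ENNReal.mul_div_cancel (by simp) (by simp)]
  obtain ⟨t, hSt, htd, htη⟩ : ∃ t : ℕ → Set (Euc 2), S ⊆ ⋃ n, t n ∧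
      (∀ n, Metric.ediam (t n) ≤ 1) ∧ ∑' n, Metric.ediam (t n) ^ s < η := by
    rw [Measure.hausdorffMeasure_apply] at hS
    have h1 := (iSup₂_eq_bot.1 hS) 1 one_pos
    have h2 : (⨅ (t : ℕ → Set (Euc 2)) (_ : S ⊆ ⋃ n, t n) (_ : ∀ n, Metric.ediam (t n) ≤ 1),
          ∑' n, ⨆ _ : (t n).Nonempty, Metric.ediam (t n) ^ s) < η := h1 ▸ hη
    simp only [iInf_lt_iff] at h2
    obtain ⟨t, h3, h4, h5⟩ := h2
    refine ⟨t, h3, h4, lt_of_le_of_lt (ENNReal.tsum_le_tsum fun n => ?_) h5⟩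
    rcases (t n).eq_empty_or_nonempty with h | h
    · simp [h, hs]
    · exact le_iSup_of_le h le_rfl
  obtain ⟨δ, hδ, hδη⟩ := ENNReal.exists_pos_sum_of_countable' hη.ne' ℕ
  -- the side `2⁻ᵏ` of the squares covering `t n` is comparable to the maximum of the diameter of
  -- `t n` and of a positive number `τ`, needed when the diameter vanishes
  have hr : ∀ n, ∃ k : ℕ, Metric.ediam (t n) ≤ ENNReal.ofReal (2 ^ k)⁻¹ ∧
      ENNReal.ofReal (((2 : ℝ) ^ k)⁻¹ ^ s) ≤ 2 * (Metric.ediam (t n) ^ s + δ n) := by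
    intro n
    have hfin : Metric.ediam (t n) ≠ ⊤ := ((htd n).trans_lt ENNReal.one_lt_top).ne
    obtain ⟨τ, hτ0, hτ1, hτ⟩ : ∃ τ : ℝ, 0 < τ ∧ τ ≤ 1 ∧ ENNReal.ofReal (τ ^ s) ≤ δ n := by
      have h1 : Tendsto (fun τ : ℝ => ENNReal.ofReal (τ ^ s)) (𝓝[>] 0) (𝓝 0) := by
        have h2 : Tendsto (fun τ : ℝ => τ ^ s) (𝓝 0) (𝓝 (0 ^ s)) :=
          (Real.continuousAt_rpow_const 0 s (Or.inr hs.le)).tendsto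
        rw [Real.zero_rpow hs.ne'] at h2
        have h3 := (ENNReal.continuous_ofReal.tendsto 0).comp h2
        rw [ENNReal.ofReal_zero] at h3
        exact h3.mono_left nhdsWithin_le_nhds
      obtain ⟨τ, h3, h4⟩ := ((ENNReal.tendsto_nhds_zero.1 h1 (δ n) (hδ n)).and
        (Ioc_mem_nhdsGT one_pos)).exists
      exact ⟨τ, h4.1, h4.2, h3⟩
    set d := (Metric.ediam (t n)).toReal with hd
    have hd0 : 0 ≤ d := ENNReal.toReal_nonneg
    have hd1 : d ≤ 1 := ENNReal.toReal_le_of_le_ofReal zero_le_one (by simpa using htd n)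
    have hdE : Metric.ediam (t n) = ENNReal.ofReal d := (ENNReal.ofReal_toReal hfin).symm
    obtain ⟨k, hk1, hk2⟩ := exists_nat_pow_near_of_lt_one (x := max d τ) (y := (1 / 2 : ℝ))
      (lt_max_of_lt_right hτ0) (max_le hd1 hτ1) (by norm_num) (by norm_num)
    have hkk : ((2 : ℝ) ^ k)⁻¹ = (1 / 2) ^ k := by rw [one_div, inv_pow]
    refine ⟨k, ?_, ?_⟩
    · rw [hdE, hkk]
      exact ENNReal.ofReal_le_ofReal ((le_max_left _ _).trans hk2)
    · have h1 : ((1 / 2 : ℝ) ^ k) ≤ 2 * max d τ := by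
        rw [pow_succ] at hk1; linarith
      have h2 : ((1 / 2 : ℝ) ^ k) ^ s ≤ 2 * (d ^ s + τ ^ s) := by
        calc ((1 / 2 : ℝ) ^ k) ^ s ≤ (2 * max d τ) ^ s := by gcongr
          _ = 2 ^ s * (max d τ) ^ s := Real.mul_rpow (by norm_num) (hd0.trans (le_max_left _ _))
          _ ≤ 2 * (d ^ s + τ ^ s) := by
            refine mul_le_mul ?_ ?_ (by positivity) (by norm_num)
            · calc (2 : ℝ) ^ s ≤ 2 ^ (1 : ℝ) := Real.rpow_le_rpow_of_exponent_le (by norm_num) hs1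
                _ = 2 := Real.rpow_one 2
            · rcases max_choice d τ with h | h <;> rw [h]
              · linarith [Real.rpow_nonneg hτ0.le s]
              · linarith [Real.rpow_nonneg hd0 s]
      rw [hkk]
      refine (ENNReal.ofReal_le_ofReal h2).trans ?_
      rw [ENNReal.ofReal_mul (by norm_num), ENNReal.ofReal_add (by positivity) (by positivity),
        hdE, ENNReal.ofReal_rpow_of_nonneg hd0 hs.le]
      simp only [ENNReal.ofReal_ofNat]
      gcongr
  choose k hk1 hk2 using hr
  have hx : ∀ n, ∃ x : Euc 2, ∀ z ∈ t n, dist z x ≤ (2 ^ k n)⁻¹ := by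
    intro n
    rcases (t n).eq_empty_or_nonempty with h | ⟨x, hx⟩
    · exact ⟨0, by simp [h]⟩
    · refine ⟨x, fun z hz => ?_⟩
      have h1 := (Metric.edist_le_ediam_of_mem hz hx).trans (hk1 n)
      rw [edist_dist] at h1
      exact (ENNReal.ofReal_le_ofReal_iff (by positivity)).1 h1
  choose x hx using hx
  let f : ℕ × (Fin 3 × Fin 3) → ℕ × ℤ × ℤ := fun a =>
    (k a.1, ⌊x a.1 0 * 2 ^ k a.1⌋ + (a.2.1 : ℤ) - 1, ⌊x a.1 1 * 2 ^ k a.1⌋ + (a.2.2 : ℤ) - 1)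
  refine ⟨maximalDyadic (Set.range f), pairwiseDisjoint_maximalDyadic _, fun z hz => ?_, ?_⟩
  · obtain ⟨n, hn⟩ := Set.mem_iUnion.1 (hSt hz)
    obtain ⟨e, he⟩ := exists_dyadicSquare_cover (hx n) hn
    exact exists_mem_maximalDyadic (I := Set.range f) ⟨(n, e), rfl⟩ he
  · have hsec : ∀ i : maximalDyadic (Set.range f), ∃ a, f a = i := fun i => i.2.1
    choose σ hσ using hsec
    have hσi : Function.Injective σ := fun i j h => Subtype.ext (by rw [← hσ i, ← hσ j, h])
    calc ∑' i : maximalDyadic (Set.range f), ENNReal.ofReal (((2 : ℝ) ^ i.1.1)⁻¹ ^ s)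
        = ∑' i, (fun a => ENNReal.ofReal (((2 : ℝ) ^ (k a.1))⁻¹ ^ s)) (σ i) := by
          refine tsum_congr fun i => ?_
          simp only
          rw [← hσ i]
      _ ≤ ∑' a : ℕ × (Fin 3 × Fin 3), ENNReal.ofReal (((2 : ℝ) ^ (k a.1))⁻¹ ^ s) :=
          ENNReal.tsum_comp_le_tsum_of_injective hσi _
      _ = ∑' n, 9 * ENNReal.ofReal (((2 : ℝ) ^ (k n))⁻¹ ^ s) := by
          rw [ENNReal.tsum_prod']
          refine tsum_congr fun n => ?_
          rw [tsum_fintype]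
          simp
      _ ≤ ∑' n, 9 * (2 * (Metric.ediam (t n) ^ s + δ n)) :=
          ENNReal.tsum_le_tsum fun n => mul_le_mul' le_rfl (hk2 n)
      _ = 9 * (2 * (∑' n, Metric.ediam (t n) ^ s + ∑' n, δ n)) := by
          rw [ENNReal.tsum_mul_left, ENNReal.tsum_mul_left, ENNReal.tsum_add]
      _ ≤ 9 * (2 * (η + η)) := by gcongr
      _ ≤ ε := hηε

/-- A function satisfying the summed Morrey estimate maps sets of vanishing `(2 - p)`-dimensional
Hausdorff measure to Lebesgue null sets. -/
lemma volume_image_eq_zero {ψ : Euc 2 → ℝ} {p : ℝ} (hp : 1 ≤ p) (hp2 : p < 2) {M : ENNReal}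
    (hM : M ≠ ⊤)
    (hψ : ∀ (s : Finset (ℕ × ℤ × ℤ)), (s : Set (ℕ × ℤ × ℤ)).PairwiseDisjoint dyadicSquare →
      ∀ x y : ℕ × ℤ × ℤ → Euc 2, (∀ i ∈ s, x i ∈ dyadicSquare i) →
      (∀ i ∈ s, y i ∈ dyadicSquare i) →
      ∑ i ∈ s, ‖ψ (x i) - ψ (y i)‖ₑ ≤
        M * (∑ i ∈ s, ENNReal.ofReal (((2 : ℝ) ^ i.1)⁻¹ ^ (2 - p))) ^ (1 / p))
    {S : Set (Euc 2)} (hS : μH[2 - p] S = 0) : volume (ψ '' S) = 0 := by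
  have hp0 : 0 < p := by linarith
  have hbd : ∀ ε : ENNReal, ε ≠ 0 → volume (ψ '' S) ≤ 2 * (M * ε ^ (1 / p)) := by
    intro ε hε
    obtain ⟨I, hI, hcov, hsum⟩ := exists_disjoint_dyadic_cover (by linarith) (by linarith) hS hε
    have hsub : ψ '' S ⊆ ⋃ i : I, ψ '' dyadicSquare i := by
      rintro _ ⟨z, hz, rfl⟩
      obtain ⟨i, hi, hzi⟩ := hcov z hz
      exact Set.mem_iUnion.2 ⟨⟨i, hi⟩, z, hzi, rfl⟩
    -- points of the square at which half of the oscillation of `ψ` is attained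
    have hpts : ∀ i : ℕ × ℤ × ℤ, ∃ x y : Euc 2, x ∈ dyadicSquare i ∧ y ∈ dyadicSquare i ∧
        Metric.ediam (ψ '' dyadicSquare i) ≤ 2 * ‖ψ x - ψ y‖ₑ := by
      intro i
      have hne : (dyadicSquare i).Nonempty :=
        ⟨!₂[(i.2.1 : ℝ) / 2 ^ i.1, (i.2.2 : ℝ) / 2 ^ i.1], mem_dyadicSquare.2 (by simp)⟩
      rcases eq_or_ne (Metric.ediam (ψ '' dyadicSquare i)) 0 with h0 | h0
      · obtain ⟨x, hx⟩ := hne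
        exact ⟨x, x, hx, hx, by simp [h0]⟩
      · have hfin : Metric.ediam (ψ '' dyadicSquare i) ≠ ⊤ := by
          have : Metric.ediam (ψ '' dyadicSquare i) ≤
              M * (ENNReal.ofReal (((2 : ℝ) ^ i.1)⁻¹ ^ (2 - p))) ^ (1 / p) := by
            refine Metric.ediam_image_le_iff.2 fun x hx y hy => ?_
            have := hψ {i} (by simp) (fun _ => x) (fun _ => y) (by simpa using hx)
              (by simpa using hy)
            rw [edist_eq_enorm_sub]
            simpa using this
          exact ne_top_of_le_ne_top (ENNReal.mul_ne_top hM
            (ENNReal.rpow_ne_top_of_nonneg (by positivity) ENNReal.ofReal_ne_top)) this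
        by_contra hcon
        push Not at hcon
        have hle : Metric.ediam (ψ '' dyadicSquare i) ≤
            Metric.ediam (ψ '' dyadicSquare i) / 2 := by
          refine Metric.ediam_image_le_iff.2 fun x hx y hy => ?_
          rw [edist_eq_enorm_sub, ENNReal.le_div_iff_mul_le (by simp) (by simp), mul_comm]
          exact (hcon x y hx hy).le
        exact absurd (ENNReal.half_lt_self h0 hfin) (not_lt.2 hle)
    choose x y hx hy hxy using hpts
    calc volume (ψ '' S) ≤ ∑' i : I, volume (ψ '' dyadicSquare i) :=
          (measure_mono hsub).trans (measure_iUnion_le _)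
      _ ≤ ∑' i : I, 2 * ‖ψ (x i) - ψ (y i)‖ₑ :=
          ENNReal.tsum_le_tsum fun i => (Real.volume_le_diam _).trans (hxy i)
      _ = 2 * ∑' i : I, ‖ψ (x i) - ψ (y i)‖ₑ := ENNReal.tsum_mul_left
      _ ≤ 2 * (M * ε ^ (1 / p)) := by
          refine mul_le_mul' le_rfl ?_
          rw [ENNReal.tsum_eq_iSup_sum]
          refine iSup_le fun s => ?_
          have h1 := hψ (s.map (Function.Embedding.subtype _)) (fun i hi j hj hij => by
            simp only [Finset.coe_map, Set.mem_image, Function.Embedding.subtype_apply] at hi hj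
            obtain ⟨i', _, rfl⟩ := hi
            obtain ⟨j', _, rfl⟩ := hj
            exact hI i'.2 j'.2 hij) x y (fun i _ => hx i) (fun i _ => hy i)
          rw [Finset.sum_map, Finset.sum_map] at h1
          refine h1.trans (mul_le_mul' le_rfl (ENNReal.rpow_le_rpow ?_ (by positivity)))
          exact (ENNReal.sum_le_tsum s).trans hsum
  have hlim : Tendsto (fun ε : ENNReal => 2 * (M * ε ^ (1 / p))) (𝓝[≠] 0) (𝓝 0) := by
    have h1 : Tendsto (fun ε : ENNReal => ε ^ (1 / p)) (𝓝[≠] 0) (𝓝 0) := by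
      have := (ENNReal.continuous_rpow_const (y := 1 / p)).tendsto 0
      rw [ENNReal.zero_rpow_of_pos (by positivity)] at this
      exact this.mono_left nhdsWithin_le_nhds
    have h2 := ENNReal.Tendsto.const_mul (a := M) h1 (Or.inr hM)
    have h3 := ENNReal.Tendsto.const_mul (a := 2) h2 (Or.inr (by simp))
    simpa using h3
  refine le_antisymm (ge_of_tendsto hlim ?_) zero_le
  filter_upwards [self_mem_nhdsWithin] with ε hε using hbd ε hε

/-! ### Constancy of stream functions on connected sets -/

/-- The measure preserving identification of `ℝ × ℝ` with the Euclidean plane. -/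
lemma measurePreserving_plane :
    MeasurePreserving (fun w : ℝ × ℝ => (!₂[w.1, w.2] : Euc 2)) volume volume :=
  (PiLp.volume_preserving_toLp (Fin 2)).comp (volume_preserving_finTwoArrow ℝ).symm

lemma continuous_plane : Continuous fun w : ℝ × ℝ => (!₂[w.1, w.2] : Euc 2) := by
  refine (PiLp.continuous_toLp 2 _).comp (continuous_pi fun i => ?_)
  fin_cases i
  · exact continuous_fst
  · exact continuous_snd

lemma continuous_plane_swap : Continuous fun w : ℝ × ℝ => (!₂[w.2, w.1] : Euc 2) := by
  refine (PiLp.continuous_toLp 2 _).comp (continuous_pi fun i => ?_)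
  fin_cases i
  · exact continuous_snd
  · exact continuous_fst

lemma lintegral_plane {f : Euc 2 → ENNReal} (hf : Measurable f) :
    ∫⁻ x, f x = ∫⁻ a : ℝ, ∫⁻ b : ℝ, f !₂[a, b] := by
  rw [← measurePreserving_plane.lintegral_comp hf, Measure.volume_eq_prod]
  exact lintegral_prod (fun w : ℝ × ℝ => f !₂[w.1, w.2])
    (hf.comp continuous_plane.measurable).aemeasurable

/-- The variation of a function on a line is at most the integral of the length of its gradient
along the line. -/
lemma enorm_sub_le_lintegral_line {D : Euc 2 → Euc 2} (hD : Continuous D) {h : Euc 2 → ℝ}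
    (hh : ∀ x, HasFDerivAt h (crossL (D x)) x) {γ : ℝ → Euc 2} {e : Euc 2} (he : ‖e‖ = 1)
    (hγ : ∀ t, HasDerivAt γ e t) (s t : ℝ) :
    ‖h (γ t) - h (γ s)‖ₑ ≤ ∫⁻ r, ‖D (γ r)‖ₑ := by
  have hγc : Continuous γ := continuous_iff_continuousAt.2 fun t => (hγ t).continuousAt
  have hd : ∀ r, HasDerivAt (fun r => h (γ r)) (crossL (D (γ r)) e) r := fun r =>
    (hh _).comp_hasDerivAt r (hγ r)
  have hc : Continuous fun r => crossL (D (γ r)) e := by fun_prop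
  rw [← intervalIntegral.integral_eq_sub_of_hasDerivAt (fun r _ => hd r)
    (hc.intervalIntegrable _ _), ← enorm_norm, intervalIntegral.norm_intervalIntegral_eq,
    enorm_norm]
  refine (enorm_integral_le_lintegral_enorm _).trans
    ((setLIntegral_le_lintegral _ _).trans (lintegral_mono fun r => ?_))
  rw [← ofReal_norm, ← ofReal_norm]
  refine ENNReal.ofReal_le_ofReal ((abs_crossL_le _ _).trans ?_)
  rw [he, mul_one]

lemma hasDerivAt_plane_snd (a t : ℝ) :
    HasDerivAt (fun t : ℝ => (!₂[a, t] : Euc 2)) (EuclideanSpace.single 1 1) t := by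
  have h := ((hasDerivAt_id t).smul_const (EuclideanSpace.single 1 1 : Euc 2)).const_add
    (EuclideanSpace.single 0 a : Euc 2)
  rw [one_smul] at h
  refine h.congr_of_eventuallyEq (Eventually.of_forall fun s => ?_)
  ext i; fin_cases i <;> simp

lemma hasDerivAt_plane_fst (b t : ℝ) :
    HasDerivAt (fun t : ℝ => (!₂[t, b] : Euc 2)) (EuclideanSpace.single 0 1) t := by
  have h := ((hasDerivAt_id t).smul_const (EuclideanSpace.single 0 1 : Euc 2)).const_add
    (EuclideanSpace.single 1 b : Euc 2)
  rw [one_smul] at h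
  refine h.congr_of_eventuallyEq (Eventually.of_forall fun s => ?_)
  ext i; fin_cases i <;> simp

lemma ae_tendsto_zero_of_tsum_lintegral {α : Type*} [MeasurableSpace α] {μ : Measure α}
    {m : ℕ → α → ENNReal} (hm : ∀ n, Measurable (m n)) (hs : ∑' n, ∫⁻ t, m n t ∂μ ≠ ⊤) :
    ∀ᵐ t ∂μ, Tendsto (fun n => m n t) atTop (𝓝 0) := by
  rw [← lintegral_tsum fun n => (hm n).aemeasurable] at hs
  filter_upwards [ae_lt_top (Measurable.tsum hm) hs] with t ht
  exact ENNReal.tendsto_atTop_zero_of_tsum_ne_top ht.ne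

lemma tendsto_zero_of_enorm_le {f : ℕ → ℝ} {m : ℕ → ENNReal} (hfm : ∀ n, ‖f n‖ₑ ≤ m n)
    (hm : Tendsto m atTop (𝓝 0)) : Tendsto f atTop (𝓝 0) := by
  rw [tendsto_zero_iff_enorm_tendsto_zero]
  exact tendsto_of_tendsto_of_tendsto_of_le_of_le tendsto_const_nhds hm (fun _ => zero_le) hfm

lemma norm_single_one (i : Fin 2) : ‖(EuclideanSpace.single i 1 : Euc 2)‖ = 1 := by
  rw [PiLp.norm_single, norm_one]

lemma plane_eta (z : Euc 2) : (!₂[z 0, z 1] : Euc 2) = z := by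
  ext i; fin_cases i <;> rfl

/-- If the gradients of `h n` have summable `L¹` norms, then after subtraction of constants `h n`
tends to zero on almost every line parallel to an axis. The constants are the values of `h n` at the
intersection of two such lines, which all the others can be compared with. -/
lemma exists_tendsto_on_lines {D : ℕ → Euc 2 → Euc 2} (hD : ∀ n, Continuous (D n))
    {h : ℕ → Euc 2 → ℝ} (hh : ∀ n x, HasFDerivAt (h n) (crossL (D n x)) x)
    (hsum : ∑' n, ∫⁻ x, ‖D n x‖ₑ ≠ ⊤) :
    ∃ (A B : Set ℝ) (c : ℕ → ℝ), (∀ᵐ t, t ∈ A) ∧ (∀ᵐ t, t ∈ B) ∧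
      ∀ z : Euc 2, z 0 ∈ A ∨ z 1 ∈ B → Tendsto (fun n => h n z - c n) atTop (𝓝 0) := by
  have hm : ∀ n, Measurable fun w : ℝ × ℝ => ‖D n !₂[w.1, w.2]‖ₑ := fun n =>
    ((hD n).comp continuous_plane).enorm.measurable
  have hm' : ∀ n, Measurable fun w : ℝ × ℝ => ‖D n !₂[w.2, w.1]‖ₑ := fun n =>
    ((hD n).comp continuous_plane_swap).enorm.measurable
  let mA : ℕ → ℝ → ENNReal := fun n a => ∫⁻ b, ‖D n !₂[a, b]‖ₑ
  let mB : ℕ → ℝ → ENNReal := fun n b => ∫⁻ a, ‖D n !₂[a, b]‖ₑ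
  have hmA : ∀ n, ∫⁻ a, mA n a = ∫⁻ x, ‖D n x‖ₑ := fun n =>
    (lintegral_plane (hD n).enorm.measurable).symm
  have hmB : ∀ n, ∫⁻ b, mB n b = ∫⁻ x, ‖D n x‖ₑ := fun n => by
    rw [lintegral_plane (hD n).enorm.measurable]
    exact (lintegral_lintegral_swap (f := fun a b => ‖D n !₂[a, b]‖ₑ) (hm n).aemeasurable).symm
  have hA : ∀ᵐ t, Tendsto (fun n => mA n t) atTop (𝓝 0) :=
    ae_tendsto_zero_of_tsum_lintegral (fun n => (hm n).lintegral_prod_right') (by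
      simp only [hmA]; exact hsum)
  have hB : ∀ᵐ t, Tendsto (fun n => mB n t) atTop (𝓝 0) :=
    ae_tendsto_zero_of_tsum_lintegral (fun n => (hm' n).lintegral_prod_right') (by
      simp only [hmB]; exact hsum)
  obtain ⟨a₀, ha₀⟩ := hA.exists
  obtain ⟨b₀, hb₀⟩ := hB.exists
  have hv : ∀ a, Tendsto (fun n => mA n a) atTop (𝓝 0) → ∀ b b' : ℝ,
      Tendsto (fun n => h n !₂[a, b] - h n !₂[a, b']) atTop (𝓝 0) := fun a ha b b' =>
    tendsto_zero_of_enorm_le (fun n => enorm_sub_le_lintegral_line (hD n) (hh n)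
      (norm_single_one 1) (hasDerivAt_plane_snd a) b' b) ha
  have hhz : ∀ b, Tendsto (fun n => mB n b) atTop (𝓝 0) → ∀ a a' : ℝ,
      Tendsto (fun n => h n !₂[a, b] - h n !₂[a', b]) atTop (𝓝 0) := fun b hb a a' =>
    tendsto_zero_of_enorm_le (fun n => enorm_sub_le_lintegral_line (hD n) (hh n)
      (norm_single_one 0) (hasDerivAt_plane_fst b) a' a) hb
  refine ⟨{t | Tendsto (fun n => mA n t) atTop (𝓝 0)},
    {t | Tendsto (fun n => mB n t) atTop (𝓝 0)}, fun n => h n !₂[a₀, b₀], hA, hB,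
    fun z hz => ?_⟩
  have hpair : ∀ a b : ℝ, Tendsto (fun n => mA n a) atTop (𝓝 0) ∨
      Tendsto (fun n => mB n b) atTop (𝓝 0) →
      Tendsto (fun n => h n !₂[a, b] - h n !₂[a₀, b₀]) atTop (𝓝 0) := by
    rintro a b (hz | hz)
    · have := (hv a hz b b₀).add (hhz b₀ hb₀ a a₀)
      rw [add_zero] at this
      exact this.congr fun n => by ring
    · have := (hhz b hz a a₀).add (hv a₀ ha₀ b b₀)
      rw [add_zero] at this
      exact this.congr fun n => by ring
  have := hpair (z 0) (z 1) hz
  rwa [plane_eta] at this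

/-- A continuous function on the plane which is constant on the intersection of a connected set
with the union of almost all lines parallel to the axes is constant on the connected set: these
lines meet a nontrivial connected set in a dense subset. -/
lemma eq_of_isPreconnected {K : Set (Euc 2)} (hK : IsPreconnected K) {ψ : Euc 2 → ℝ}
    (hψ : Continuous ψ) {A B : Set ℝ} (hA : ∀ᵐ t, t ∈ A) (hB : ∀ᵐ t, t ∈ B)
    (hconst : ∀ z ∈ K, ∀ w ∈ K, (z 0 ∈ A ∨ z 1 ∈ B) → (w 0 ∈ A ∨ w 1 ∈ B) → ψ z = ψ w)
    {x y : Euc 2} (hx : x ∈ K) (hy : y ∈ K) : ψ x = ψ y := by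
  rcases eq_or_ne x y with rfl | hxy
  · rfl
  -- the sup-norm distance to `x` takes an interval of values on `K`, and almost every small value
  -- is only attained at points whose first coordinate is in `A` or whose second one is in `B`
  have hnear : ∀ x ∈ K, ∀ y ∈ K, x ≠ y → ∀ δ > 0,
      ∃ z ∈ K, dist z x < δ ∧ (z 0 ∈ A ∨ z 1 ∈ B) := by
    intro x hx y hy hxy δ hδ
    let N : Euc 2 → ℝ := fun z => max |z 0 - x 0| |z 1 - x 1|
    have hNc : Continuous N := by
      simp only [N]
      fun_prop
    have hNx : N x = 0 := by simp [N]
    have hNy : 0 < N y := by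
      by_contra h
      apply hxy
      have h0 : |y 0 - x 0| ≤ 0 := (le_max_left _ _).trans (not_lt.1 h)
      have h1 : |y 1 - x 1| ≤ 0 := (le_max_right _ _).trans (not_lt.1 h)
      ext i; fin_cases i
      · have := abs_nonpos_iff.1 h0; simp only [Fin.zero_eta]; linarith
      · have := abs_nonpos_iff.1 h1; simp only [Fin.mk_one]; linarith
    have hshift : ∀ (A : Set ℝ) (c : ℝ), (∀ᵐ t, t ∈ A) →
        (∀ᵐ r : ℝ, c + r ∈ A) ∧ ∀ᵐ r : ℝ, c - r ∈ A :=
      fun A c h => ⟨(measurePreserving_add_left volume c).quasiMeasurePreserving.ae h,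
        (Measure.measurePreserving_sub_left volume c).quasiMeasurePreserving.ae h⟩
    have hpos : 0 < min (N y) (δ / 2) := lt_min hNy (by positivity)
    have hgood : ∀ᵐ r : ℝ, (x 0 + r ∈ A ∧ x 0 - r ∈ A) ∧ (x 1 + r ∈ B ∧ x 1 - r ∈ B) := by
      filter_upwards [(hshift A (x 0) hA).1, (hshift A (x 0) hA).2, (hshift B (x 1) hB).1,
        (hshift B (x 1) hB).2] with r h1 h2 h3 h4 using ⟨⟨h1, h2⟩, h3, h4⟩
    have hIoo : (volume.restrict (Set.Ioo 0 (min (N y) (δ / 2)))) ≠ 0 := by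
      rw [ne_eq, Measure.restrict_eq_zero, Real.volume_Ioo, sub_zero, ENNReal.ofReal_eq_zero]
      exact not_le.2 hpos
    have : NeBot (ae (volume.restrict (Set.Ioo 0 (min (N y) (δ / 2))))) := ae_neBot.2 hIoo
    have hev : ∀ᵐ r ∂(volume.restrict (Set.Ioo 0 (min (N y) (δ / 2)))),
        ((x 0 + r ∈ A ∧ x 0 - r ∈ A) ∧ (x 1 + r ∈ B ∧ x 1 - r ∈ B)) ∧
          r ∈ Set.Ioo 0 (min (N y) (δ / 2)) :=
      (ae_restrict_of_ae hgood).and (ae_restrict_mem measurableSet_Ioo)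
    obtain ⟨r, ⟨⟨hr1, hr2⟩, hr3, hr4⟩, hr⟩ := hev.exists
    have himg : r ∈ N '' K := by
      have := (hK.image N hNc.continuousOn).ordConnected.out
        (Set.mem_image_of_mem N hx) (Set.mem_image_of_mem N hy)
      rw [hNx] at this
      exact this ⟨hr.1.le, (hr.2.trans_le (min_le_left _ _)).le⟩
    obtain ⟨z, hzK, hzr⟩ := himg
    refine ⟨z, hzK, ?_, ?_⟩
    · have h0 : |z 0 - x 0| ≤ r := (le_max_left _ _).trans hzr.le
      have h1 : |z 1 - x 1| ≤ r := (le_max_right _ _).trans hzr.le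
      have hr2 : 2 * r < δ := by have := hr.2.trans_le (min_le_right _ _); linarith
      refine lt_of_le_of_lt ?_ hr2
      rw [dist_eq_norm, EuclideanSpace.norm_eq]
      refine Real.sqrt_le_iff.2 ⟨by have := hr.1; positivity, ?_⟩
      simp only [Fin.sum_univ_two, Real.norm_eq_abs, PiLp.sub_apply]
      nlinarith [abs_nonneg (z 0 - x 0), abs_nonneg (z 1 - x 1), hr.1]
    · rcases max_choice |z 0 - x 0| |z 1 - x 1| with h | h
      · left
        have h2 : |z 0 - x 0| = r := by rw [← h]; exact hzr
        rcases (abs_eq hr.1.le).1 h2 with h3 | h3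
        · rwa [show z 0 = x 0 + r by linarith]
        · rwa [show z 0 = x 0 - r by linarith]
      · right
        have h2 : |z 1 - x 1| = r := by rw [← h]; exact hzr
        rcases (abs_eq hr.1.le).1 h2 with h3 | h3
        · rwa [show z 1 = x 1 + r by linarith]
        · rwa [show z 1 = x 1 - r by linarith]
  refine eq_of_forall_dist_le fun ε hε => ?_
  obtain ⟨δ, hδ, hδε⟩ := Metric.continuousAt_iff.1 (hψ.continuousAt (x := x)) (ε / 2)
    (by positivity)
  obtain ⟨δ', hδ', hδε'⟩ :=
    Metric.continuousAt_iff.1 (hψ.continuousAt (x := y)) (ε / 2) (by positivity)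
  obtain ⟨z, hz, hzx, hzg⟩ := hnear x hx y hy hxy δ hδ
  obtain ⟨w, hw, hwy, hwg⟩ := hnear y hy x hx hxy.symm δ' hδ'
  have h1 := hδε hzx
  have h2 := hδε' hwy
  rw [hconst z hz w hw hzg hwg] at h1
  have h3 := dist_triangle_left (ψ x) (ψ y) (ψ w)
  linarith

/-- A function with vanishing derivative on a neighbourhood of a preconnected set is constant on
that set. -/
lemma eq_of_fderiv_eq_zero_near {U K : Set (Euc 2)} (hU : IsOpen U) (hKU : K ⊆ U)
    (hK : IsPreconnected K) {f : Euc 2 → ℝ} (hf : ∀ x ∈ U, HasFDerivAt f (0 : Euc 2 →L[ℝ] ℝ) x)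
    {x y : Euc 2} (hx : x ∈ K) (hy : y ∈ K) : f x = f y := by
  have hloc : ∀ x ∈ U, ∀ᶠ z in 𝓝 x, f z = f x := by
    intro x hx
    obtain ⟨r, hr, hrU⟩ := Metric.isOpen_iff.1 hU x hx
    filter_upwards [Metric.ball_mem_nhds x hr] with z hz
    exact (convex_ball x r).is_const_of_fderivWithin_eq_zero (𝕜 := ℝ)
      (fun w hw => (hf w (hrU hw)).differentiableAt.differentiableWithinAt)
      (fun w hw => by
        rw [fderivWithin_of_isOpen Metric.isOpen_ball hw, (hf w (hrU hw)).fderiv])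
      hz (Metric.mem_ball_self hr)
  exact hK.induction₂ (fun a b => f a = f b)
    (fun a ha => mem_nhdsWithin_of_mem_nhds ((hloc a (hKU ha)).mono fun z hz => hz.symm))
    (fun a b c _ _ _ h1 h2 => h1.trans h2) (fun a b _ _ h => h.symm) hx hy

/-- The limit `ψ` of stream functions of fields converging to `Φ` is constant on every connected
subset of the complement of `Ω`, when `Φ` is also the limit of divergence-free test fields
on `Ω`. -/
lemma eq_of_isPreconnected_compl {Ω K : Set (Euc 2)} (hK : IsPreconnected K) (hKΩ : K ⊆ Ωᶜ)
    {Ψ F : ℕ → Euc 2 → Euc 2} (hΨ : ∀ n, TestField Ω (Ψ n)) (hΨd : ∀ n x, dvg (Ψ n) x = 0)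
    (hF : ∀ n, Continuous (F n)) {ψ' : ℕ → Euc 2 → ℝ}
    (hψ' : ∀ n x, HasFDerivAt (ψ' n) (crossL (F n x)) x)
    (hsum : ∑' n, ∫⁻ x, ‖Ψ n x - F n x‖ₑ ≠ ⊤) {ψ : Euc 2 → ℝ} (hψ : Continuous ψ)
    (hlim : ∀ x, Tendsto (fun n => ψ' n x) atTop (𝓝 (ψ x))) {x y : Euc 2} (hx : x ∈ K)
    (hy : y ∈ K) : ψ x = ψ y := by
  -- `φ n`, the stream function of the test field `Ψ n`, is constant on `K`
  choose φ _ hφ using fun n => exists_stream_function (hΨ n).contDiff (hΨd n)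
  have hφK : ∀ n, ∀ z ∈ K, φ n z = φ n x := by
    intro n z hz
    refine eq_of_fderiv_eq_zero_near (U := (tsupport (Ψ n))ᶜ)
      (isClosed_tsupport _).isOpen_compl
      (fun w hw h => hKΩ hw ((hΨ n).tsupport_subset h)) hK (fun w hw => ?_) hz hx
    have := hφ n w
    rwa [image_eq_zero_of_notMem_tsupport hw, map_zero] at this
  obtain ⟨A, B, c, hA, hB, hc⟩ := exists_tendsto_on_lines (D := fun n x => Ψ n x - F n x)
    (h := fun n x => φ n x - ψ' n x) (fun n => (hΨ n).contDiff.continuous.sub (hF n))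
    (fun n z => by
      rw [map_sub]
      exact (hφ n z).sub (hψ' n z)) hsum
  have hgood : ∀ z ∈ K, (z 0 ∈ A ∨ z 1 ∈ B) →
      Tendsto (fun n => φ n x - c n) atTop (𝓝 (ψ z)) := by
    intro z hz hzg
    have := (hc z hzg).add (hlim z)
    simp only [hφK _ z hz, zero_add] at this
    refine this.congr fun n => ?_
    ring
  exact eq_of_isPreconnected hK hψ hA hB (fun z hz w hw hzg hwg =>
    tendsto_nhds_unique (hgood z hz hzg) (hgood w hw hwg)) hx hy

/-! ### Fields orthogonal to gradients and their regularizations -/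

/-- A square integrable field, vanishing outside `Ω`, which is orthogonal to the weak gradients
of all functions of `W^{1,2}(Ω)`: the weak form of being divergence-free in the plane with support
in `Ω`. -/
structure OrthogonalToGradients (Ω : Set (Euc 2)) (Φ : Euc 2 → Euc 2) : Prop where
  memLp : MemLp Φ 2
  eq_zero : ∀ x ∉ Ω, Φ x = 0
  integral_eq_zero : ∀ (v : Euc 2 → ℝ) (G : Euc 2 → Euc 2), MemLp v 2 (volume.restrict Ω) →
    HasWeakGradient Ω v G → MemLp G 2 (volume.restrict Ω) → ∫ x in Ω, inner ℝ (G x) (Φ x) = 0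

lemma eLpNorm_le_of_eq_zero_off {F : Type*} [NormedAddCommGroup F] {f : Euc 2 → F}
    {B : Set (Euc 2)} {p q : ENNReal} (hpq : p ≤ q) (hf : AEStronglyMeasurable f)
    (h0 : ∀ x ∉ B, f x = 0) : eLpNorm f p volume ≤
      eLpNorm f q volume * volume B ^ (1 / p.toReal - 1 / q.toReal) := by
  have hs : Function.support f ⊆ B := fun x hx => by
    by_contra h
    exact hx (h0 x h)
  rw [← eLpNorm_restrict_eq_of_support_subset hs]
  refine (eLpNorm_le_eLpNorm_mul_rpow_measure_univ hpq hf.restrict).trans ?_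
  rw [Measure.restrict_apply_univ]
  gcongr
  exact Measure.restrict_le_self

namespace OrthogonalToGradients

variable {Ω : Set (Euc 2)} {Φ : Euc 2 → Euc 2}

lemma locallyIntegrable (h : OrthogonalToGradients Ω Φ) : LocallyIntegrable Φ :=
  h.memLp.locallyIntegrable (by norm_num)

lemma dvg_mollify_eq_zero (h : OrthogonalToGradients Ω Φ) (hΩ : IsOpen Ω) {ε : ℝ} (hε : 0 < ε)
    (x : Euc 2) : dvg (mollify ε Φ) x = 0 := by
  rw [dvg_mollify hε h.locallyIntegrable]
  have hv : ContDiff ℝ ∞ fun y => moll ε (x - y) :=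
    (contDiff_moll ε).comp (contDiff_const.sub contDiff_id)
  have hc : HasCompactSupport fun y => moll ε (x - y) :=
    (hasCompactSupport_moll hε).comp_homeomorph (Homeomorph.subLeft x)
  have hG := contDiff_gradient hv
  have hGc : HasCompactSupport (gradient fun y => moll ε (x - y)) :=
    hc.of_isClosed_subset (isClosed_tsupport _) (tsupport_gradient_subset _)
  have h0 := h.integral_eq_zero _ _
    ((hv.continuous.memLp_of_hasCompactSupport hc).restrict Ω)
    (hasWeakGradient_of_hasFDerivAt hΩ
      (fun y _ => hasFDerivAt_innerSL_gradient (hv.differentiable (by simp) y))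
      hG.continuous.continuousOn)
    ((hG.continuous.memLp_of_hasCompactSupport hGc).restrict Ω)
  rw [setIntegral_eq_integral_of_forall_compl_eq_zero (fun y hy => by
    rw [h.eq_zero y hy, inner_zero_right])] at h0
  rw [← neg_eq_zero, ← integral_neg, ← h0]
  refine integral_congr_ae (Eventually.of_forall fun y => ?_)
  have hd : HasFDerivAt (fun y => moll ε (x - y))
      ((fderiv ℝ (moll ε) (x - y)).comp (-ContinuousLinearMap.id ℝ (Euc 2))) y :=
    (((contDiff_moll ε).differentiable (by simp)) (x - y)).hasFDerivAt.comp y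
      ((hasFDerivAt_id y).const_sub x)
  simp only [inner_gradient_left, hd.fderiv]
  simp

/-- The regularizations of a field orthogonal to gradients, together with divergence-free test
fields at summable distance from them. -/
lemma exists_approx (h : OrthogonalToGradients Ω Φ) (hΩ : IsOpen Ω)
    (hb : Bornology.IsBounded Ω) : ∃ (ε : ℕ → ℝ) (Ψ : ℕ → Euc 2 → Euc 2),
      (∀ n, 0 < ε n) ∧ (∀ n, ε n ≤ 1) ∧ Tendsto ε atTop (𝓝[>] 0) ∧ (∀ n, TestField Ω (Ψ n)) ∧
      (∀ n x, dvg (Ψ n) x = 0) ∧ ∑' n, ∫⁻ x, ‖Ψ n x - mollify (ε n) Φ x‖ₑ ≠ ⊤ := by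
  have hmol : ∀ n : ℕ, ∃ ε : ℝ, 0 < ε ∧ ε < 1 / ((n : ℝ) + 1) ∧
      eLpNorm (mollify ε Φ - Φ) 2 volume ≤ ENNReal.ofReal ((1 / 2) ^ n) := by
    intro n
    have h1 : ∀ᶠ ε in 𝓝[>] (0 : ℝ), eLpNorm (mollify ε Φ - Φ) 2 volume ≤
        ENNReal.ofReal ((1 / 2) ^ n) :=
      ENNReal.tendsto_nhds_zero.1 (tendsto_eLpNorm_mollify_sub (by norm_num) (by simp) h.memLp) _
        (by simp)
    have h2 : ∀ᶠ ε in 𝓝[>] (0 : ℝ), ε ∈ Set.Ioo (0 : ℝ) (1 / ((n : ℝ) + 1)) :=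
      Ioo_mem_nhdsGT (by positivity)
    obtain ⟨ε, h3, h4⟩ := (h1.and h2).exists
    exact ⟨ε, h4.1, h4.2, h3⟩
  choose ε hε0 hε1 hε2 using hmol
  have htest : ∀ n : ℕ, ∃ Ψ, TestField Ω Ψ ∧ (∀ x, dvg Ψ x = 0) ∧
      eLpNorm (Ψ - Φ) 2 volume ≤ ENNReal.ofReal ((1 / 2) ^ n) := fun n =>
    exists_testField_eLpNorm_sub_le hΩ hb h.memLp h.eq_zero h.integral_eq_zero (by positivity)
  choose Ψ hΨ hΨd hΨ2 using htest
  have hε1' : ∀ n, ε n ≤ 1 := fun n => (hε1 n).le.trans (by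
    rw [div_le_one (by positivity)]; linarith [(Nat.cast_nonneg n : (0 : ℝ) ≤ n)])
  refine ⟨ε, Ψ, hε0, hε1', ?_, hΨ, hΨd, ?_⟩
  · refine tendsto_nhdsWithin_iff.2 ⟨?_, Eventually.of_forall hε0⟩
    exact squeeze_zero (fun n => (hε0 n).le) (fun n => (hε1 n).le)
      tendsto_one_div_add_atTop_nhds_zero_nat
  · obtain ⟨R, hR⟩ := hb.subset_closedBall (0 : Euc 2)
    set B := Metric.closedBall (0 : Euc 2) (R + 1) with hB
    have hsub : Ω ⊆ B := hR.trans (Metric.closedBall_subset_closedBall (by linarith))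
    have hoff : ∀ n, ∀ x ∉ B, Ψ n x - mollify (ε n) Φ x = 0 := by
      intro n x hx
      rw [(hΨ n).eq_zero fun h' => hx (hsub h'), mollify_eq_zero (hε0 n), sub_zero]
      intro y hy
      refine h.eq_zero y fun h' => hx ?_
      have h1 := hR h'
      rw [Metric.mem_closedBall] at h1 ⊢
      linarith [dist_triangle x y 0, hε1' n]
    have hmeas : ∀ n, AEStronglyMeasurable (mollify (ε n) Φ) := fun n =>
      (contDiff_mollify (hε0 n) h.locallyIntegrable).continuous.aestronglyMeasurable
    set C := volume B ^ (1 / (1 : ENNReal).toReal - 1 / (2 : ENNReal).toReal) with hC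
    have hCt : C ≠ ⊤ := by
      refine ENNReal.rpow_ne_top_of_nonneg (by norm_num) ?_
      exact (isCompact_closedBall _ _).measure_lt_top.ne
    have hle : ∀ n, ∫⁻ x, ‖Ψ n x - mollify (ε n) Φ x‖ₑ ≤
        (ENNReal.ofReal ((1 / 2) ^ n) + ENNReal.ofReal ((1 / 2) ^ n)) * C := by
      intro n
      have hm : AEStronglyMeasurable (fun x => Ψ n x - mollify (ε n) Φ x) :=
        (hΨ n).contDiff.continuous.aestronglyMeasurable.sub (hmeas n)
      have h1 := eLpNorm_le_of_eq_zero_off (p := 1) (q := 2) (by norm_num) hm (hoff n)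
      rw [eLpNorm_one_eq_lintegral_enorm] at h1
      refine h1.trans ?_
      gcongr
      have h2 : (fun x => Ψ n x - mollify (ε n) Φ x) =
          (Ψ n - Φ) - (mollify (ε n) Φ - Φ) := by
        ext1 x; simp
      rw [h2]
      refine (eLpNorm_sub_le ((hΨ n).contDiff.continuous.aestronglyMeasurable.sub h.memLp.1)
        ((hmeas n).sub h.memLp.1) (by norm_num)).trans ?_
      exact add_le_add (hΨ2 n) (hε2 n)
    refine ne_top_of_le_ne_top ?_ (ENNReal.tsum_le_tsum hle)
    rw [ENNReal.tsum_mul_right, ENNReal.tsum_add]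
    have hgeo : ∑' n : ℕ, ENNReal.ofReal ((1 / 2 : ℝ) ^ n) ≠ ⊤ := by
      rw [← ENNReal.ofReal_tsum_of_nonneg (fun n => by positivity) summable_geometric_two]
      exact ENNReal.ofReal_ne_top
    exact ENNReal.mul_ne_top (ENNReal.add_ne_top.2 ⟨hgeo, hgeo⟩) hCt

end OrthogonalToGradients

/-! ### Limits of stream functions -/

/-- Below a conjugate exponent of `p < 2` there is a finite conjugate exponent of the same kind. -/
lemma ConjExponents.exists_ne_top {p : ℝ} {q : ENNReal} (hpq : ConjExponents p q) (hp : 1 ≤ p)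
    (hp2 : p < 2) : ∃ p' q', 1 ≤ p' ∧ p' < 2 ∧ ConjExponents p' q' ∧ q' ≠ ⊤ ∧ q' ≤ q := by
  have h1 : 1 < (p + 2) / 2 := by linarith
  have hc := Real.HolderConjugate.conjExponent h1
  refine ⟨(p + 2) / 2, _, h1.le, by linarith, Or.inr ⟨_, hc, rfl⟩, ENNReal.ofReal_ne_top, ?_⟩
  rcases hpq with ⟨_, rfl⟩ | ⟨q', h, rfl⟩
  · exact le_top
  · refine ENNReal.ofReal_le_ofReal ((inv_le_inv₀ h.symm.pos hc.symm.pos).1 ?_)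
    have h2 := hc.inv_add_inv_eq_one
    have h3 := h.inv_add_inv_eq_one
    have h4 : ((p + 2) / 2)⁻¹ ≤ p⁻¹ := by
      rw [inv_le_inv₀ (by linarith) (by linarith)]
      linarith
    linarith

/-- By Morrey's estimate, stream functions of an `L^q` convergent sequence of fields converge
uniformly on bounded sets. -/
lemma exists_tendstoUniformlyOn_stream {F : ℕ → Euc 2 → Euc 2} {Φ : Euc 2 → Euc 2}
    (hF : ∀ n, Continuous (F n)) (hΦ : AEStronglyMeasurable Φ) {ψ' : ℕ → Euc 2 → ℝ}
    (hψ' : ∀ n x, HasFDerivAt (ψ' n) (crossL (F n x)) x) (h0 : ∀ n, ψ' n 0 = 0) {p : ℝ}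
    {q : ENNReal} (hpq : ConjExponents p q) (hp : 1 ≤ p) (hp2 : p < 2)
    (hconv : Tendsto (fun n => eLpNorm (F n - Φ) q volume) atTop (𝓝 0)) :
    ∃ ψ : Euc 2 → ℝ, Continuous ψ ∧
      ∀ R, TendstoUniformlyOn ψ' ψ atTop (Metric.closedBall 0 R) := by
  have hcauchy : ∀ R, UniformCauchySeqOn ψ' atTop (Metric.closedBall 0 R) := by
    intro R
    set S : ℝ := max R 1 with hS
    have hS0 : 0 < S := lt_of_lt_of_le one_pos (le_max_right _ _)
    set C : ENNReal := ENNReal.ofReal (4 / (2 / p - 1)) *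
      ENNReal.ofReal ((3 * S) ^ (2 / p - 1)) with hC
    have hCt : C ≠ ⊤ := ENNReal.mul_ne_top ENNReal.ofReal_ne_top ENNReal.ofReal_ne_top
    have hmem : ∀ x ∈ Metric.closedBall (0 : Euc 2) R, x ∈ square (-S) (-S) (3 * S) := by
      intro x hx
      rw [mem_closedBall_zero_iff] at hx
      have hxS : ∀ i, |x i| ≤ S := fun i =>
        (PiLp.norm_apply_le x i).trans (hx.trans (le_max_left _ _))
      have h0 := abs_le.1 (hxS 0)
      have h1 := abs_le.1 (hxS 1)
      exact ⟨⟨h0.1, by linarith⟩, h1.1, by linarith⟩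
    have hzero : (0 : Euc 2) ∈ square (-S) (-S) (3 * S) := by
      simp only [square, Set.mem_ofPred_eq, PiLp.zero_apply, Set.mem_Ico]
      exact ⟨⟨by linarith, by linarith⟩, by linarith, by linarith⟩
    have hbound : ∀ m n, ∀ x ∈ Metric.closedBall (0 : Euc 2) R, ‖ψ' m x - ψ' n x‖ₑ ≤
        C * eLpNorm (F m - Φ) q volume + C * eLpNorm (F n - Φ) q volume := by
      intro m n x hx
      have h := enorm_sub_le_of_mem_square (F := fun x => F m x - F n x) ((hF m).sub (hF n))
        (ψ := fun x => ψ' m x - ψ' n x)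
        (fun x => by
          rw [map_sub]
          exact (hψ' m x).sub (hψ' n x))
        hpq.one_le hpq.one_sub_one_div hp hp2 (by positivity) (hmem x hx) hzero
      simp only [h0, sub_zero] at h
      refine h.trans ?_
      rw [← mul_add, hC, mul_assoc]
      gcongr
      refine (eLpNorm_mono_measure _ Measure.restrict_le_self).trans ?_
      have h2 : (fun x => F m x - F n x) = (F m - Φ) - (F n - Φ) := by ext1 x; simp
      rw [h2]
      exact eLpNorm_sub_le ((hF m).aestronglyMeasurable.sub hΦ)
        ((hF n).aestronglyMeasurable.sub hΦ) hpq.one_le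
    have hCconv : Tendsto (fun n => C * eLpNorm (F n - Φ) q volume) atTop (𝓝 0) := by
      have := ENNReal.Tendsto.const_mul (a := C) hconv (Or.inr hCt)
      rwa [mul_zero] at this
    rw [Metric.uniformCauchySeqOn_iff]
    intro ε hε
    obtain ⟨N, hN⟩ := eventually_atTop.1 (ENNReal.tendsto_nhds_zero.1 hCconv
      (ENNReal.ofReal (ε / 3)) (by simp [hε]))
    refine ⟨N, fun m hm n hn x hx => ?_⟩
    have h := (hbound m n x hx).trans (add_le_add (hN m hm) (hN n hn))
    rw [← ENNReal.ofReal_add (by positivity) (by positivity), ← ofReal_norm,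
      ENNReal.ofReal_le_ofReal_iff (by positivity), ← dist_eq_norm] at h
    linarith
  have hpt : ∀ x, ∃ l, Tendsto (fun n => ψ' n x) atTop (𝓝 l) := fun x =>
    cauchySeq_tendsto_of_complete ((hcauchy ‖x‖).cauchySeq (by simp))
  choose ψ hψ using hpt
  have hunif : ∀ R, TendstoUniformlyOn ψ' ψ atTop (Metric.closedBall 0 R) := fun R =>
    (hcauchy R).tendstoUniformlyOn_of_tendsto fun x _ => hψ x
  refine ⟨ψ, ?_, hunif⟩
  have hloc : TendstoLocallyUniformly ψ' ψ atTop := by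
    rw [tendstoLocallyUniformly_iff_forall_tendsto]
    intro x
    have hmem : Metric.closedBall (0 : Euc 2) (‖x‖ + 1) ∈ 𝓝 x :=
      Filter.mem_of_superset (Metric.ball_mem_nhds x one_pos) fun y hy => by
        rw [mem_closedBall_zero_iff]
        rw [Metric.mem_ball, dist_eq_norm] at hy
        linarith [norm_le_norm_add_norm_sub' y x]
    exact (tendstoUniformlyOn_iff_tendsto.1 (hunif (‖x‖ + 1))).mono_left
      (Filter.prod_mono le_rfl (le_principal_iff.2 hmem))
  exact hloc.continuous (Frequently.of_forall fun n =>
    continuous_iff_continuousAt.2 fun x => (hψ' n x).continuousAt)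

/-- The limit of stream functions of fields bounded in `L^q` maps sets of vanishing
`(2 - p)`-dimensional Hausdorff measure to Lebesgue null sets. -/
lemma volume_image_eq_zero_of_tendsto {F : ℕ → Euc 2 → Euc 2} (hF : ∀ n, Continuous (F n))
    {ψ' : ℕ → Euc 2 → ℝ} (hψ' : ∀ n x, HasFDerivAt (ψ' n) (crossL (F n x)) x) {p : ℝ}
    {q : ENNReal} (hpq : ConjExponents p q) (hp : 1 ≤ p) (hp2 : p < 2) {M : ENNReal}
    (hM : M ≠ ⊤) (hFM : ∀ n, eLpNorm (F n) q volume ≤ M) {ψ : Euc 2 → ℝ}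
    (hlim : ∀ x, Tendsto (fun n => ψ' n x) atTop (𝓝 (ψ x))) {S : Set (Euc 2)}
    (hS : μH[2 - p] S = 0) : volume (ψ '' S) = 0 := by
  refine volume_image_eq_zero hp hp2 (M := ENNReal.ofReal (4 / (2 / p - 1)) * M)
    (ENNReal.mul_ne_top ENNReal.ofReal_ne_top hM) (fun s hs x y hx hy => ?_) hS
  refine le_of_tendsto (tendsto_finsetSum s fun i _ => ((hlim (x i)).sub (hlim (y i))).enorm)
    (Eventually.of_forall fun n => ?_)
  refine (sum_enorm_sub_le (hF n) (hψ' n) hpq hp hp2 s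
    (r := fun i : ℕ × ℤ × ℤ => ((2 : ℝ) ^ i.1)⁻¹) (fun i _ => by positivity) hs hx hy).trans ?_
  rw [mul_assoc, mul_comm M]
  gcongr
  exact hFM n

/-- A function which is constant on the connected subsets of the complement of an admissible domain
and maps `(2 - p)`-dimensional null sets to Lebesgue null sets maps the whole complement to a null
set, as all its values are attained at the selected points. -/
lemma AdmissibleDomain.volume_image_compl_eq_zero {p : ℝ} {Ω : Set (Euc 2)}
    (hΩ : AdmissibleDomain p Ω) {ψ : Euc 2 → ℝ}
    (hconst : ∀ K : Set (Euc 2), IsPreconnected K → K ⊆ Ωᶜ → ∀ x ∈ K, ∀ y ∈ K, ψ x = ψ y)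
    (hnull : ∀ S : Set (Euc 2), μH[2 - p] S = 0 → volume (ψ '' S) = 0) :
    volume (ψ '' Ωᶜ) = 0 := by
  obtain ⟨s, hs, hs0⟩ := hΩ.exists_selection
  refine measure_mono_null ?_ (hnull _ hs0)
  rintro _ ⟨x, hx, rfl⟩
  let x' : (Ωᶜ : Set (Euc 2)) := ⟨x, hx⟩
  refine ⟨_, ⟨ConnectedComponents.mk x', rfl⟩, ?_⟩
  refine hconst (Subtype.val '' connectedComponent x')
    (isPreconnected_connectedComponent.image _ continuous_subtype_val.continuousOn) ?_ _
    ⟨_, ConnectedComponents.coe_eq_coe'.1 (hs _), rfl⟩ _ ⟨x', mem_connectedComponent, rfl⟩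
  rintro _ ⟨y, _, rfl⟩
  exact y.2

/-! ### Passage to the limit in products -/

section Holder

variable {α E E' : Type*} [MeasurableSpace α] {μ : Measure α} [NormedAddCommGroup E]
  [NormedAddCommGroup E'] {P Q : ENNReal}

lemma lintegral_enorm_mul_le [P.HolderConjugate Q] {g : α → E} {h : α → E'}
    (hg : AEStronglyMeasurable g μ) (hh : AEStronglyMeasurable h μ) :
    ∫⁻ x, ‖g x‖ₑ * ‖h x‖ₑ ∂μ ≤ eLpNorm g P μ * eLpNorm h Q μ := by
  have := eLpNorm_le_eLpNorm_mul_eLpNorm_of_nnnorm (p := P) (q := Q) (r := 1) hg hh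
    (fun u v => ‖u‖ * ‖v‖) 1 (Eventually.of_forall fun x => by
      rw [one_mul, nnnorm_mul, nnnorm_norm, nnnorm_norm])
  simpa only [eLpNorm_one_eq_lintegral_enorm, enorm_mul, enorm_norm, ENNReal.coe_one,
    one_mul] using this

/-- The product of a fixed function of `L^P` with a sequence bounded in `L^Q` and converging to
zero in `L¹` converges to zero in `L¹`. -/
lemma tendsto_lintegral_enorm_mul [P.HolderConjugate Q] (hP : P ≠ ⊤) {g : α → E}
    (hg : MemLp g P μ) {H : ℕ → α → E'} (hHm : ∀ n, AEStronglyMeasurable (H n) μ) {M : ENNReal}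
    (hM : M ≠ ⊤) (hHM : ∀ n, eLpNorm (H n) Q μ ≤ M)
    (hH : Tendsto (fun n => ∫⁻ x, ‖H n x‖ₑ ∂μ) atTop (𝓝 0)) :
    Tendsto (fun n => ∫⁻ x, ‖g x‖ₑ * ‖H n x‖ₑ ∂μ) atTop (𝓝 0) := by
  rw [ENNReal.tendsto_nhds_zero]
  intro δ hδ
  have hM1 : M + 1 ≠ ⊤ := ENNReal.add_ne_top.2 ⟨hM, ENNReal.one_ne_top⟩
  have hη : δ / 2 / (M + 1) ≠ 0 :=
    (ENNReal.div_pos (ENNReal.div_pos hδ.ne' (by simp)).ne' hM1).ne'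
  obtain ⟨γ, hγ, hγP⟩ := hg.exists_simpleFunc_eLpNorm_sub_lt hP hη
  obtain ⟨C, hC⟩ := γ.exists_forall_norm_le
  have h1 : Tendsto (fun n => ENNReal.ofReal C * ∫⁻ x, ‖H n x‖ₑ ∂μ) atTop (𝓝 0) := by
    have := ENNReal.Tendsto.const_mul (a := ENNReal.ofReal C) hH (Or.inr ENNReal.ofReal_ne_top)
    rwa [mul_zero] at this
  filter_upwards [ENNReal.tendsto_nhds_zero.1 h1 (δ / 2)
    (ENNReal.div_pos hδ.ne' (by simp))] with n hn
  have h2 : ∫⁻ x, ‖g x‖ₑ * ‖H n x‖ₑ ∂μ ≤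
      ∫⁻ x, (ENNReal.ofReal C * ‖H n x‖ₑ + ‖(g - ⇑γ) x‖ₑ * ‖H n x‖ₑ) ∂μ := by
    refine lintegral_mono fun x => ?_
    rw [← add_mul]
    gcongr
    calc ‖g x‖ₑ = ‖γ x + (g - ⇑γ) x‖ₑ := by simp
      _ ≤ ‖γ x‖ₑ + ‖(g - ⇑γ) x‖ₑ := enorm_add_le _ _
      _ ≤ _ := by
        gcongr
        rw [← ofReal_norm]
        exact ENNReal.ofReal_le_ofReal (hC x)
  refine h2.trans ?_
  rw [lintegral_add_left' ((hHm n).enorm.const_mul _), lintegral_const_mul'' _ (hHm n).enorm,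
    ← ENNReal.add_halves δ]
  refine add_le_add hn ?_
  refine (lintegral_enorm_mul_le (P := P) (Q := Q) (hg.1.sub hγP.1) (hHm n)).trans ?_
  calc eLpNorm (g - ⇑γ) P μ * eLpNorm (H n) Q μ ≤ (δ / 2 / (M + 1)) * (M + 1) := by
        gcongr
        exact (hHM n).trans le_self_add
    _ = δ / 2 := ENNReal.div_mul_cancel (by simp) hM1

variable [InnerProductSpace ℝ E]

lemma integrable_mul_inner [P.HolderConjugate Q] {g h : α → E} (hg : MemLp g P μ)
    (hh : MemLp h Q μ) {a : α → ℝ} (ha : AEStronglyMeasurable a μ) (ha1 : ∀ x, |a x| ≤ 1) :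
    Integrable (fun x => a x * inner ℝ (g x) (h x)) μ := by
  refine ⟨ha.mul (hg.1.inner hh.1), ?_⟩
  refine lt_of_le_of_lt (lintegral_mono fun x => ?_)
    ((lintegral_enorm_mul_le (P := P) (Q := Q) hg.1 hh.1).trans_lt
      (ENNReal.mul_lt_top hg.2 hh.2))
  rw [← ofReal_norm, ← ofReal_norm, ← ofReal_norm, ← ENNReal.ofReal_mul (norm_nonneg _)]
  refine ENNReal.ofReal_le_ofReal ?_
  rw [norm_mul]
  exact (mul_le_of_le_one_left (norm_nonneg _) (ha1 x)).trans (norm_inner_le_norm _ _)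

/-- Convergence of `∫ aₙ ⟨g, Fₙ⟩` when `g` is in `L^P`, `Fₙ` is bounded in `L^Q` and converges in
`L¹`, and the bounded coefficients `aₙ` converge pointwise. -/
lemma tendsto_integral_mul_inner [P.HolderConjugate Q] (hP : P ≠ ⊤) {g : α → E}
    (hg : MemLp g P μ) {F : ℕ → α → E} {Φ : α → E} (hF : ∀ n, AEStronglyMeasurable (F n) μ)
    (hΦ : MemLp Φ Q μ) {M : ENNReal} (hM : M ≠ ⊤) (hFM : ∀ n, eLpNorm (F n) Q μ ≤ M)
    (hconv : Tendsto (fun n => ∫⁻ x, ‖F n x - Φ x‖ₑ ∂μ) atTop (𝓝 0)) {a : ℕ → α → ℝ}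
    {a' : α → ℝ} (ha : ∀ n, AEStronglyMeasurable (a n) μ) (ha1 : ∀ n x, |a n x| ≤ 1)
    (hlim : ∀ x, Tendsto (fun n => a n x) atTop (𝓝 (a' x))) :
    Tendsto (fun n => ∫ x, a n x * inner ℝ (g x) (F n x) ∂μ) atTop
      (𝓝 (∫ x, a' x * inner ℝ (g x) (Φ x) ∂μ)) := by
  have hQ1 : 1 ≤ Q := ENNReal.HolderConjugate.one_le Q P
  have hFL : ∀ n, MemLp (F n) Q μ := fun n => ⟨hF n, (hFM n).trans_lt hM.lt_top⟩
  have h1 : Tendsto (fun n => ∫ x, a n x * inner ℝ (g x) (Φ x) ∂μ) atTop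
      (𝓝 (∫ x, a' x * inner ℝ (g x) (Φ x) ∂μ)) := by
    refine tendsto_integral_of_dominated_convergence (fun x => ‖(1 : ℝ) * inner ℝ (g x) (Φ x)‖)
      (fun n => (ha n).mul (hg.1.inner hΦ.1))
      (integrable_mul_inner hg hΦ aestronglyMeasurable_const (by simp)).norm
      (fun n => Eventually.of_forall fun x => ?_)
      (Eventually.of_forall fun x => (hlim x).mul_const _)
    rw [norm_mul, norm_mul, norm_one]
    exact mul_le_mul_of_nonneg_right (ha1 n x) (norm_nonneg _)
  have h2 : Tendsto (fun n => ∫ x, a n x * inner ℝ (g x) ((F n - Φ) x) ∂μ) atTop (𝓝 0) := by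
    refine tendsto_zero_iff_enorm_tendsto_zero.2 ?_
    refine tendsto_of_tendsto_of_tendsto_of_le_of_le tendsto_const_nhds
      (tendsto_lintegral_enorm_mul hP hg (H := fun n => F n - Φ) (fun n => (hF n).sub hΦ.1)
        (M := M + eLpNorm Φ Q μ) (ENNReal.add_ne_top.2 ⟨hM, hΦ.2.ne⟩)
        (fun n => (eLpNorm_sub_le (hF n) hΦ.1 hQ1).trans (add_le_add_left (hFM n) _)) hconv)
      (fun _ => zero_le) (fun n => ?_)
    refine (enorm_integral_le_lintegral_enorm _).trans (lintegral_mono fun x => ?_)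
    simp only
    rw [← ofReal_norm, ← ofReal_norm, ← ofReal_norm, ← ENNReal.ofReal_mul (norm_nonneg _)]
    refine ENNReal.ofReal_le_ofReal ?_
    rw [norm_mul]
    exact (mul_le_of_le_one_left (norm_nonneg _) (ha1 n x)).trans (norm_inner_le_norm _ _)
  have h3 := h2.add h1
  rw [zero_add] at h3
  refine h3.congr fun n => ?_
  rw [← integral_add (integrable_mul_inner hg ((hFL n).sub hΦ) (ha n) (ha1 n))
    (integrable_mul_inner hg hΦ (ha n) (ha1 n))]
  refine integral_congr_ae (Eventually.of_forall fun x => ?_)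
  simp only [Pi.sub_apply, inner_sub_right]
  ring

end Holder

/-! ### Cutoff functions near a closed null set -/

lemma exists_cutoff_seq {L : Set ℝ} (hL : IsClosed L) : ∃ χ : ℕ → ℝ → ℝ,
    (∀ k, ContDiff ℝ ∞ (χ k)) ∧ (∀ k s, |χ k s| ≤ 1) ∧
    (∀ k, ∃ δ > 0, ∀ s ∈ Metric.thickening δ L, χ k s = 0) ∧
    ∀ s, Tendsto (fun k => χ k s) atTop (𝓝 (Lᶜ.indicator 1 s)) := by
  have hex : ∀ k : ℕ, ∃ χ : ℝ → ℝ, ContDiff ℝ ∞ χ ∧ (∀ s, |χ s| ≤ 1) ∧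
      (∀ s ∈ Metric.thickening (1 / ((k : ℝ) + 1)) L, χ s = 0) ∧
      ∀ s ∉ Metric.thickening (2 / ((k : ℝ) + 1)) L, χ s = 1 := by
    intro k
    have hk : (0 : ℝ) < 1 / ((k : ℝ) + 1) := by positivity
    have hk2 : 1 / ((k : ℝ) + 1) < 2 / ((k : ℝ) + 1) := by
      rw [div_lt_div_iff_of_pos_right (by positivity)]; norm_num
    have hdis : Disjoint (Metric.cthickening (1 / ((k : ℝ) + 1)) L)
        (Metric.thickening (2 / ((k : ℝ) + 1)) L)ᶜ :=
      Set.disjoint_compl_right_iff_subset.2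
        (Metric.cthickening_subset_thickening' (hk.trans hk2) hk2 L)
    obtain ⟨χ, h1, h2, h3, h4⟩ := exists_contMDiff_zero_iff_one_iff_of_isClosed
      (modelWithCornersSelf ℝ ℝ) (n := ⊤) Metric.isClosed_cthickening
      Metric.isOpen_thickening.isClosed_compl hdis
    refine ⟨χ, h1.contDiff, fun s => ?_, fun s hs => ?_, fun s hs => (h4 s).1 hs⟩
    · have := h2 ⟨s, rfl⟩
      rw [abs_of_nonneg this.1]
      exact this.2
    · exact (h3 s).1 (Metric.thickening_subset_cthickening _ _ hs)
  choose χ hχ hχ1 hχ0 hχt using hex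
  refine ⟨χ, hχ, hχ1, fun k => ⟨_, by positivity, hχ0 k⟩, fun s => ?_⟩
  by_cases hs : s ∈ L
  · rw [Set.indicator_of_notMem (by simpa using hs)]
    refine tendsto_const_nhds.congr fun k => (hχ0 k s ?_).symm
    exact Metric.self_subset_thickening (by positivity) _ hs
  · rw [Set.indicator_of_mem (by simpa using hs)]
    obtain ⟨r, hr, hrL⟩ := Metric.isOpen_iff.1 hL.isOpen_compl s hs
    have h2 : Tendsto (fun k : ℕ => 2 * (1 / ((k : ℝ) + 1))) atTop (𝓝 (2 * 0)) :=
      tendsto_one_div_add_atTop_nhds_zero_nat.const_mul 2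
    rw [mul_zero] at h2
    refine tendsto_const_nhds.congr' ?_
    filter_upwards [h2.eventually (gt_mem_nhds hr)] with k hk
    refine (hχt k s fun hmem => ?_).symm
    obtain ⟨z, hz, hsz⟩ := Metric.mem_thickening_iff.1 hmem
    refine hrL (Metric.mem_ball.2 ?_) hz
    rw [dist_comm]
    refine hsz.trans (lt_of_le_of_lt (le_of_eq ?_) hk)
    ring

/-! ### Localization by functions of the stream function -/

/-- Smooth divergence-free fields `F n` supported in a ball of radius `R`, bounded in `L^Q` and
converging in `L¹` to `Φ`, whose stream functions `ψ' n` converge uniformly on bounded sets to the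
continuous function `ψ`. -/
structure StreamApprox (R : ℝ) (Q : ENNReal) (Φ : Euc 2 → Euc 2) (ψ : Euc 2 → ℝ)
    (F : ℕ → Euc 2 → Euc 2) (ψ' : ℕ → Euc 2 → ℝ) : Prop where
  contDiff : ∀ n, ContDiff ℝ ∞ (F n)
  dvg_eq_zero : ∀ n x, dvg (F n) x = 0
  eq_zero : ∀ n, ∀ x ∉ Metric.closedBall (0 : Euc 2) R, F n x = 0
  contDiff_stream : ∀ n, ContDiff ℝ ∞ (ψ' n)
  hasFDerivAt_stream : ∀ n x, HasFDerivAt (ψ' n) (crossL (F n x)) x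
  memLp : MemLp Φ Q
  eLpNorm_le : ∀ n, eLpNorm (F n) Q volume ≤ eLpNorm Φ Q volume
  tendsto_lintegral : Tendsto (fun n => ∫⁻ x, ‖F n x - Φ x‖ₑ) atTop (𝓝 0)
  continuous : Continuous ψ
  tendstoUniformlyOn : ∀ r, TendstoUniformlyOn ψ' ψ atTop (Metric.closedBall 0 r)

namespace StreamApprox

variable {R : ℝ} {P Q : ENNReal} {Φ : Euc 2 → Euc 2} {ψ : Euc 2 → ℝ} {F : ℕ → Euc 2 → Euc 2}
  {ψ' : ℕ → Euc 2 → ℝ}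

lemma tendsto (h : StreamApprox R Q Φ ψ F ψ') (x : Euc 2) :
    Tendsto (fun n => ψ' n x) atTop (𝓝 (ψ x)) :=
  (h.tendstoUniformlyOn ‖x‖).tendsto_at (by simp)

lemma tendsto_integral (h : StreamApprox R Q Φ ψ F ψ') [P.HolderConjugate Q] (hP : P ≠ ⊤)
    {Ω : Set (Euc 2)} {g : Euc 2 → Euc 2} (hg : MemLp g P (volume.restrict Ω)) {χ : ℝ → ℝ}
    (hχ : Continuous χ) (hχ1 : ∀ s, |χ s| ≤ 1) :
    Tendsto (fun n => ∫ x in Ω, χ (ψ' n x) * inner ℝ (g x) (F n x)) atTop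
      (𝓝 (∫ x in Ω, χ (ψ x) * inner ℝ (g x) (Φ x))) := by
  refine tendsto_integral_mul_inner (Q := Q) hP hg
    (fun n => (h.contDiff n).continuous.aestronglyMeasurable) (h.memLp.restrict Ω) h.memLp.2.ne
    (fun n => (eLpNorm_mono_measure _ Measure.restrict_le_self).trans (h.eLpNorm_le n)) ?_
    (a := fun n x => χ (ψ' n x))
    (fun n => (hχ.comp (h.contDiff_stream n).continuous).aestronglyMeasurable)
    (fun n x => hχ1 _) (fun x => (hχ.tendsto _).comp (h.tendsto x))
  exact tendsto_of_tendsto_of_tendsto_of_le_of_le tendsto_const_nhds h.tendsto_lintegral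
    (fun _ => zero_le) (fun n => setLIntegral_le_lintegral _ _)

/-- Multiplying a divergence-free field by a function of its stream function preserves the
divergence. If the function vanishes near the values of `ψ` off `Ω`, this produces test
fields on `Ω`. -/
lemma eventually_testField (h : StreamApprox R Q Φ ψ F ψ') {Ω : Set (Euc 2)}
    {L : Set ℝ} (hL : ψ '' (Ωᶜ ∩ Metric.closedBall 0 R) ⊆ L) {χ : ℝ → ℝ} (hχ : ContDiff ℝ ∞ χ)
    {δ : ℝ} (hδ : 0 < δ) (hχ0 : ∀ s ∈ Metric.thickening δ L, χ s = 0) :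
    ∀ᶠ n in atTop, TestField Ω (fun x => χ (ψ' n x) • F n x) ∧
      ∀ x, dvg (fun x => χ (ψ' n x) • F n x) x = 0 := by
  filter_upwards [Metric.tendstoUniformlyOn_iff.1 (h.tendstoUniformlyOn R) δ hδ] with n hn
  have hc : ContDiff ℝ ∞ fun x => χ (ψ' n x) := hχ.comp (h.contDiff_stream n)
  refine ⟨⟨hc.smul (h.contDiff n), ?_, ?_⟩, fun x => ?_⟩
  · refine HasCompactSupport.intro (isCompact_closedBall (0 : Euc 2) R) fun x hx => ?_
    rw [h.eq_zero n x hx, smul_zero]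
  · have hU : IsOpen {x | ψ' n x ∈ Metric.thickening δ L} :=
      Metric.isOpen_thickening.preimage (h.contDiff_stream n).continuous
    have hsub : tsupport (fun x => χ (ψ' n x) • F n x) ⊆
        Metric.closedBall 0 R ∩ {x | ψ' n x ∈ Metric.thickening δ L}ᶜ := by
      refine closure_minimal (fun x hx => ?_) (Metric.isClosed_closedBall.inter hU.isClosed_compl)
      refine ⟨?_, fun hxU => hx ?_⟩
      · by_contra hxB
        exact hx (by simp only [h.eq_zero n x hxB, smul_zero])
      · simp only [hχ0 _ hxU, zero_smul]
    intro x hx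
    obtain ⟨hxB, hxU⟩ := hsub hx
    by_contra hxΩ
    refine hxU (Metric.mem_thickening_iff.2 ⟨ψ x, hL ⟨x, ⟨hxΩ, hxB⟩, rfl⟩, ?_⟩)
    rw [dist_comm]
    exact hn x hxB
  · have hd : HasFDerivAt (fun x => χ (ψ' n x)) (deriv χ (ψ' n x) • crossL (F n x)) x :=
      ((hχ.differentiable (by simp)) (ψ' n x)).hasDerivAt.comp_hasFDerivAt x
        (h.hasFDerivAt_stream n x)
    rw [dvg_smul hd.differentiableAt ((h.contDiff n).differentiable (by simp) x),
      h.dvg_eq_zero, hd.fderiv, smul_apply, crossL_self]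
    simp

/-- A weak gradient is orthogonal to the part of `Φ` where `ψ` avoids a closed set containing the
values of `ψ` off `Ω`. -/
lemma integral_indicator_eq_zero (h : StreamApprox R Q Φ ψ F ψ') [P.HolderConjugate Q]
    (hP : P ≠ ⊤) {Ω : Set (Euc 2)} {L : Set ℝ} (hLc : IsClosed L)
    (hL : ψ '' (Ωᶜ ∩ Metric.closedBall 0 R) ⊆ L) {u : Euc 2 → ℝ} {g : Euc 2 → Euc 2}
    (hu : HasWeakGradient Ω u g) (hg : MemLp g P (volume.restrict Ω)) :
    ∫ x in Ω, Lᶜ.indicator 1 (ψ x) * inner ℝ (g x) (Φ x) = 0 := by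
  obtain ⟨χ, hχ, hχ1, hχ0, hχt⟩ := exists_cutoff_seq hLc
  have hk : ∀ k, ∫ x in Ω, χ k (ψ x) * inner ℝ (g x) (Φ x) = 0 := by
    intro k
    obtain ⟨δ, hδ, hδ0⟩ := hχ0 k
    refine tendsto_nhds_unique (h.tendsto_integral hP hg (hχ k).continuous (hχ1 k))
      (tendsto_const_nhds.congr' ?_)
    filter_upwards [h.eventually_testField hL (hχ k) hδ hδ0] with n hn
    rw [← hn.1.integral_inner_weakGradient hn.2 hu]
    simp only [inner_smul_right]
  have hint := integrable_mul_inner hg (h.memLp.restrict Ω)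
    (aestronglyMeasurable_const (b := (1 : ℝ))) (by simp)
  have hlim : Tendsto (fun k => ∫ x in Ω, χ k (ψ x) * inner ℝ (g x) (Φ x)) atTop
      (𝓝 (∫ x in Ω, Lᶜ.indicator 1 (ψ x) * inner ℝ (g x) (Φ x))) := by
    refine tendsto_integral_of_dominated_convergence _
      (fun k => ((hχ k).continuous.comp h.continuous).aestronglyMeasurable.mul
        (hg.1.inner (h.memLp.restrict Ω).1)) hint.norm
      (fun k => Eventually.of_forall fun x => ?_)
      (Eventually.of_forall fun x => (hχt (ψ x)).mul_const _)
    rw [norm_mul, one_mul]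
    exact mul_le_of_le_one_left (norm_nonneg _) (hχ1 k _)
  simp only [hk] at hlim
  exact tendsto_nhds_unique hlim tendsto_const_nhds

/-- The derivative of a stream function along `v` is the component of the field along a vector
orthogonal to `v`. -/
lemma inner_perp (F v : Euc 2) : inner ℝ (!₂[v 1, -v 0] : Euc 2) F = crossL F v := by
  rw [crossL_apply, PiLp.inner_apply, Fin.sum_univ_two]
  simp
  ring

/-- The chain rule for the limit stream function `ψ` and a primitive of `χ`, in the sense of
distributions. -/
lemma integral_comp_mul_crossL (h : StreamApprox R Q Φ ψ F ψ') [P.HolderConjugate Q]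
    (hP : P ≠ ⊤) {χ : ℝ → ℝ} (hχ : Continuous χ) (hχ1 : ∀ s, |χ s| ≤ 1) {η : Euc 2 → ℝ}
    (hη : ContDiff ℝ ∞ η) (hηc : HasCompactSupport η) (v : Euc 2) :
    ∫ x, χ (ψ x) * (η x * crossL (Φ x) v) =
      - ∫ x, (∫ s in (0 : ℝ)..ψ x, χ s) * fderiv ℝ η x v := by
  set T : ℝ → ℝ := fun t => ∫ s in (0 : ℝ)..t, χ s with hT
  have hTd : ∀ t, HasDerivAt T (χ t) t := fun t =>
    intervalIntegral.integral_hasDerivAt_right (hχ.intervalIntegrable _ _)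
      (hχ.stronglyMeasurableAtFilter _ _) hχ.continuousAt
  have hTc : Continuous T := continuous_iff_continuousAt.2 fun t => (hTd t).continuousAt
  have hTle : ∀ t, |T t| ≤ |t| := fun t => by
    have := intervalIntegral.norm_integral_le_of_norm_le_const (a := 0) (b := t) (f := χ)
      (C := 1) fun s _ => hχ1 s
    simpa using this
  have hηv : Continuous fun x => fderiv ℝ η x v := (hη.continuous_fderiv (by simp)).clm_apply
    continuous_const
  have hηvc : HasCompactSupport fun x => fderiv ℝ η x v := hηc.fderiv_apply ℝ v
  have hparts : ∀ n, ∫ x, χ (ψ' n x) * (η x * crossL (F n x) v) =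
      - ∫ x, T (ψ' n x) * fderiv ℝ η x v := by
    intro n
    have hψc := (h.contDiff_stream n).continuous
    have hFc := (h.contDiff n).continuous
    have hd : ∀ x, HasFDerivAt (fun x => T (ψ' n x)) (χ (ψ' n x) • crossL (F n x)) x := fun x =>
      (hTd (ψ' n x)).comp_hasFDerivAt x (h.hasFDerivAt_stream n x)
    have hfd : ∀ x, fderiv ℝ (fun x => T (ψ' n x)) x v = χ (ψ' n x) * crossL (F n x) v :=
      fun x => by rw [(hd x).fderiv]; rfl
    have hparts := integral_mul_fderiv_eq_neg_fderiv_mul_of_integrable (𝕜 := ℝ) (μ := volume)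
      (f := fun x => T (ψ' n x)) (g := η) (v := v) ?_ ?_ ?_
      (fun x _ => (hd x).differentiableAt) (fun x _ => hη.differentiable (by simp) x)
    · rw [hparts, neg_neg]
      refine integral_congr_ae (Eventually.of_forall fun x => ?_)
      simp only [hfd]
      ring
    · simp only [hfd]
      exact Continuous.integrable_of_hasCompactSupport (by fun_prop) hηc.mul_left
    · exact Continuous.integrable_of_hasCompactSupport (by fun_prop) hηvc.mul_left
    · exact Continuous.integrable_of_hasCompactSupport
        ((hTc.comp hψc).mul hη.continuous) hηc.mul_left
  have hg : MemLp (fun x => η x • (!₂[v 1, -v 0] : Euc 2)) P (volume.restrict Set.univ) := by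
    rw [Measure.restrict_univ]
    exact (hη.continuous.smul continuous_const).memLp_of_hasCompactSupport hηc.smul_right
  have hlim1 := h.tendsto_integral hP hg hχ hχ1
  simp only [Measure.restrict_univ, inner_smul_left, inner_perp, RCLike.conj_to_real,
    hparts] at hlim1
  refine tendsto_nhds_unique hlim1 (Tendsto.neg ?_)
  obtain ⟨r, hr⟩ := hηvc.isCompact.isBounded.subset_closedBall (0 : Euc 2)
  refine tendsto_integral_filter_of_dominated_convergence
    (fun x => (|ψ x| + 1) * |fderiv ℝ η x v|)
    (Eventually.of_forall fun n =>
      ((hTc.comp (h.contDiff_stream n).continuous).mul hηv).aestronglyMeasurable) ?_ ?_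
    (Eventually.of_forall fun x => ((hTc.tendsto _).comp (h.tendsto x)).mul_const _)
  · filter_upwards [Metric.tendstoUniformlyOn_iff.1 (h.tendstoUniformlyOn r) 1 one_pos] with n hn
    refine Eventually.of_forall fun x => ?_
    by_cases hx : x ∈ tsupport fun x => fderiv ℝ η x v
    · rw [norm_mul]
      refine mul_le_mul_of_nonneg_right ((hTle _).trans ?_) (norm_nonneg _)
      have h1 := hn x (hr hx)
      rw [Real.dist_eq, abs_sub_comm] at h1
      linarith [abs_sub_abs_le_abs_sub (ψ' n x) (ψ x)]
    · have h0 : fderiv ℝ η x v = 0 :=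
        image_eq_zero_of_notMem_tsupport (f := fun x => fderiv ℝ η x v) hx
      rw [h0]
      simp
  · exact Continuous.integrable_of_hasCompactSupport
      ((h.continuous.abs.add continuous_const).mul hηv.abs)
      ((hηvc.comp_left (g := fun t => |t|) abs_zero).mul_left)

/-- The limit field vanishes almost everywhere on the inverse image of a closed null set `L` under
its stream function: the primitives of cutoff functions vanishing near `L` converge to the identity,
so in the chain rule the part of the gradient of `ψ` on `ψ ⁻¹' L` does not contribute. -/
lemma ae_eq_zero_of_mem (h : StreamApprox R Q Φ ψ F ψ') [P.HolderConjugate Q]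
    (hP : P ≠ ⊤) {L : Set ℝ} (hLc : IsClosed L) (hL0 : volume L = 0) :
    ∀ᵐ x, ψ x ∈ L → Φ x = 0 := by
  obtain ⟨χ, hχ, hχ1, -, hχt⟩ := exists_cutoff_seq hLc
  have hQ1 : 1 ≤ Q := ENNReal.HolderConjugate.one_le Q P
  have hloc : LocallyIntegrable Φ := h.memLp.locallyIntegrable hQ1
  have hindm : Measurable fun x => Lᶜ.indicator (1 : ℝ → ℝ) (ψ x) :=
    (measurable_one.indicator hLc.measurableSet.compl).comp h.continuous.measurable
  have hcross : ∀ v : Euc 2, LocallyIntegrable fun x => crossL (Φ x) v := by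
    intro v
    have h2 : LocallyIntegrable fun x => crossL.flip v (Φ x) := fun x =>
      let ⟨s, hs, hsi⟩ := hloc x
      ⟨s, hs, (crossL.flip v).integrable_comp hsi⟩
    exact h2
  have key : ∀ v : Euc 2, ∀ᵐ x, crossL (Φ x) v - Lᶜ.indicator 1 (ψ x) * crossL (Φ x) v = 0 := by
    intro v
    have hloc2 : LocallyIntegrable fun x => Lᶜ.indicator 1 (ψ x) * crossL (Φ x) v := fun x =>
      let ⟨s, hs, hsi⟩ := hcross v x
      ⟨s, hs, hsi.bdd_mul (c := 1) hindm.aestronglyMeasurable (Eventually.of_forall fun x => by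
        by_cases hx : ψ x ∈ L <;> simp [hx])⟩
    refine ae_eq_zero_of_integral_contDiff_smul_eq_zero ((hcross v).sub hloc2)
      fun η hη hηc => ?_
    have hint : Integrable fun x => η x * crossL (Φ x) v :=
      (hcross v).integrable_smul_left_of_hasCompactSupport hη.continuous hηc
    have hint2 : Integrable fun x => η x * (Lᶜ.indicator 1 (ψ x) * crossL (Φ x) v) :=
      hloc2.integrable_smul_left_of_hasCompactSupport hη.continuous hηc
    have hηv : Continuous fun x => fderiv ℝ η x v :=
      (hη.continuous_fderiv (by simp)).clm_apply continuous_const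
    have hηvc : HasCompactSupport fun x => fderiv ℝ η x v := hηc.fderiv_apply ℝ v
    -- the chain rule for `χ = 1`, to be compared with the limit of the chain rules for `χ k`
    have hid := h.integral_comp_mul_crossL hP (χ := fun _ => 1) continuous_const (by simp) hη hηc v
    simp only [one_mul, intervalIntegral.integral_const, sub_zero, smul_eq_mul, mul_one] at hid
    have hk := fun k => h.integral_comp_mul_crossL hP (hχ k).continuous (hχ1 k) hη hηc v
    have hl1 : Tendsto (fun k => ∫ x, χ k (ψ x) * (η x * crossL (Φ x) v)) atTop
        (𝓝 (∫ x, Lᶜ.indicator 1 (ψ x) * (η x * crossL (Φ x) v))) := by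
      refine tendsto_integral_of_dominated_convergence _
        (fun k => ((hχ k).continuous.comp h.continuous).aestronglyMeasurable.mul hint.1) hint.norm
        (fun k => Eventually.of_forall fun x => ?_)
        (Eventually.of_forall fun x => (hχt (ψ x)).mul_const _)
      rw [norm_mul]
      exact mul_le_of_le_one_left (norm_nonneg _) (hχ1 k _)
    have hT : ∀ t, Tendsto (fun k => ∫ s in (0 : ℝ)..t, χ k s) atTop (𝓝 t) := by
      intro t
      have : Tendsto (fun k => ∫ s in (0 : ℝ)..t, χ k s) atTop
          (𝓝 (∫ s in (0 : ℝ)..t, (1 : ℝ))) := by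
        refine intervalIntegral.tendsto_integral_filter_of_dominated_convergence (fun _ => 1)
          (Eventually.of_forall fun k => (hχ k).continuous.aestronglyMeasurable)
          (Eventually.of_forall fun k => Eventually.of_forall fun s _ => hχ1 k s)
          intervalIntegrable_const ?_
        filter_upwards [measure_eq_zero_iff_ae_notMem.1 hL0] with s hs _
        have := hχt s
        rwa [Set.indicator_of_mem (by simpa using hs)] at this
      simpa using this
    have hl2 : Tendsto (fun k => ∫ x, (∫ s in (0 : ℝ)..ψ x, χ k s) * fderiv ℝ η x v) atTop
        (𝓝 (∫ x, ψ x * fderiv ℝ η x v)) := by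
      refine tendsto_integral_of_dominated_convergence (fun x => |ψ x| * |fderiv ℝ η x v|)
        (fun k => (((intervalIntegral.continuous_primitive
          (fun a b => (hχ k).continuous.intervalIntegrable a b) 0).comp h.continuous).mul
            hηv).aestronglyMeasurable) ?_
        (fun k => Eventually.of_forall fun x => ?_)
        (Eventually.of_forall fun x => (hT (ψ x)).mul_const _)
      · exact Continuous.integrable_of_hasCompactSupport (h.continuous.abs.mul hηv.abs)
          ((hηvc.comp_left (g := fun t => |t|) abs_zero).mul_left)
      · rw [norm_mul]
        refine mul_le_mul_of_nonneg_right ?_ (norm_nonneg _)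
        have := intervalIntegral.norm_integral_le_of_norm_le_const (a := 0) (b := ψ x) (f := χ k)
          (C := 1) fun s _ => hχ1 k s
        simpa using this
    simp only [hk] at hl1
    have heq := tendsto_nhds_unique hl1 hl2.neg
    rw [← hid] at heq
    simp only [smul_eq_mul, mul_sub]
    rw [integral_sub hint hint2, sub_eq_zero, ← heq]
    exact integral_congr_ae (Eventually.of_forall fun x => by ring)
  filter_upwards [key (EuclideanSpace.single 1 1), key (EuclideanSpace.single 0 1)] with x h0 h1 hx
  rw [Set.indicator_of_notMem (by simpa using hx), zero_mul, sub_zero, crossL_apply] at h0 h1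
  ext i
  fin_cases i
  · simpa using h0
  · simpa using h1

end StreamApprox

/-! ### Orthogonality to the gradients of `W^{1,p}` -/

lemma ConjExponents.holderConjugate {p : ℝ} {q : ENNReal} (h : ConjExponents p q) :
    (ENNReal.ofReal p).HolderConjugate q := by
  rcases h with ⟨rfl, rfl⟩ | ⟨q', h, rfl⟩
  · rw [ENNReal.ofReal_one]; infer_instance
  · exact h.ennrealOfReal

lemma MeasureTheory.MemLp.mono_exponent_of_eq_zero_off {F : Type*} [NormedAddCommGroup F]
    {f : Euc 2 → F} {B : Set (Euc 2)} (hB : volume B ≠ ⊤) {p q : ENNReal} (hpq : p ≤ q) (hp : 1 ≤ p)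
    (hf : MemLp f q) (h0 : ∀ x ∉ B, f x = 0) : MemLp f p := by
  refine ⟨hf.1, (eLpNorm_le_of_eq_zero_off hpq hf.1 h0).trans_lt (ENNReal.mul_lt_top hf.2 ?_)⟩
  refine (ENNReal.rpow_ne_top_of_nonneg ?_ hB).lt_top
  rcases eq_or_ne q ⊤ with rfl | hq
  · simp
  · rw [sub_nonneg]
    refine one_div_le_one_div_of_le ?_ (ENNReal.toReal_mono hq hpq)
    exact ENNReal.toReal_pos (by positivity) (ne_top_of_le_ne_top hq hpq)

/-- A field of `L^q` which is orthogonal to the gradients of `W^{1,2}(Ω)` is the limit of a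
sequence of regularizations together with their stream functions; the limit stream function maps
the complement of an admissible domain to a null set. -/
lemma OrthogonalToGradients.exists_streamApprox {p : ℝ} {q : ENNReal} (hpq : ConjExponents p q)
    (hp : 1 ≤ p) (hp2 : p < 2) {Ω : Set (Euc 2)} (hΩ : AdmissibleDomain p Ω)
    {Φ : Euc 2 → Euc 2} (h : OrthogonalToGradients Ω Φ) (hΦ : MemLp Φ q) :
    ∃ R ψ F ψ', StreamApprox R q Φ ψ F ψ' ∧ volume (ψ '' Ωᶜ) = 0 := by
  obtain ⟨ε, Ψ, hε, hε1, hεt, hΨ, hΨd, hsum⟩ := h.exists_approx hΩ.isOpen hΩ.isBounded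
  obtain ⟨R, hR⟩ := hΩ.isBounded.subset_closedBall (0 : Euc 2)
  set F : ℕ → Euc 2 → Euc 2 := fun n => mollify (ε n) Φ with hF
  have hFs : ∀ n, ContDiff ℝ ∞ (F n) := fun n => contDiff_mollify (hε n) h.locallyIntegrable
  have hFd : ∀ n x, dvg (F n) x = 0 := fun n x => h.dvg_mollify_eq_zero hΩ.isOpen (hε n) x
  have hstream : ∀ n, ∃ φ : Euc 2 → ℝ, ContDiff ℝ ∞ φ ∧
      (∀ x, HasFDerivAt φ (crossL (F n x)) x) ∧ φ 0 = 0 := by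
    intro n
    obtain ⟨φ, hφ, hφd⟩ := exists_stream_function (hFs n) (hFd n)
    exact ⟨fun x => φ x - φ 0, hφ.sub contDiff_const, fun x => (hφd x).sub_const _, sub_self _⟩
  choose ψ' hψs hψd hψ0 using hstream
  have hF0 : ∀ n, ∀ x ∉ Metric.closedBall (0 : Euc 2) (R + 1), F n x = 0 := by
    intro n x hx
    refine mollify_eq_zero (hε n) fun y hy => h.eq_zero y fun h' => hx ?_
    have h1 := hR h'
    rw [Metric.mem_closedBall] at h1 ⊢
    linarith [dist_triangle x y 0, hε1 n]
  have hΦ0 : ∀ x ∉ Metric.closedBall (0 : Euc 2) R, Φ x = 0 := fun x hx =>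
    h.eq_zero x fun h' => hx (hR h')
  have hball : ∀ r, volume (Metric.closedBall (0 : Euc 2) r) ≠ ⊤ := fun r =>
    (isCompact_closedBall _ _).measure_lt_top.ne
  have hFm : ∀ n, eLpNorm (F n) q volume ≤ eLpNorm Φ q volume := fun n =>
    eLpNorm_mollify_le (hε n) hpq.one_le hΦ.1
  have hL1 : Tendsto (fun n => ∫⁻ x, ‖F n x - Φ x‖ₑ) atTop (𝓝 0) := by
    have h1 : MemLp Φ 1 := hΦ.mono_exponent_of_eq_zero_off (hball R) hpq.one_le le_rfl hΦ0
    have h2 := (tendsto_eLpNorm_mollify_sub le_rfl (by simp) h1).comp hεt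
    simp only [Function.comp_def, eLpNorm_one_eq_lintegral_enorm] at h2
    exact h2
  obtain ⟨p', q', hp1', hp2', hpq', hq't, hq'q⟩ := hpq.exists_ne_top hp hp2
  have hq' : MemLp Φ q' := hΦ.mono_exponent_of_eq_zero_off (hball R) hq'q hpq'.one_le hΦ0
  obtain ⟨ψ, hψc, hψu⟩ := exists_tendstoUniformlyOn_stream (fun n => (hFs n).continuous) hΦ.1 hψd
    hψ0 hpq' hp1' hp2' ((tendsto_eLpNorm_mollify_sub hpq'.one_le hq't hq').comp hεt)
  have happrox : StreamApprox (R + 1) q Φ ψ F ψ' :=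
    ⟨hFs, hFd, hF0, hψs, hψd, hΦ, hFm, hL1, hψc, hψu⟩
  refine ⟨_, _, _, _, happrox, hΩ.volume_image_compl_eq_zero (fun K hK hKΩ x hx y hy => ?_)
    fun S hS => ?_⟩
  · exact eq_of_isPreconnected_compl hK hKΩ hΨ hΨd (fun n => (hFs n).continuous) hψd hsum hψc
      happrox.tendsto hx hy
  · exact volume_image_eq_zero_of_tendsto (fun n => (hFs n).continuous) hψd hpq hp hp2 hΦ.2.ne hFm
      happrox.tendsto hS

/-- On an admissible domain, a field of `L^q` orthogonal to the gradients of `W^{1,2}(Ω)` is also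
orthogonal to the weak gradients in `L^p`. -/
lemma OrthogonalToGradients.integral_inner_eq_zero {p : ℝ} {q : ENNReal}
    (hpq : ConjExponents p q) (hp : 1 ≤ p) (hp2 : p < 2) {Ω : Set (Euc 2)}
    (hΩ : AdmissibleDomain p Ω) {Φ : Euc 2 → Euc 2} (h : OrthogonalToGradients Ω Φ)
    (hΦ : MemLp Φ q) {u : Euc 2 → ℝ} {g : Euc 2 → Euc 2} (hu : HasWeakGradient Ω u g)
    (hg : MemLp g (ENNReal.ofReal p) (volume.restrict Ω)) :
    ∫ x in Ω, inner ℝ (g x) (Φ x) = 0 := by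
  have := hpq.holderConjugate
  obtain ⟨R, ψ, F, ψ', happrox, hnull⟩ := h.exists_streamApprox hpq hp hp2 hΩ hΦ
  set L := ψ '' (Ωᶜ ∩ Metric.closedBall 0 R) with hL
  have hLc : IsClosed L :=
    (((isCompact_closedBall (0 : Euc 2) R).inter_left hΩ.isOpen.isClosed_compl).image
      happrox.continuous).isClosed
  have hL0 : volume L = 0 :=
    measure_mono_null (Set.image_mono Set.inter_subset_left) hnull
  rw [← happrox.integral_indicator_eq_zero ENNReal.ofReal_ne_top hLc hL.symm.subset hu hg]
  refine integral_congr_ae (ae_restrict_of_ae ?_)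
  filter_upwards [happrox.ae_eq_zero_of_mem (P := ENNReal.ofReal p) ENNReal.ofReal_ne_top hLc hL0]
    with x hx
  by_cases hxL : ψ x ∈ L
  · rw [hx hxL, inner_zero_right, mul_zero]
  · rw [Set.indicator_of_mem (by simpa using hxL), Pi.one_apply, one_mul]

/-! ### Density criterion in `L^p` by duality -/

section Duality

variable {α E : Type*} [MeasurableSpace α] {μ : Measure α} [IsFiniteMeasure μ]
  [NormedAddCommGroup E] [InnerProductSpace ℝ E]

/-- A functional on `L²` which is bounded for the `L¹` norm is represented by a bounded function: it
is tested with the unit field `Φ / ‖Φ‖` on the set where `‖Φ‖` exceeds the bound. -/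
lemma memLp_top_of_integral_inner_le {Φ : α → E} (hm : StronglyMeasurable Φ) (hΦ : MemLp Φ 2 μ)
    {C : ℝ} (hC : 0 ≤ C) (h : ∀ f : α → E, MemLp f 2 μ →
      |∫ x, inner ℝ (Φ x) (f x) ∂μ| ≤ C * (eLpNorm f 1 μ).toReal) : MemLp Φ ⊤ μ := by
  set A : Set α := {x | C < ‖Φ x‖} with hA
  have hAm : MeasurableSet A := measurableSet_lt measurable_const hm.norm.measurable
  have hn : Measurable fun x => ‖Φ x‖⁻¹ := hm.norm.measurable.inv
  set f : α → E := A.indicator fun x => ‖Φ x‖⁻¹ • Φ x with hf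
  have hfm : StronglyMeasurable f := (hn.stronglyMeasurable.smul hm).indicator hAm
  have hf1 : ∀ x, ‖f x‖ ≤ A.indicator 1 x := by
    intro x
    by_cases hx : x ∈ A
    · rw [hf, Set.indicator_of_mem hx, Set.indicator_of_mem hx, norm_smul, norm_inv, norm_norm]
      exact inv_mul_le_one
    · rw [hf, Set.indicator_of_notMem hx, Set.indicator_of_notMem hx, norm_zero]
  have hf2 : MemLp f 2 μ :=
    MemLp.of_bound hfm.aestronglyMeasurable 1 (Eventually.of_forall fun x =>
      (hf1 x).trans (Set.indicator_le_self' (fun _ _ => zero_le_one) x))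
  have hinner : ∀ x, inner ℝ (Φ x) (f x) = A.indicator (fun x => ‖Φ x‖) x := by
    intro x
    by_cases hx : x ∈ A
    · rw [hf, Set.indicator_of_mem hx, Set.indicator_of_mem hx, inner_smul_right,
        real_inner_self_eq_norm_sq]
      rcases eq_or_ne ‖Φ x‖ 0 with h0 | h0
      · simp [h0]
      · field_simp
    · rw [hf, Set.indicator_of_notMem hx, Set.indicator_of_notMem hx, inner_zero_right]
  have hint : IntegrableOn (fun x => ‖Φ x‖) A μ :=
    (hΦ.integrable (by norm_num)).norm.integrableOn
  have hconst : IntegrableOn (fun _ => C) A μ := integrableOn_const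
  have hnorm : (eLpNorm f 1 μ).toReal ≤ μ.real A := by
    rw [eLpNorm_one_eq_lintegral_enorm, ← integral_norm_eq_lintegral_enorm hf2.1,
      ← integral_indicator_one hAm]
    exact integral_mono (hf2.integrable (by norm_num)).norm
      ((integrable_const 1).indicator hAm) hf1
  have hA0 : μ A = 0 := by
    have hle : ∫ x in A, ‖Φ x‖ ∂μ ≤ ∫ x in A, C ∂μ := by
      have h1 := (le_abs_self _).trans (h f hf2)
      simp only [hinner] at h1
      rw [integral_indicator hAm] at h1
      rw [setIntegral_const, smul_eq_mul, mul_comm]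
      exact h1.trans (mul_le_mul_of_nonneg_left hnorm hC)
    by_contra hne
    have hpos : 0 < ∫ x in A, (‖Φ x‖ - C) ∂μ := by
      refine (setIntegral_pos_iff_support_of_nonneg_ae (f := fun x => ‖Φ x‖ - C) ?_
        (hint.sub hconst)).2 ?_
      rotate_left
      · refine (pos_iff_ne_zero.2 hne).trans_le (measure_mono fun x hx => ⟨?_, hx⟩)
        exact (sub_pos.2 hx).ne'
      · filter_upwards [ae_restrict_mem hAm] with x hx using (sub_pos.2 hx).le
    rw [integral_sub hint hconst] at hpos
    linarith
  refine MemLp.of_bound hΦ.1 C ?_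
  filter_upwards [measure_eq_zero_iff_ae_notMem.1 hA0] with x hx
  exact not_lt.1 hx

/-- A functional on `L²` which is bounded for the `L^p` norm, `p > 1`, is represented by a function
of `L^q`: it is tested with truncations of `‖Φ‖ ^ (q - 2) • Φ`. -/
lemma memLp_of_integral_inner_le {p q : ℝ} (hpq : p.HolderConjugate q) {Φ : α → E}
    (hm : StronglyMeasurable Φ) {C : ℝ} (hC : 0 ≤ C) (h : ∀ f : α → E, MemLp f 2 μ →
      |∫ x, inner ℝ (Φ x) (f x) ∂μ| ≤ C * (eLpNorm f (ENNReal.ofReal p) μ).toReal) :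
    MemLp Φ (ENNReal.ofReal q) μ := by
  have hp0 := hpq.pos
  have hq0 := hpq.symm.pos
  have hq1 := hpq.symm.lt
  set A : ℕ → Set α := fun n => {x | ‖Φ x‖ ≤ n} with hA
  have hAm : ∀ n, MeasurableSet (A n) := fun n =>
    measurableSet_le hm.norm.measurable measurable_const
  set φ : α → ℝ := fun x => ‖Φ x‖ ^ q with hφ
  have hφm : Measurable φ := hm.norm.measurable.pow_const q
  have hφ0 : ∀ x, 0 ≤ φ x := fun x => by positivity
  have hbound : ∀ n, ∫ x, (A n).indicator φ x ∂μ ≤ C ^ q ∧ Integrable ((A n).indicator φ) μ := by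
    intro n
    set J := ∫ x, (A n).indicator φ x ∂μ with hJ
    set f : α → E := (A n).indicator fun x => ‖Φ x‖ ^ (q - 2) • Φ x with hf
    have hfm : StronglyMeasurable f :=
      ((hm.norm.measurable.pow_const (q - 2)).stronglyMeasurable.smul hm).indicator (hAm n)
    have hpow : ∀ x, ‖‖Φ x‖ ^ (q - 2) • Φ x‖ = ‖Φ x‖ ^ (q - 1) := by
      intro x
      rw [norm_smul, Real.norm_of_nonneg (by positivity)]
      rcases (norm_nonneg (Φ x)).eq_or_lt with h0 | h0
      · rw [← h0, mul_zero, Real.zero_rpow (by linarith)]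
      · rw [← Real.rpow_add_one h0.ne']
        congr 1; ring
    have hf2 : ∀ r, MemLp f r μ := by
      intro r
      refine MemLp.of_bound hfm.aestronglyMeasurable ((n : ℝ) ^ (q - 1))
        (Eventually.of_forall fun x => ?_)
      by_cases hx : x ∈ A n
      · rw [hf, Set.indicator_of_mem hx, hpow]
        exact Real.rpow_le_rpow (norm_nonneg _) hx (by linarith)
      · rw [hf, Set.indicator_of_notMem hx, norm_zero]
        positivity
    have hinner : ∀ x, inner ℝ (Φ x) (f x) = (A n).indicator φ x := by
      intro x
      by_cases hx : x ∈ A n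
      · rw [hf, Set.indicator_of_mem hx, Set.indicator_of_mem hx, inner_smul_right,
          real_inner_self_eq_norm_sq, hφ]
        rcases (norm_nonneg (Φ x)).eq_or_lt with h0 | h0
        · simp only [← h0]
          rw [Real.zero_rpow hq0.ne']
          simp
        · rw [← Real.rpow_natCast, ← Real.rpow_add h0]
          congr 1
          push_cast; ring
      · rw [hf, Set.indicator_of_notMem hx, Set.indicator_of_notMem hx, inner_zero_right]
    have hfp : ∀ x, ‖f x‖ ^ p = (A n).indicator φ x := by
      intro x
      by_cases hx : x ∈ A n
      · rw [hf, Set.indicator_of_mem hx, Set.indicator_of_mem hx, hpow,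
          ← Real.rpow_mul (norm_nonneg _), hpq.symm.sub_one_mul_conj]
      · rw [hf, Set.indicator_of_notMem hx, Set.indicator_of_notMem hx, norm_zero,
          Real.zero_rpow hp0.ne']
    have hJ0 : 0 ≤ J := integral_nonneg fun x => Set.indicator_nonneg (fun x _ => hφ0 x) x
    have h1 := (le_abs_self _).trans (h f (hf2 2))
    rw [(hf2 _).eLpNorm_eq_integral_rpow_norm (by simpa using hp0) ENNReal.ofReal_ne_top,
      ENNReal.toReal_ofReal hp0.le] at h1
    simp only [hinner, hfp] at h1
    rw [← hJ, ENNReal.toReal_ofReal (by positivity)] at h1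
    refine ⟨?_, ?_⟩
    · rcases hJ0.eq_or_lt with h0 | h0
      · rw [← h0]; positivity
      · have h2 : J ^ q⁻¹ ≤ C := by
          have h3 : J = J ^ q⁻¹ * J ^ p⁻¹ := by
            rw [← Real.rpow_add h0, hpq.symm.inv_add_inv_eq_one, Real.rpow_one]
          have h4 : 0 < J ^ p⁻¹ := by positivity
          nth_rw 1 [h3] at h1
          exact le_of_mul_le_mul_right h1 h4
        calc J = (J ^ q⁻¹) ^ q := by
              rw [← Real.rpow_mul hJ0, inv_mul_cancel₀ hq0.ne', Real.rpow_one]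
          _ ≤ C ^ q := Real.rpow_le_rpow (by positivity) h2 hq0.le
    · have h5 := (hf2 (ENNReal.ofReal p)).integrable_norm_rpow (by simpa using hp0)
        ENNReal.ofReal_ne_top
      rw [ENNReal.toReal_ofReal hp0.le] at h5
      exact h5.congr (Eventually.of_forall hfp)
  refine ⟨hm.aestronglyMeasurable, ?_⟩
  rw [eLpNorm_lt_top_iff_lintegral_rpow_enorm_lt_top (by simpa using hq0) ENNReal.ofReal_ne_top,
    ENNReal.toReal_ofReal hq0.le]
  have heq : ∀ x, ‖Φ x‖ₑ ^ q = ENNReal.ofReal (φ x) := fun x => by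
    rw [← ofReal_norm, ENNReal.ofReal_rpow_of_nonneg (norm_nonneg _) hq0.le]
  simp only [heq]
  have hmono : ∀ x, Monotone fun n => ENNReal.ofReal ((A n).indicator φ x) := by
    intro x n m hnm
    refine ENNReal.ofReal_le_ofReal (Set.indicator_le_indicator_of_subset (fun y hy => ?_) hφ0 x)
    exact le_trans (show ‖Φ y‖ ≤ n from hy) (Nat.cast_le.2 hnm)
  have hlim := lintegral_tendsto_of_tendsto_of_monotone (μ := μ)
    (f := fun n x => ENNReal.ofReal ((A n).indicator φ x)) (F := fun x => ENNReal.ofReal (φ x))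
    (fun n => ((hφm.indicator (hAm n)).ennreal_ofReal).aemeasurable)
    (Eventually.of_forall hmono) (Eventually.of_forall fun x => by
      refine tendsto_const_nhds.congr' ?_
      filter_upwards [eventually_ge_atTop ⌈‖Φ x‖⌉₊] with n hn
      rw [Set.indicator_of_mem (show x ∈ A n from Nat.ceil_le.1 hn)])
  refine (le_of_tendsto' hlim fun n => ?_).trans_lt (ENNReal.ofReal_lt_top (r := C ^ q))
  rw [← ofReal_integral_eq_lintegral_ofReal (hbound n).2
    (Eventually.of_forall fun x => Set.indicator_nonneg (fun x _ => hφ0 x) x)]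
  exact ENNReal.ofReal_le_ofReal (hbound n).1

variable [CompleteSpace E]

/-- Riesz representation on `L²`, restricted to functionals which are continuous for the
`L^p` norm. -/
lemma exists_forall_eq_integral_inner {p : ℝ} {q : ENNReal} (hpq : ConjExponents p q)
    (hp : 1 ≤ p) (hp2 : p < 2) [Fact (1 ≤ ENNReal.ofReal p)]
    (ℓ : StrongDual ℝ (Lp E (ENNReal.ofReal p) μ)) :
    ∃ Φ : α → E, StronglyMeasurable Φ ∧ MemLp Φ 2 μ ∧ MemLp Φ q μ ∧
      ∀ (f : α → E) (_ : MemLp f 2 μ) (hf : MemLp f (ENNReal.ofReal p) μ),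
        ℓ (hf.toLp f) = ∫ x, inner ℝ (Φ x) (f x) ∂μ := by
  have hle : ENNReal.ofReal p ≤ 2 := by
    rw [← ENNReal.ofReal_ofNat]
    exact ENNReal.ofReal_le_ofReal hp2.le
  let ι₀ : Lp E 2 μ →ₗ[ℝ] Lp E (ENNReal.ofReal p) μ :=
    { toFun := fun f => ((Lp.memLp f).mono_exponent hle).toLp f
      map_add' := fun f g => by
        rw [← MemLp.toLp_add, MemLp.toLp_eq_toLp_iff]
        exact Lp.coeFn_add f g
      map_smul' := fun c f => by
        rw [RingHom.id_apply, ← MemLp.toLp_const_smul, MemLp.toLp_eq_toLp_iff]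
        exact Lp.coeFn_smul c f }
  have hexp : (0 : ℝ) ≤ 1 / (ENNReal.ofReal p).toReal - 1 / (2 : ENNReal).toReal := by
    rw [ENNReal.toReal_ofReal (by linarith), sub_nonneg]
    exact one_div_le_one_div_of_le (by linarith) (by simpa using hp2.le)
  set K := μ Set.univ ^ (1 / (ENNReal.ofReal p).toReal - 1 / (2 : ENNReal).toReal) with hK
  have hKt : K ≠ ⊤ := ENNReal.rpow_ne_top_of_nonneg hexp (measure_ne_top _ _)
  let ι : Lp E 2 μ →L[ℝ] Lp E (ENNReal.ofReal p) μ := ι₀.mkContinuous K.toReal fun f => by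
    change ‖((Lp.memLp f).mono_exponent hle).toLp f‖ ≤ _
    rw [Lp.norm_toLp, Lp.norm_def, mul_comm, ← ENNReal.toReal_mul]
    exact ENNReal.toReal_mono (ENNReal.mul_ne_top (Lp.memLp f).2.ne hKt)
      (eLpNorm_le_eLpNorm_mul_rpow_measure_univ hle (Lp.memLp f).1)
  set Φ : Lp E 2 μ := (InnerProductSpace.toDual ℝ (Lp E 2 μ)).symm (ℓ.comp ι) with hΦ
  have hrep : ∀ (f : α → E) (_ : MemLp f 2 μ) (hf : MemLp f (ENNReal.ofReal p) μ),
        ℓ (hf.toLp f) = ∫ x, inner ℝ (Φ x) (f x) ∂μ := by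
    intro f hf2 hf
    have h1 : inner ℝ Φ (hf2.toLp f) = ℓ (ι (hf2.toLp f)) := by
      rw [hΦ, InnerProductSpace.toDual_symm_apply]
      rfl
    have h2 : ι (hf2.toLp f) = hf.toLp f := by
      change ((Lp.memLp (hf2.toLp f)).mono_exponent hle).toLp _ = _
      rw [MemLp.toLp_eq_toLp_iff]
      exact hf2.coeFn_toLp
    rw [← h2, ← h1, L2.inner_def]
    refine integral_congr_ae ?_
    filter_upwards [hf2.coeFn_toLp] with x hx
    rw [hx]
  obtain ⟨C, hC, hbd⟩ : ∃ C : ℝ, 0 ≤ C ∧ ∀ f : α → E, MemLp f 2 μ →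
      |∫ x, inner ℝ (Φ x) (f x) ∂μ| ≤ C * (eLpNorm f (ENNReal.ofReal p) μ).toReal := by
    refine ⟨‖ℓ‖, norm_nonneg ℓ, fun f hf => ?_⟩
    rw [← hrep f hf (hf.mono_exponent hle), ← Lp.norm_toLp f (hf.mono_exponent hle)]
    exact ℓ.le_opNorm _
  refine ⟨Φ, Lp.stronglyMeasurable Φ, Lp.memLp Φ, ?_, hrep⟩
  rcases hpq with ⟨rfl, rfl⟩ | ⟨q', h, rfl⟩
  · refine memLp_top_of_integral_inner_le (Lp.stronglyMeasurable Φ) (Lp.memLp Φ) hC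
      fun f hf => ?_
    have := hbd f hf
    rwa [ENNReal.ofReal_one] at this
  · exact memLp_of_integral_inner_le h (Lp.stronglyMeasurable Φ) hC hbd

/-- A function `g` of `L^p` is in the closure of a linear space of square integrable functions for
the `L^p` norm, provided that every function of `L^q` orthogonal to the space is orthogonal to `g`. -/
lemma exists_eLpNorm_sub_lt_of_orthogonal {p : ℝ} {q : ENNReal} (hpq : ConjExponents p q)
    (hp : 1 ≤ p) (hp2 : p < 2) (N : Submodule ℝ (α → E)) (hN : ∀ G ∈ N, MemLp G 2 μ) {g : α → E}
    (hg : MemLp g (ENNReal.ofReal p) μ)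
    (horth : ∀ Φ : α → E, StronglyMeasurable Φ → MemLp Φ 2 μ → MemLp Φ q μ →
      (∀ G ∈ N, ∫ x, inner ℝ (G x) (Φ x) ∂μ = 0) → ∫ x, inner ℝ (g x) (Φ x) ∂μ = 0)
    {ε : ENNReal} (hε : ε ≠ 0) :
    ∃ G ∈ N, eLpNorm (G - g) (ENNReal.ofReal p) μ < ε := by
  have hle : ENNReal.ofReal p ≤ 2 := by
    rw [← ENNReal.ofReal_ofNat]
    exact ENNReal.ofReal_le_ofReal hp2.le
  have hfact : Fact (1 ≤ ENNReal.ofReal p) := ⟨by simpa using hp⟩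
  have hconj := hpq.holderConjugate
  let N' : Submodule ℝ (Lp E (ENNReal.ofReal p) μ) :=
    { carrier := {f | ∃ G ∈ N, f =ᵐ[μ] G}
      zero_mem' := ⟨0, N.zero_mem, Lp.coeFn_zero _ _ _⟩
      add_mem' := by
        rintro a b ⟨G, hG, hGa⟩ ⟨H, hH, hHb⟩
        exact ⟨G + H, N.add_mem hG hH, (Lp.coeFn_add a b).trans (hGa.add hHb)⟩
      smul_mem' := by
        rintro c a ⟨G, hG, hGa⟩
        exact ⟨c • G, N.smul_mem c hG, (Lp.coeFn_smul c a).trans (hGa.const_smul c)⟩ }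
  have hmem : ∀ (G : α → E) (hG : G ∈ N), ((hN G hG).mono_exponent hle).toLp G ∈ N' :=
    fun G hG => ⟨G, hG, MemLp.coeFn_toLp _⟩
  by_cases hcl : hg.toLp g ∈ closure (N' : Set (Lp E (ENNReal.ofReal p) μ))
  · obtain ⟨f, ⟨G, hG, hGf⟩, hf⟩ := EMetric.mem_closure_iff.1 hcl ε (pos_iff_ne_zero.2 hε)
    refine ⟨G, hG, ?_⟩
    rw [edist_comm, Lp.edist_def] at hf
    refine lt_of_le_of_lt (le_of_eq (eLpNorm_congr_ae ?_)) hf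
    exact hGf.symm.sub hg.coeFn_toLp.symm
  · -- a functional bounded above on a linear space vanishes there
    exfalso
    obtain ⟨ℓ, c, hℓ, hc⟩ := geometric_hahn_banach_closed_point
      (N'.convex.closure) isClosed_closure hcl
    have hc0 : 0 < c := by
      have := hℓ 0 (subset_closure N'.zero_mem)
      rwa [map_zero] at this
    have hℓ0 : ∀ f ∈ N', ℓ f = 0 := by
      intro f hf
      by_contra hne
      have := hℓ ((c / ℓ f) • f) (subset_closure (N'.smul_mem _ hf))
      rw [map_smul, smul_eq_mul, div_mul_cancel₀ _ hne] at this
      exact lt_irrefl _ this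
    obtain ⟨Φ, hΦm, hΦ2, hΦq, hrep⟩ := exists_forall_eq_integral_inner hpq hp hp2 ℓ
    have hgΦ : ∫ x, inner ℝ (Φ x) (g x) ∂μ = 0 := by
      simp only [real_inner_comm]
      refine horth Φ hΦm hΦ2 hΦq fun G hG => ?_
      have := hrep G (hN G hG) ((hN G hG).mono_exponent hle)
      rw [hℓ0 _ (hmem G hG)] at this
      simp only [real_inner_comm, ← this]
    have hzero : ℓ (hg.toLp g) = 0 := by
      rw [← norm_le_zero_iff]
      refine le_of_forall_pos_le_add fun δ hδ => ?_
      set K : ℝ := ‖ℓ‖ + (eLpNorm Φ q μ).toReal + 1 with hK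
      have hK0 : 0 < K := by positivity
      obtain ⟨s, hs, hsp⟩ := hg.exists_simpleFunc_eLpNorm_sub_lt ENNReal.ofReal_ne_top
        (ε := ENNReal.ofReal (δ / K)) (by simp; positivity)
      have hs2 : MemLp s 2 μ := s.memLp_of_isFiniteMeasure 2 μ
      have hd : (eLpNorm (g - ⇑s) (ENNReal.ofReal p) μ).toReal ≤ δ / K :=
        ENNReal.toReal_le_of_le_ofReal (by positivity) hs.le
      have h1 : ‖ℓ (hg.toLp g) - ℓ (hsp.toLp s)‖ ≤ ‖ℓ‖ * (δ / K) := by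
        rw [← map_sub, ← MemLp.toLp_sub]
        refine (ℓ.le_opNorm _).trans ?_
        rw [Lp.norm_toLp]
        gcongr
      have h2 : ‖ℓ (hsp.toLp s)‖ ≤ (eLpNorm Φ q μ).toReal * (δ / K) := by
        have hi : ∀ f : α → E, MemLp f (ENNReal.ofReal p) μ →
            Integrable (fun x => inner ℝ (Φ x) (f x)) μ := fun f hf => by
          simpa using integrable_mul_inner hΦq hf (aestronglyMeasurable_const (b := (1 : ℝ)))
            (by simp)
        have h3 : ℓ (hsp.toLp s) = - ∫ x, inner ℝ (Φ x) ((g - ⇑s) x) ∂μ := by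
          rw [hrep s hs2 hsp]
          simp only [Pi.sub_apply, inner_sub_right]
          rw [integral_sub (hi g hg) (hi s hsp), hgΦ, zero_sub, neg_neg]
        rw [h3, norm_neg]
        have h4 : ‖∫ x, inner ℝ (Φ x) ((g - ⇑s) x) ∂μ‖ₑ ≤
            eLpNorm Φ q μ * eLpNorm (g - ⇑s) (ENNReal.ofReal p) μ := by
          refine (enorm_integral_le_lintegral_enorm _).trans
            (le_trans (lintegral_mono fun x => ?_)
              (lintegral_enorm_mul_le hΦq.1 (hg.1.sub hsp.1)))
          rw [← ofReal_norm, ← ofReal_norm, ← ofReal_norm, ← ENNReal.ofReal_mul (norm_nonneg _)]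
          exact ENNReal.ofReal_le_ofReal (norm_inner_le_norm _ _)
        have h5 := ENNReal.toReal_mono (ENNReal.mul_ne_top hΦq.2.ne (hg.sub hsp).2.ne) h4
        rw [toReal_enorm, ENNReal.toReal_mul] at h5
        exact h5.trans (mul_le_mul_of_nonneg_left hd ENNReal.toReal_nonneg)
      calc ‖ℓ (hg.toLp g)‖ ≤ ‖ℓ (hg.toLp g) - ℓ (hsp.toLp s)‖ + ‖ℓ (hsp.toLp s)‖ := by
            simpa using norm_add_le (ℓ (hg.toLp g) - ℓ (hsp.toLp s)) (ℓ (hsp.toLp s))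
        _ ≤ ‖ℓ‖ * (δ / K) + (eLpNorm Φ q μ).toReal * (δ / K) := add_le_add h1 h2
        _ ≤ K * (δ / K) := by
            rw [← add_mul]
            gcongr
            linarith
        _ = 0 + δ := by field_simp; ring
    rw [hzero] at hc
    exact absurd hc hc0.not_gt

end Duality

/-! ### The space of weak gradients and the density theorem -/

lemma integrableOn_mul_of_tsupport_subset {Ω : Set (Euc 2)} (hΩ : IsOpen Ω) {f ζ : Euc 2 → ℝ}
    (hf : LocallyIntegrableOn f Ω) (hζ : Continuous ζ) (hc : HasCompactSupport ζ)
    (hs : tsupport ζ ⊆ Ω) : IntegrableOn (fun x => f x * ζ x) Ω := by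
  have h1 : IntegrableOn f (tsupport ζ) := hf.integrableOn_compact_subset hs hc
  refine (h1.mul_continuousOn hζ.continuousOn hc).of_forall_sdiff_eq_zero hΩ.measurableSet
    fun x hx => ?_
  rw [image_eq_zero_of_notMem_tsupport hx.2, mul_zero]

lemma locallyIntegrableOn_coord {Ω : Set (Euc 2)} {g : Euc 2 → Euc 2}
    (hg : LocallyIntegrableOn g Ω) (i : Fin 2) : LocallyIntegrableOn (fun x => g x i) Ω :=
  fun x hx =>
    let ⟨s, hs, hi⟩ := hg x hx
    ⟨s, hs, (EuclideanSpace.proj i : Euc 2 →L[ℝ] ℝ).integrable_comp hi⟩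

namespace HasWeakGradient

variable {Ω : Set (Euc 2)} {u u' : Euc 2 → ℝ} {g g' : Euc 2 → Euc 2}

lemma add (hΩ : IsOpen Ω) (h : HasWeakGradient Ω u g) (h' : HasWeakGradient Ω u' g') :
    HasWeakGradient Ω (u + u') (g + g') := by
  refine ⟨h.locallyIntegrable.add h'.locallyIntegrable,
    h.locallyIntegrable_grad.add h'.locallyIntegrable_grad, fun η hη hc hs i => ?_⟩
  have hηd : Continuous fun x => fderiv ℝ η x (EuclideanSpace.single i 1) :=
    (hη.continuous_fderiv (by simp)).clm_apply continuous_const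
  have hηs := (tsupport_fderiv_apply_subset ℝ (EuclideanSpace.single i 1 : Euc 2)).trans hs
  have hηc := hc.fderiv_apply ℝ (EuclideanSpace.single i 1 : Euc 2)
  simp only [Pi.add_apply, PiLp.add_apply, add_mul]
  rw [integral_add (integrableOn_mul_of_tsupport_subset hΩ h.locallyIntegrable hηd hηc hηs)
      (integrableOn_mul_of_tsupport_subset hΩ h'.locallyIntegrable hηd hηc hηs),
    integral_add
      (integrableOn_mul_of_tsupport_subset hΩ
        (locallyIntegrableOn_coord h.locallyIntegrable_grad i) hη.continuous hc hs)
      (integrableOn_mul_of_tsupport_subset hΩ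
        (locallyIntegrableOn_coord h'.locallyIntegrable_grad i) hη.continuous hc hs),
      h.integral_eq η hη hc hs i, h'.integral_eq η hη hc hs i]
  ring

lemma const_smul (h : HasWeakGradient Ω u g) (c : ℝ) : HasWeakGradient Ω (c • u) (c • g) := by
  refine ⟨fun x hx => (h.locallyIntegrable x hx).smul c,
    fun x hx => (h.locallyIntegrable_grad x hx).smul c, fun η hη hc hs i => ?_⟩
  simp only [Pi.smul_apply, PiLp.smul_apply, smul_eq_mul, mul_assoc, integral_const_mul,
    h.integral_eq η hη hc hs i, mul_neg]

/-- Weak gradients are unique up to null sets. -/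
lemma ae_eq (hΩ : IsOpen Ω) (h : HasWeakGradient Ω u g) (h' : HasWeakGradient Ω u g') :
    g =ᵐ[volume.restrict Ω] g' := by
  have hi : ∀ i, ∀ᵐ x, x ∈ Ω → g x i - g' x i = 0 := by
    intro i
    have h1 := locallyIntegrableOn_coord h.locallyIntegrable_grad i
    have h2 := locallyIntegrableOn_coord h'.locallyIntegrable_grad i
    refine hΩ.ae_eq_zero_of_integral_contDiff_smul_eq_zero (h1.sub h2) fun η hη hc hs => ?_
    rw [← setIntegral_eq_integral_of_forall_compl_eq_zero (s := Ω) fun x hx => by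
      rw [image_eq_zero_of_notMem_tsupport fun h => hx (hs h), zero_smul]]
    simp only [smul_eq_mul, mul_comm (η _), sub_mul]
    rw [integral_sub (integrableOn_mul_of_tsupport_subset hΩ h1 hη.continuous hc hs)
      (integrableOn_mul_of_tsupport_subset hΩ h2 hη.continuous hc hs), sub_eq_zero, ← neg_inj,
      ← h.integral_eq η hη hc hs i, ← h'.integral_eq η hη hc hs i]
  refine (ae_restrict_iff' hΩ.measurableSet).2 ?_
  filter_upwards [hi 0, hi 1] with x h0 h1 hx
  ext i
  fin_cases i
  · exact sub_eq_zero.1 (h0 hx)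
  · exact sub_eq_zero.1 (h1 hx)

end HasWeakGradient

/-- The space of weak gradients of functions of `W^{1,2}(Ω)`. -/
def sobolevGradients (Ω : Set (Euc 2)) (hΩ : IsOpen Ω) : Submodule ℝ (Euc 2 → Euc 2) where
  carrier := {G | ∃ v, MemLp v 2 (volume.restrict Ω) ∧ HasWeakGradient Ω v G ∧
    MemLp G 2 (volume.restrict Ω)}
  zero_mem' := ⟨0, MemLp.zero, hasWeakGradient_of_hasFDerivAt hΩ
    (fun x _ => (hasFDerivAt_const (0 : ℝ) x).congr_fderiv (by simp)) continuousOn_const,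
    MemLp.zero⟩
  add_mem' := by
    rintro G H ⟨v, hv, hvG, hG⟩ ⟨w, hw, hwH, hH⟩
    exact ⟨v + w, hv.add hw, hvG.add hΩ hwH, hG.add hH⟩
  smul_mem' := by
    rintro c G ⟨v, hv, hvG, hG⟩
    exact ⟨c • v, hv.const_smul c, hvG.const_smul c, hG.const_smul c⟩

/-- Weak gradients in `L^p` on an admissible domain are approximated in `L^p` by weak gradients of
functions of `W^{1,2}(Ω)`. -/
lemma AdmissibleDomain.exists_eLpNorm_sub_lt {p : ℝ} (hp : 1 ≤ p) (hp2 : p < 2) {Ω : Set (Euc 2)}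
    (hΩ : AdmissibleDomain p Ω) {u : Euc 2 → ℝ} {g : Euc 2 → Euc 2} (hu : HasWeakGradient Ω u g)
    (hg : MemLp g (ENNReal.ofReal p) (volume.restrict Ω)) {ε : ENNReal} (hε : ε ≠ 0) :
    ∃ G ∈ sobolevGradients Ω hΩ.isOpen,
      eLpNorm (G - g) (ENNReal.ofReal p) (volume.restrict Ω) < ε := by
  obtain ⟨q, hpq⟩ := exists_conjExponents hp
  have hfin : IsFiniteMeasure (volume.restrict Ω) :=
    ⟨by rw [Measure.restrict_apply_univ]; exact hΩ.isBounded.measure_lt_top⟩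
  refine exists_eLpNorm_sub_lt_of_orthogonal hpq hp hp2 (sobolevGradients Ω hΩ.isOpen)
    (fun G ⟨_, _, _, hG⟩ => hG) hg (fun Φ hΦm hΦ2 hΦq horth => ?_) hε
  have hΩm := hΩ.isOpen.measurableSet
  have hind : ∀ G : Euc 2 → Euc 2, ∫ x in Ω, inner ℝ (G x) (Ω.indicator Φ x) =
      ∫ x in Ω, inner ℝ (G x) (Φ x) := fun G =>
    setIntegral_congr_fun hΩm fun x hx => by simp only [Set.indicator_of_mem hx]
  have hΦ : OrthogonalToGradients Ω (Ω.indicator Φ) :=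
    ⟨(memLp_indicator_iff_restrict hΩm).2 hΦ2, fun x hx => Set.indicator_of_notMem hx _,
      fun v G hv hvG hG => by rw [hind]; exact horth G ⟨v, hv, hvG, hG⟩⟩
  rw [← hind]
  exact hΦ.integral_inner_eq_zero hpq hp hp2 hΩ ((memLp_indicator_iff_restrict hΩm).2 hΦq) hu hg

theorem theorem3p5 (p : ℝ) (hp1 : 1 ≤ p) (hp2 : p < 2) (Ω : Set (Euc 2))
    (hΩ : AdmissibleDomain p Ω) (u : Euc 2 → ℝ) (hu : MemSobolev (ENNReal.ofReal p) Ω u)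
    (g : Euc 2 → Euc 2) (hg : HasWeakGradient Ω u g) :
    ∃ (v : ℕ → Euc 2 → ℝ) (G : ℕ → Euc 2 → Euc 2),
      (∀ n, MemSobolev 2 Ω (v n) ∧ HasWeakGradient Ω (v n) (G n)) ∧
      Tendsto (fun n => eLpNorm (G n - g) (ENNReal.ofReal p) (volume.restrict Ω))
        atTop (𝓝 0) := by
  -- the given weak gradient agrees almost everywhere with one in `L^p`
  obtain ⟨-, g', hg', hgp'⟩ := hu
  have hgp : MemLp g (ENNReal.ofReal p) (volume.restrict Ω) :=
    hgp'.ae_eq (hg'.ae_eq hΩ.isOpen hg)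
  have hex : ∀ n : ℕ, ∃ (v : Euc 2 → ℝ) (G : Euc 2 → Euc 2), (MemSobolev 2 Ω v ∧
      HasWeakGradient Ω v G) ∧
      eLpNorm (G - g) (ENNReal.ofReal p) (volume.restrict Ω) < ((n : ENNReal) + 1)⁻¹ := by
    intro n
    obtain ⟨G, ⟨v, hv, hvG, hG⟩, hlt⟩ := hΩ.exists_eLpNorm_sub_lt hp1 hp2 hg hgp
      (ε := ((n : ENNReal) + 1)⁻¹) (by simp)
    exact ⟨v, G, ⟨⟨hv, G, hvG, hG⟩, hvG⟩, hlt⟩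
  choose v G hvG hlt using hex
  refine ⟨v, G, hvG, ?_⟩
  have hlim : Tendsto (fun n : ℕ => ((n : ENNReal) + 1)⁻¹) atTop (𝓝 0) := by
    simpa using (tendsto_add_atTop_iff_nat 1).2 ENNReal.tendsto_inv_nat_nhds_zero
  exact tendsto_of_tendsto_of_tendsto_of_le_of_le tendsto_const_nhds hlim (fun _ => zero_le)
    (fun n => (hlt n).le)
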